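/- All hyperbolic surfaces are complete, connected and oriented, that is, of the form $\mathbb{H}/\Gamma$ with $\Gamma$ a discrete torsion-free group of orientation-preserving isometries of the hyperbolic plane $\mathbb{H}$. (1) Let $P$ be a hyperbolic pair of pants, that is, a closed subset of a hyperbolic surface that is homeomorphic to a sphere with three holes, each of which is either bounded by a simple closed geodesic or is a cusp. Let $\ell(a),\ell(b),\ell(c)$ be the lengths of the three boundary geodesics, where a cusp has length $0$. Let $a,b\in\pi_1(P)$ be the standard simple loops around the first two holes, oriented in the same sense, so that $ab$ is freely homotopic to a simple loop around the third hole. Then every closed geodesic $\gamma$ that is freely homotopic to $a^{-1}b$ satisfies $$\cosh\frac{\ell(\gamma)}{2}=2\cosh\frac{\ell(a)}{2}\cosh\frac{\ell(b)}{2}+\cosh\frac{\ell(c)}{2}.$$ (2) Every closed geodesic $\gamma$ with exactly one double point on a hyperbolic surface $S$ has length $\ell(\gamma)\ge 2\operatorname{arccosh}3=2\log(3+2\sqrt2)$, and $\ell(\gamma)=2\operatorname{arccosh}3$ if and only if $S$ is a three-cusped sphere (a sphere with three punctures, each of which is a cusp). On every three-cusped sphere there is a closed geodesic with exactly one double point and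 length $2\operatorname{arccosh}3$. -/

import Mathlib

open scoped MatrixGroups UpperHalfPlane unitInterval Topology

noncomputable section

namespace HyperbolicPants

/-! ### Complete oriented hyperbolic surfaces -/

/-- `Γ` is discrete and only `±1` has fixed points in `ℍ`, that is, the group of
orientation-preserving isometries of `ℍ` induced by `Γ` is discrete and torsion-free, so that
`ℍ/Γ` is a complete connected oriented hyperbolic surface. Every such surface arises in this way.
(`Γ` may or may not contain `-1`, which acts trivially.) -/
structure IsSurfaceGroup (Γ : Subgroup SL(2, ℝ)) : Prop where
  discrete : DiscreteTopology Γ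
  free : ∀ g ∈ Γ, ∀ z : ℍ, g • z = z → g = 1 ∨ g = -1

/-- The surface `ℍ/Γ`, with the quotient topology. -/
abbrev Surface (Γ : Subgroup SL(2, ℝ)) : Type := MulAction.orbitRel.Quotient Γ ℍ

/-- The projection `ℍ → ℍ/Γ`. -/
def proj (Γ : Subgroup SL(2, ℝ)) (z : ℍ) : Surface Γ := Quotient.mk _ z

/-! ### Closed geodesics -/

/-- `c` is a closed geodesic of length `ℓ > 0` in `ℍ/Γ`, parametrised by arc length: the
`ℓ`-periodic projection of a complete unit speed geodesic of `ℍ`, that is, of an isometric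
embedding `ℝ → ℍ`. (It may run several times around its image.) -/
structure IsClosedGeodesic (Γ : Subgroup SL(2, ℝ)) (c : ℝ → Surface Γ) (ℓ : ℝ) : Prop where
  pos : 0 < ℓ
  geodesic : ∃ f : ℝ → ℍ, Isometry f ∧ ∀ t, c t = proj Γ (f t)
  periodic : Function.Periodic c ℓ

/-- The closed curve `c` of period `ℓ` has exactly one double point: there is exactly one pair of
different parameters in a period at which it takes the same value. -/
def HasExactlyOneDoublePoint {X : Type*} (c : ℝ → X) (ℓ : ℝ) : Prop :=
  ∃! p : ℝ × ℝ, 0 ≤ p.1 ∧ p.1 < p.2 ∧ p.2 < ℓ ∧ c p.1 = c p.2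

/-- Free homotopy of the loops `u` and `v`, parametrised by `[0,1]`. -/
def FreelyHomotopic {X : Type*} [TopologicalSpace X] (u v : I → X) : Prop :=
  ∃ H : C(I × I, X), (∀ t, H (0, t) = u t) ∧ (∀ t, H (1, t) = v t) ∧ ∀ s, H (s, 0) = H (s, 1)

/-- The holonomy of the loop `u` in `ℍ/Γ` is parabolic: `u` lifts to a path in `ℍ` that runs from
some `z` to `g • z` with `g ∈ Γ` parabolic. -/
def IsParabolicLoop (Γ : Subgroup SL(2, ℝ)) (u : I → Surface Γ) : Prop :=
  ∃ (w : C(I, ℍ)) (g : SL(2, ℝ)), (∀ t, proj Γ (w t) = u t) ∧ g ∈ Γ ∧ w 1 = g • w 0 ∧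
    (g : Matrix (Fin 2) (Fin 2) ℝ).IsParabolic

/-! ### The topological three-holed sphere -/

/-- The three boundary circles, indexed by the holes `0`, `1`, `2`. -/
def holeCircle : Fin 3 → Set ℂ :=
  ![Metric.sphere (-1) (1 / 2), Metric.sphere 1 (1 / 2), Metric.sphere 0 3]

/-- A closed disc minus two disjoint open discs in its interior, from which the boundary circles
with index in `J` are deleted (these holes are punctures). -/
def pantsModel (J : Set (Fin 3)) : Set ℂ :=
  (Metric.closedBall 0 3 \ (Metric.ball (-1) (1 / 2) ∪ Metric.ball 1 (1 / 2))) \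
    ⋃ i ∈ J, holeCircle i

theorem mem_pantsModel {J : Set (Fin 3)} {z : ℂ} (h₂ : ‖z‖ < 3) (h₀ : 1 / 2 < ‖z + 1‖)
    (h₁ : 1 / 2 < ‖z - 1‖) : z ∈ pantsModel J := by
  refine ⟨⟨by simpa using h₂.le, ?_⟩, ?_⟩
  · simp only [Set.mem_union, Metric.mem_ball, dist_eq_norm, sub_neg_eq_add]
    rintro (h | h) <;> linarith
  · simp only [Set.mem_iUnion, not_exists]
    intro i _
    fin_cases i
    · simpa [holeCircle, dist_eq_norm] using h₀.ne'
    · simpa [holeCircle, dist_eq_norm] using h₁.ne'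
    · simpa [holeCircle] using h₂.ne

/-- The unit circle, once around, counterclockwise from `1`. -/
def unitCircle (t : I) : ℂ := Complex.exp (2 * Real.pi * (t : ℝ) * Complex.I)

theorem continuous_unitCircle : Continuous unitCircle := by
  unfold unitCircle; fun_prop

theorem norm_unitCircle (t : I) : ‖unitCircle t‖ = 1 := by
  simpa [unitCircle] using Complex.norm_exp_ofReal_mul_I (2 * Real.pi * (t : ℝ))

theorem unitCircle_zero : unitCircle 0 = 1 := by simp [unitCircle]

theorem unitCircle_one : unitCircle 1 = 1 := by simp [unitCircle]

/-- The base point `0`. -/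
def base (J : Set (Fin 3)) : pantsModel J :=
  ⟨0, mem_pantsModel (by norm_num) (by norm_num) (by norm_num)⟩

/-- The loop `a` based at `0`: the circle of radius `1` about `-1`, counterclockwise. -/
def loopA (J : Set (Fin 3)) : Path (base J) (base J) where
  toFun t := ⟨-1 + unitCircle t, by
    have h := norm_unitCircle t
    refine mem_pantsModel ?_ ?_ ?_
    · have := norm_add_le (-1 : ℂ) (unitCircle t)
      norm_num [h] at this ⊢; linarith
    · norm_num [h]
    · have := norm_sub_norm_le (2 : ℂ) (unitCircle t)
      have e : -1 + unitCircle t - 1 = -(2 - unitCircle t) := by ring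
      rw [e, norm_neg]; norm_num [h] at this ⊢; linarith⟩
  continuous_toFun := (continuous_const.add continuous_unitCircle).subtype_mk _
  source' := Subtype.ext (by simp [unitCircle_zero, base])
  target' := Subtype.ext (by simp [unitCircle_one, base])

/-- The loop `b` based at `0`: the circle of radius `1` about `1`, counterclockwise. -/
def loopB (J : Set (Fin 3)) : Path (base J) (base J) where
  toFun t := ⟨1 - unitCircle t, by
    have h := norm_unitCircle t
    refine mem_pantsModel ?_ ?_ ?_
    · have := norm_sub_le (1 : ℂ) (unitCircle t)
      norm_num [h] at this ⊢; linarith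
    · have := norm_sub_norm_le (2 : ℂ) (unitCircle t)
      have e : 1 - unitCircle t + 1 = 2 - unitCircle t := by ring
      rw [e]; norm_num [h] at this ⊢; linarith
    · have e : 1 - unitCircle t - 1 = -unitCircle t := by ring
      rw [e, norm_neg, h]; norm_num⟩
  continuous_toFun := (continuous_const.sub continuous_unitCircle).subtype_mk _
  source' := Subtype.ext (by simp [unitCircle_zero, base])
  target' := Subtype.ext (by simp [unitCircle_one, base])

/-- The circle of radius `5/2` about `0`, counterclockwise; it is freely homotopic to `a * b`,
and is parallel to the third boundary circle. -/
def loopC (J : Set (Fin 3)) (t : I) : pantsModel J :=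
  ⟨5 / 2 * unitCircle t, by
    have h := norm_unitCircle t
    have h5 : ‖5 / 2 * unitCircle t‖ = 5 / 2 := by norm_num [h]
    refine mem_pantsModel ?_ ?_ ?_
    · rw [h5]; norm_num
    · have := norm_sub_le (5 / 2 * unitCircle t + 1) 1
      rw [add_sub_cancel_right, h5] at this; norm_num at this ⊢; linarith
    · have := norm_add_le (5 / 2 * unitCircle t - 1) 1
      rw [sub_add_cancel, h5] at this; norm_num at this ⊢; linarith⟩

/-- The loops around the three holes. -/
def holeLoop (J : Set (Fin 3)) : Fin 3 → I → pantsModel J :=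
  ![fun t => loopA J t, fun t => loopB J t, loopC J]

/-- The loop `a⁻¹ * b`, which is a figure eight. -/
def figureEight (J : Set (Fin 3)) : Path (base J) (base J) := (loopA J).symm.trans (loopB J)

/-! ### Hyperbolic pairs of pants -/

/-- `h` embeds the three-holed sphere with set of punctures `J` as a hyperbolic pair of pants `P`
in the surface `ℍ/Γ`: `P` is closed, the holes in `J` are cusps (of length `L i = 0`) and every
other boundary component is a simple closed geodesic, of length `L i`. -/
structure IsPairOfPants (Γ : Subgroup SL(2, ℝ)) (J : Set (Fin 3)) (h : pantsModel J → Surface Γ)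
    (L : Fin 3 → ℝ) : Prop where
  isClosedEmbedding : Topology.IsClosedEmbedding h
  cusp : ∀ i ∈ J, IsParabolicLoop Γ (h ∘ holeLoop J i) ∧ L i = 0
  boundary : ∀ i ∉ J, ∃ c : ℝ → Surface Γ, IsClosedGeodesic Γ c (L i) ∧
    Set.InjOn c (Set.Ico 0 (L i)) ∧ Set.range c = h '' {z | (z : ℂ) ∈ holeCircle i}

/-- `ℍ/Γ` is a three-cusped (thrice-punctured) sphere: it is homeomorphic to the sphere with three
punctures, each of which is a cusp. -/
def IsThreeCuspedSphere (Γ : Subgroup SL(2, ℝ)) : Prop :=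
  ∃ h : pantsModel Set.univ → Surface Γ,
    IsPairOfPants Γ Set.univ h (fun _ => 0) ∧ Function.Surjective h

end HyperbolicPants

end

/-!
The proof takes place in the group `Γ ≤ SL(2, ℝ)`. The axis of `X` is described by two functions:
`side X z` is positive, negative or zero according to the position of `z : ℍ` relative to the axis,
and the quadratic form `qf X` vanishes at the fixed points of `X` at infinity, which are represented
by vectors of `ℝ²`. If `side Y` does not change sign along the orbit of a point under the powers of
`X`, then `qf Y` has the same sign at the fixed points of `X` (`qf_nonneg_of_side_nonneg`).
Comparing the forms of `A`, `B` and `A * B` at each other's eigenvectors then shows: if the three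
axes avoid a common connected region invariant under `A` and `B`, and the axes have no common end,
then `tr A * tr B * tr (A * B) < 0` (`tr_mul_tr_mul_tr_neg`). Together with the trace identity
`tr_mul_add`, `tr (A⁻¹ * B) = tr A * tr B - tr (A * B)`, this gives
`|tr (A⁻¹ * B)| = |tr A| * |tr B| + |tr (A * B)|`.

*The length formula.* The loops `a`, `b` and `a * b` have holonomies `A`, `B` and `A * B`. A closed
geodesic of length `ℓ` has holonomy of trace `± 2 * cosh (ℓ / 2)`, and a cusp has one of trace `± 2`
(`IsClosedGeodesic.tr_holonomy`, `IsPairOfPants.tr_holonomy`). The axes of the three holonomies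
project to the boundary curves, which `a` and `b` do not meet, so the lifts of these loops sweep out
a region as above (`side_mul_side_pos`), and the sign rule yields the formula
(`IsPairOfPants.cosh_length`).

*The lower bound.* A geodesic with one double point is moved to the imaginary axis, with translation
`D l`; its double point has two lifts to one period of the axis, and some `A` in the group maps the
first to the second (`IsFigureEight`). The two loops at the double point have holonomies `A` and
`E⁻¹`, where `E = (D l)⁻¹ * A`. As there is no other double point, the axes of `A`, `E` and `A * E`
miss all translates of the geodesic (`simple_axes`), and the union of the lifts through a point
plays the role of the invariant region: up to a common sign change, `A` and `E` have trace at least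
`2` and `A * E` has trace at most `-2` (`tr_le`). So
`2 * cosh (l / 2) = tr A * tr E - tr (A * E) ≥ 6` (`three_le_cosh`).

*Equality.* It forces the three elements to be parabolic. Two of them are then simultaneously
conjugate to the standard parabolic elements (`exists_conj_standard`), and a discrete torsion-free
group containing these and `-1` is the principal congruence subgroup `Gamma2`
(`IsSurfaceGroup.eq_Gamma2`). Conversely, every hyperbolic element of `Gamma2` has an axis that
crosses one of its translates (`crossesConjugate_of_mem`), so `A`, `E` and `A * E` are parabolic
whenever `Γ` is conjugate to `Gamma2`, and equality holds (`cosh_eq_three_iff`).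

*Three-cusped spheres* are exactly the quotients by conjugates of `Gamma2`, once `-1` is adjoined to
the group (`isThreeCuspedSphere_iff`). In one direction, the loops around the punctures have
parabolic holonomies, which do not commute because of their winding numbers
(`IsPantsHolonomy.mul_ne_mul`); the sign rule and the normal form of parabolic pairs determine the
group. In the other direction, `triMap` identifies the closed upper half-plane without two boundary
points with an ideal triangle, and reflecting it gives a map `surfaceMap` from the twice-punctured
plane to the ideal quadrilateral that is a fundamental domain of `Gamma2`, which descends to a
homeomorphism onto the surface (`isThreeCuspedSphere_of_conjGroup_eq`).

*Sharpness.* In `Gamma2`, the axis of `!![5, 2; 2, 1]` projects to a geodesic with one double point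
and length `2 * arcosh 3` (`exists_length_eq`). Its intersections with its translates are governed
by the units of norm `-1` in `ℤ[√2]`, of which only two lie in one period (`eq_of_axis_meets`).
-/

noncomputable section

namespace HyperbolicPants

/-! ### Entries of elements of `SL(2, ℝ)` and the action on `ℍ` -/

theorem det_entries (g : SL(2, ℝ)) : g 0 0 * g 1 1 - g 0 1 * g 1 0 = 1 := by
  have := g.det_coe
  rwa [Matrix.det_fin_two] at this

theorem mul_entry (g h : SL(2, ℝ)) (i j : Fin 2) :
    (g * h) i j = g i 0 * h 0 j + g i 1 * h 1 j := by
  simp [Matrix.mul_apply, Fin.sum_univ_two]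

theorem inv_entry_00 (g : SL(2, ℝ)) : g⁻¹ 0 0 = g 1 1 := by
  simp [Matrix.SpecialLinearGroup.SL2_inv_expl]
theorem inv_entry_01 (g : SL(2, ℝ)) : g⁻¹ 0 1 = -g 0 1 := by
  simp [Matrix.SpecialLinearGroup.SL2_inv_expl]
theorem inv_entry_10 (g : SL(2, ℝ)) : g⁻¹ 1 0 = -g 1 0 := by
  simp [Matrix.SpecialLinearGroup.SL2_inv_expl]
theorem inv_entry_11 (g : SL(2, ℝ)) : g⁻¹ 1 1 = g 0 0 := by
  simp [Matrix.SpecialLinearGroup.SL2_inv_expl]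

theorem neg_entry (g : SL(2, ℝ)) (i j : Fin 2) : (-g) i j = -g i j := by
  simp

theorem one_entry_00 : (1 : SL(2, ℝ)) 0 0 = 1 := by simp
theorem one_entry_01 : (1 : SL(2, ℝ)) 0 1 = 0 := by simp
theorem one_entry_10 : (1 : SL(2, ℝ)) 1 0 = 0 := by simp
theorem one_entry_11 : (1 : SL(2, ℝ)) 1 1 = 1 := by simp

/-- The element of `SL(2, ℝ)` with given entries. -/
def sl (a b c d : ℝ) (h : a * d - b * c = 1) : SL(2, ℝ) :=
  ⟨!![a, b; c, d], by rw [Matrix.det_fin_two]; simpa using h⟩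

section
variable (a b c d : ℝ) (h : a * d - b * c = 1)
@[simp] theorem sl_00 : sl a b c d h 0 0 = a := rfl
@[simp] theorem sl_01 : sl a b c d h 0 1 = b := rfl
@[simp] theorem sl_10 : sl a b c d h 1 0 = c := rfl
@[simp] theorem sl_11 : sl a b c d h 1 1 = d := rfl
end

theorem ext_entries {g h : SL(2, ℝ)} (h₀ : g 0 0 = h 0 0) (h₁ : g 0 1 = h 0 1)
    (h₂ : g 1 0 = h 1 0) (h₃ : g 1 1 = h 1 1) : g = h := by
  ext i j
  fin_cases i <;> fin_cases j <;> assumption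

theorem neg_smul' (g : SL(2, ℝ)) (z : ℍ) : -g • z = g • z := by
  ext
  rw [UpperHalfPlane.coe_specialLinearGroup_apply, UpperHalfPlane.coe_specialLinearGroup_apply]
  simp only [neg_entry, Algebra.algebraMap_self, RingHom.id_apply, Complex.ofReal_neg]
  rw [show -(g 0 0 : ℂ) * z + -(g 0 1 : ℂ) = -(g 0 0 * z + g 0 1) by ring,
    show -(g 1 0 : ℂ) * z + -(g 1 1 : ℂ) = -(g 1 0 * z + g 1 1) by ring, neg_div_neg_eq]

theorem denom_pos (g : SL(2, ℝ)) (z : ℍ) :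
    0 < (g 1 0 * z.re + g 1 1) ^ 2 + (g 1 0 * z.im) ^ 2 := by
  by_contra hcon
  have p1 := sq_nonneg (g 1 0 * z.re + g 1 1)
  have p2 := sq_nonneg (g 1 0 * z.im)
  have h1 : g 1 0 * z.im = 0 := by nlinarith
  have h2 : g 1 0 * z.re + g 1 1 = 0 := by nlinarith
  have h3 : g 1 0 = 0 := (mul_eq_zero.1 h1).resolve_right z.im_pos.ne'
  have := det_entries g
  simp_all

theorem smul_im (g : SL(2, ℝ)) (z : ℍ) :
    (g • z).im = z.im / ((g 1 0 * z.re + g 1 1) ^ 2 + (g 1 0 * z.im) ^ 2) := by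
  have h := congrArg Complex.im (UpperHalfPlane.coe_specialLinearGroup_apply g z)
  rw [UpperHalfPlane.coe_im, Complex.div_im] at h
  rw [h]
  simp [Complex.normSq_apply]
  have := det_entries g
  have := denom_pos g z
  rw [← sub_div]
  congr 1
  · linear_combination z.im * det_entries g
  · ring

theorem smul_re (g : SL(2, ℝ)) (z : ℍ) :
    (g • z).re = (g 0 0 * g 1 0 * (z.re ^ 2 + z.im ^ 2) + (g 0 0 * g 1 1 + g 0 1 * g 1 0) * z.re
      + g 0 1 * g 1 1) / ((g 1 0 * z.re + g 1 1) ^ 2 + (g 1 0 * z.im) ^ 2) := by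
  have h := congrArg Complex.re (UpperHalfPlane.coe_specialLinearGroup_apply g z)
  rw [UpperHalfPlane.coe_re, Complex.div_re] at h
  rw [h]
  simp [Complex.normSq_apply]
  rw [← add_div]
  congr 1 <;> ring

theorem smul_normSq (g : SL(2, ℝ)) (z : ℍ) :
    (g • z).re ^ 2 + (g • z).im ^ 2 = (g 0 0 ^ 2 * (z.re ^ 2 + z.im ^ 2)
      + 2 * g 0 0 * g 0 1 * z.re + g 0 1 ^ 2) /
      ((g 1 0 * z.re + g 1 1) ^ 2 + (g 1 0 * z.im) ^ 2) := by
  have h0 := denom_pos g z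
  have hd := det_entries g
  rw [smul_re, smul_im]
  set x := z.re
  set y := z.im
  set a := g 0 0
  set b := g 0 1
  set c := g 1 0
  set d := g 1 1
  have hd2 : (a * d - b * c) ^ 2 = 1 := by rw [hd]; ring
  rw [div_pow, div_pow, ← add_div, div_eq_div_iff (by positivity) h0.ne']
  linear_combination (-(y ^ 2) * ((c * x + d) ^ 2 + (c * y) ^ 2)) * hd2

/-! ### The quadratic form of an element of `SL(2, ℝ)` -/

/-- The quadratic form `v ↦ v ∧ X v` on `ℝ²`; it vanishes exactly at the eigenvectors of `X`. -/
def qf (X : SL(2, ℝ)) (u w : ℝ) : ℝ := X 1 0 * u ^ 2 + (X 1 1 - X 0 0) * u * w - X 0 1 * w ^ 2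

/-- The position of `z` relative to the axis of `X`: up to a constant, this is the hyperbolic sine
of the signed distance. It is the Hermitian extension of `qf X` at `(z, 1)`, divided by `Im z`. -/
def side (X : SL(2, ℝ)) (z : ℍ) : ℝ :=
  (X 1 0 * (z.re ^ 2 + z.im ^ 2) + (X 1 1 - X 0 0) * z.re - X 0 1) / z.im

theorem continuous_side (X : SL(2, ℝ)) : Continuous (side X) := by
  unfold side
  have h1 := UpperHalfPlane.continuous_re
  have h2 := UpperHalfPlane.continuous_im
  exact Continuous.div (by fun_prop) h2 fun z => z.im_ne_zero

theorem side_neg (X : SL(2, ℝ)) (z : ℍ) : side (-X) z = -side X z := by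
  simp only [side, neg_entry]; ring

theorem qf_neg (X : SL(2, ℝ)) (u w : ℝ) : qf (-X) u w = -qf X u w := by
  simp only [qf, neg_entry]; ring

theorem side_inv (X : SL(2, ℝ)) (z : ℍ) : side X⁻¹ z = -side X z := by
  simp only [side, inv_entry_00, inv_entry_01, inv_entry_10, inv_entry_11]; ring

theorem qf_inv (X : SL(2, ℝ)) (u w : ℝ) : qf X⁻¹ u w = -qf X u w := by
  simp only [qf, inv_entry_00, inv_entry_01, inv_entry_10, inv_entry_11]; ring

theorem qf_conj (g X : SL(2, ℝ)) (u w : ℝ) :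
    qf (g⁻¹ * X * g) u w = qf X (g 0 0 * u + g 0 1 * w) (g 1 0 * u + g 1 1 * w) := by
  simp only [qf, mul_entry, inv_entry_00, inv_entry_01, inv_entry_10, inv_entry_11]; ring

theorem conj_entry_10 (g X : SL(2, ℝ)) : (g⁻¹ * X * g) 1 0 = qf X (g 0 0) (g 1 0) := by
  simp only [qf, mul_entry, inv_entry_10, inv_entry_11]; ring

theorem conj_entry_01 (g X : SL(2, ℝ)) : (g⁻¹ * X * g) 0 1 = -qf X (g 0 1) (g 1 1) := by
  simp only [qf, mul_entry, inv_entry_00, inv_entry_01]; ring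

theorem side_conj (g X : SL(2, ℝ)) (z : ℍ) : side (g⁻¹ * X * g) z = side X (g • z) := by
  have h0 := denom_pos g z
  have hz := z.im_pos
  unfold side
  rw [smul_normSq, smul_re, smul_im]
  simp only [mul_entry, inv_entry_00, inv_entry_01, inv_entry_10, inv_entry_11]
  have hd := det_entries g
  set x := z.re
  set y := z.im
  set a := g 0 0
  set b := g 0 1
  set c := g 1 0
  set d := g 1 1
  generalize hq : (c * x + d) ^ 2 + (c * y) ^ 2 = q at h0 ⊢
  field_simp
  rw [← hq]
  ring

theorem side_smul (g X : SL(2, ℝ)) (z : ℍ) : side (g * X * g⁻¹) (g • z) = side X z := by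
  rw [← side_conj]; congr 1; group

theorem side_zpow_smul (X : SL(2, ℝ)) (n : ℤ) (z : ℍ) : side X (X ^ n • z) = side X z := by
  rw [← side_conj]; congr 1; group

/-- The trace. -/
def tr (X : SL(2, ℝ)) : ℝ := X 0 0 + X 1 1

theorem tr_neg (X : SL(2, ℝ)) : tr (-X) = -tr X := by simp only [tr, neg_entry]; ring

theorem tr_inv (X : SL(2, ℝ)) : tr X⁻¹ = tr X := by
  simp only [tr, inv_entry_00, inv_entry_11]; ring

theorem tr_mul_comm (X Y : SL(2, ℝ)) : tr (X * Y) = tr (Y * X) := by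
  simp only [tr, mul_entry]; ring

theorem tr_conj (g X : SL(2, ℝ)) : tr (g * X * g⁻¹) = tr X := by
  rw [tr_mul_comm, ← mul_assoc]; simp

theorem tr_conj' (g X : SL(2, ℝ)) : tr (g⁻¹ * X * g) = tr X := by
  simpa using tr_conj g⁻¹ X

theorem tr_mul_add (X Y : SL(2, ℝ)) : tr (X * Y) + tr (X * Y⁻¹) = tr X * tr Y := by
  simp only [tr, mul_entry, inv_entry_00, inv_entry_01, inv_entry_10, inv_entry_11]; ring

theorem tr_one : tr 1 = 2 := by simp only [tr, one_entry_00, one_entry_11]; norm_num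

/-- An element with a trace of absolute value less than `2` has a fixed point. -/
theorem exists_fixed_of_abs_tr_lt {X : SL(2, ℝ)} (h : |tr X| < 2) : ∃ z : ℍ, X • z = z := by
  have hd := det_entries X
  have h4 : tr X ^ 2 < 4 := by nlinarith [abs_lt.1 h]
  have hc : X 1 0 ≠ 0 := by
    intro hc
    rw [hc] at hd
    unfold tr at h4
    nlinarith [sq_nonneg (X 0 0 - X 1 1)]
  set s := √(4 - tr X ^ 2) with hs
  have hs0 : 0 < s := Real.sqrt_pos.2 (by linarith)
  have hs2 : s ^ 2 = 4 - tr X ^ 2 := Real.sq_sqrt (by linarith)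
  have hy : 0 < s / (2 * |X 1 0|) := by positivity
  have hab : |X 1 0| ^ 2 = X 1 0 ^ 2 := sq_abs _
  have habp : 0 < |X 1 0| := abs_pos.2 hc
  refine ⟨⟨⟨(X 0 0 - X 1 1) / (2 * X 1 0), s / (2 * |X 1 0|)⟩, hy⟩, ?_⟩
  set z : ℍ := ⟨⟨(X 0 0 - X 1 1) / (2 * X 1 0), s / (2 * |X 1 0|)⟩, hy⟩ with hz
  have hre : z.re = (X 0 0 - X 1 1) / (2 * X 1 0) := rfl
  have him : z.im = s / (2 * |X 1 0|) := rfl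
  have him2 : (X 1 0 * z.im) ^ 2 = s ^ 2 / 4 := by
    rw [him, mul_pow, div_pow, mul_pow, hab]; field_simp; norm_num
  have hre1 : X 1 0 * z.re = (X 0 0 - X 1 1) / 2 := by rw [hre]; field_simp
  have hden : (X 1 0 * z.re + X 1 1) ^ 2 + (X 1 0 * z.im) ^ 2 = 1 := by
    rw [him2, hre1, hs2, tr]; ring
  apply UpperHalfPlane.ext_re_im
  · rw [smul_re, hden, div_one]
    apply mul_left_cancel₀ hc
    have e : X 1 0 ^ 2 * (z.re ^ 2 + z.im ^ 2) = (X 1 0 * z.re) ^ 2 + (X 1 0 * z.im) ^ 2 := by ring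
    have e2 : X 1 0 * (X 0 0 * X 1 0 * (z.re ^ 2 + z.im ^ 2) +
        (X 0 0 * X 1 1 + X 0 1 * X 1 0) * z.re + X 0 1 * X 1 1) =
        X 0 0 * ((X 1 0 * z.re) ^ 2 + (X 1 0 * z.im) ^ 2) +
        (X 0 0 * X 1 1 + X 0 1 * X 1 0) * (X 1 0 * z.re) + X 0 1 * X 1 0 * X 1 1 := by ring
    rw [e2, him2, hre1, hs2, tr]
    linear_combination ((-X 0 0 + X 1 1) / 2 - X 1 1) * hd
  · rw [smul_im, hden, div_one]

/-! ### Geodesic normal form -/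

/-- The point `i e^t` of the imaginary axis. -/
def geo (t : ℝ) : ℍ := ⟨⟨0, Real.exp t⟩, Real.exp_pos t⟩

@[simp] theorem geo_re (t : ℝ) : (geo t).re = 0 := rfl
@[simp] theorem geo_im (t : ℝ) : (geo t).im = Real.exp t := rfl

theorem continuous_geo : Continuous geo := by
  unfold geo
  refine Continuous.upperHalfPlaneMk ?_ _
  exact Complex.equivRealProdCLM.symm.continuous.comp
    (by fun_prop : Continuous fun t : ℝ => ((0 : ℝ), Real.exp t))

/-- The translation by `δ` along the imaginary axis. -/
def D (δ : ℝ) : SL(2, ℝ) :=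
  sl (Real.exp (δ / 2)) 0 0 (Real.exp (-(δ / 2))) (by rw [← Real.exp_add]; simp)

theorem D_smul_geo (δ t : ℝ) : D δ • geo t = geo (t + δ) := by
  have e : Real.exp (-(δ / 2)) ^ 2 = (Real.exp δ)⁻¹ := by
    rw [← Real.exp_nat_mul, ← Real.exp_neg]; congr 1; push_cast; ring
  apply UpperHalfPlane.ext_re_im
  · rw [smul_re]; simp [D]
  · rw [smul_im]; simp [D, e, Real.exp_add]

theorem D_add (δ ε : ℝ) : D (δ + ε) = D δ * D ε := by
  apply ext_entries <;> rw [mul_entry] <;> simp [D, ← Real.exp_add] <;> ring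

theorem D_zero : D 0 = 1 := by
  apply ext_entries <;> simp [D]

theorem D_neg (δ : ℝ) : D (-δ) = (D δ)⁻¹ := by
  rw [eq_inv_iff_mul_eq_one, ← D_add, neg_add_cancel, D_zero]

theorem D_zpow (δ : ℝ) (n : ℤ) : D δ ^ n = D (n * δ) := by
  induction n with
  | zero => simp [D_zero]
  | succ n ih => rw [zpow_add_one, ih, ← D_add]; congr 1; push_cast; ring
  | pred n ih => rw [zpow_sub_one, ih, ← D_neg, ← D_add]; congr 1; push_cast; ring

theorem tr_D (δ : ℝ) : tr (D δ) = 2 * Real.cosh (δ / 2) := by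
  simp [tr, D, Real.cosh_eq]; ring

/-- An element without off-diagonal entries is a translation along the imaginary axis,
up to sign. -/
theorem exists_eq_D {X : SL(2, ℝ)} (h₁ : X 0 1 = 0) (h₂ : X 1 0 = 0) :
    ∃ δ, X = D δ ∨ X = -D δ := by
  have hd := det_entries X
  rw [h₁, h₂] at hd
  have hne : X 0 0 ≠ 0 := by rintro h; simp [h] at hd
  have hd' : X 1 1 = (X 0 0)⁻¹ := by field_simp; linarith
  refine ⟨2 * Real.log |X 0 0|, ?_⟩
  have e1 : Real.exp (2 * Real.log |X 0 0| / 2) = |X 0 0| := by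
    rw [mul_div_cancel_left₀ _ (two_ne_zero), Real.exp_log (abs_pos.2 hne)]
  have e2 : Real.exp (-(2 * Real.log |X 0 0| / 2)) = |X 0 0|⁻¹ := by
    rw [Real.exp_neg, e1]
  rcases abs_choice (X 0 0) with h | h
  · left
    have e3 := e1.trans h
    have e4 := e2.trans (congrArg Inv.inv h)
    apply ext_entries <;> simp only [D, sl_00, sl_01, sl_10, sl_11, h₁, h₂, hd', e3, e4]
  · right
    have e3 := e1.trans h
    have e4 := e2.trans (congrArg Inv.inv h)
    apply ext_entries <;>
      simp only [neg_entry, D, sl_00, sl_01, sl_10, sl_11, h₁, h₂, hd', e3, e4, inv_neg,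
        neg_neg, neg_zero]

theorem side_geo (X : SL(2, ℝ)) (t : ℝ) :
    side X (geo t) = X 1 0 * Real.exp t - X 0 1 * Real.exp (-t) := by
  have := Real.exp_pos t
  simp only [side, geo_re, geo_im, Real.exp_neg]; field_simp; ring

/-- Fixed-point freeness of the isotropy: only `±1` acts trivially on the imaginary axis. -/
theorem eq_D_of_smul_geo {X : SL(2, ℝ)} {δ : ℝ} (h : ∀ t, X • geo t = geo (t + δ)) :
    X = D δ ∨ X = -D δ := by
  have key : ∀ t, D (-δ) • X • geo t = geo t := fun t => by rw [h, D_smul_geo]; congr 1; ring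
  set Y := D (-δ) * X with hY
  have key' : ∀ t, Y • geo t = geo t := fun t => by rw [hY, mul_smul, key]
  have hd := det_entries Y
  have h0 := denom_pos Y
  have him : ∀ t, (Y 1 1) ^ 2 + (Y 1 0) ^ 2 * Real.exp t ^ 2 = 1 := by
    intro t
    have h1 := congrArg UpperHalfPlane.im (key' t)
    rw [smul_im, div_eq_iff (h0 _).ne'] at h1
    simp only [geo_re, geo_im] at h1
    have := Real.exp_pos t
    have h2 : Real.exp t * ((Y 1 1) ^ 2 + (Y 1 0) ^ 2 * Real.exp t ^ 2) = Real.exp t * 1 := by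
      linear_combination -h1
    exact mul_left_cancel₀ this.ne' h2
  have hc : Y 1 0 = 0 := by
    have h1 := him 0
    have h2 := him 1
    have : (1 : ℝ) < Real.exp 1 := by simp
    simp only [Real.exp_zero] at h1
    have h3 : (Y 1 0) ^ 2 * (Real.exp 1 ^ 2 - 1) = 0 := by linarith
    rcases mul_eq_zero.1 h3 with h4 | h4
    · exact pow_eq_zero_iff two_ne_zero |>.1 h4
    · nlinarith
  have hd1 : Y 1 1 ^ 2 = 1 := by have := him 0; rw [hc] at this; linarith
  have hb : Y 0 1 = 0 := by
    have h1 := congrArg UpperHalfPlane.re (key' 0)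
    rw [smul_re, div_eq_iff (h0 _).ne'] at h1
    simp only [geo_re, geo_im, hc] at h1
    have : Y 1 1 ≠ 0 := by rintro h; simp [h] at hd1
    have h2 : Y 0 1 * Y 1 1 = 0 := by linarith
    exact (mul_eq_zero.1 h2).resolve_right this
  have hX : X = D δ * Y := by rw [hY, D_neg]; group
  rw [hb, hc] at hd
  rcases mul_self_eq_one_iff.1 ((sq (Y 1 1)).symm.trans hd1) with h1 | h1
  · left
    have : Y = 1 := by
      apply ext_entries <;> simp [hb, hc, h1]
      rw [h1] at hd; linarith
    rw [hX, this, mul_one]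
  · right
    have : Y = -1 := by
      apply ext_entries <;> simp [hb, hc, h1]
      rw [h1] at hd; linarith
    rw [hX, this, mul_neg, mul_one]

/-! ### Eigenvectors and limits of the forms -/

theorem exists_eigenvector {X : SL(2, ℝ)} (h : 2 ≤ |tr X|) :
    ∃ u w : ℝ, (u ≠ 0 ∨ w ≠ 0) ∧ qf X u w = 0 := by
  by_cases hc : X 1 0 = 0
  · exact ⟨1, 0, by simp, by simp [qf, hc]⟩
  · have h4 : 0 ≤ tr X ^ 2 - 4 := by
      have := sq_abs (tr X)
      nlinarith
    have hs := Real.sq_sqrt h4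
    set s := √(tr X ^ 2 - 4)
    refine ⟨X 0 0 - X 1 1 + s, 2 * X 1 0, Or.inr (by simpa using hc), ?_⟩
    have hd := det_entries X
    unfold tr at hs
    unfold qf
    linear_combination X 1 0 * hs + 4 * X 1 0 * hd

/-- A zero of `qf X` is an eigenvector of `X`; the last equation is the characteristic equation. -/
theorem exists_eigenvalue {X : SL(2, ℝ)} {u w : ℝ} (hv : u ≠ 0 ∨ w ≠ 0) (h : qf X u w = 0) :
    ∃ l : ℝ, X 0 0 * u + X 0 1 * w = l * u ∧ X 1 0 * u + X 1 1 * w = l * w ∧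
      l * (tr X - l) = 1 := by
  have hd := det_entries X
  unfold qf at h
  have main : ∀ l : ℝ, X 0 0 * u + X 0 1 * w = l * u → X 1 0 * u + X 1 1 * w = l * w →
      l * (tr X - l) = 1 := by
    intro l h1 h2
    have e1 : (l * (tr X - l) - 1) * u = 0 := by
      unfold tr
      linear_combination (l - X 1 1) * h1 + X 0 1 * h2 + u * hd
    have e2 : (l * (tr X - l) - 1) * w = 0 := by
      unfold tr
      linear_combination (l - X 0 0) * h2 + X 1 0 * h1 + w * hd
    rcases hv with hv | hv
    · linarith [(mul_eq_zero.1 e1).resolve_right hv]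
    · linarith [(mul_eq_zero.1 e2).resolve_right hv]
  rcases hv with hv | hv
  · have h1 : X 0 0 * u + X 0 1 * w = (X 0 0 * u + X 0 1 * w) / u * u := by field_simp
    have h2 : X 1 0 * u + X 1 1 * w = (X 0 0 * u + X 0 1 * w) / u * w := by
      field_simp; linear_combination h
    exact ⟨_, h1, h2, main _ h1 h2⟩
  · have h1 : X 0 0 * u + X 0 1 * w = (X 1 0 * u + X 1 1 * w) / w * u := by
      field_simp; linear_combination -h
    have h2 : X 1 0 * u + X 1 1 * w = (X 1 0 * u + X 1 1 * w) / w * w := by field_simp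
    exact ⟨_, h1, h2, main _ h1 h2⟩

/-- An element of `SL(2, ℝ)` with first column `(u, w)`. -/
def colFrame (u w : ℝ) (h : u ≠ 0 ∨ w ≠ 0) : SL(2, ℝ) :=
  sl u (-w / (u ^ 2 + w ^ 2)) w (u / (u ^ 2 + w ^ 2)) (by
    have : u ^ 2 + w ^ 2 ≠ 0 := by rcases h with h | h <;> positivity
    field_simp; ring)

/-- The parabolic element `z ↦ z + t`. -/
def U (t : ℝ) : SL(2, ℝ) := sl 1 t 0 1 (by ring)

theorem U_add (s t : ℝ) : U (s + t) = U s * U t := by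
  apply ext_entries <;> rw [mul_entry] <;> simp [U]; ring

theorem U_zero : U 0 = 1 := by apply ext_entries <;> simp [U]

theorem U_neg (t : ℝ) : U (-t) = (U t)⁻¹ := by
  rw [eq_inv_iff_mul_eq_one, ← U_add, neg_add_cancel, U_zero]

theorem U_zpow (t : ℝ) (n : ℤ) : U t ^ n = U (n * t) := by
  induction n with
  | zero => simp [U_zero]
  | succ n ih => rw [zpow_add_one, ih, ← U_add]; congr 1; push_cast; ring
  | pred n ih => rw [zpow_sub_one, ih, ← U_neg, ← U_add]; congr 1; push_cast; ring

theorem U_smul_re (t : ℝ) (z : ℍ) : (U t • z).re = z.re + t := by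
  rw [smul_re]; simp [U]

theorem U_smul_im (t : ℝ) (z : ℍ) : (U t • z).im = z.im := by
  rw [smul_im]; simp [U]

theorem D_smul_re (t : ℝ) (z : ℍ) : (D t • z).re = Real.exp t * z.re := by
  have e : Real.exp (-(t / 2)) ^ 2 = (Real.exp t)⁻¹ := by
    rw [← Real.exp_nat_mul, ← Real.exp_neg]; congr 1; push_cast; ring
  rw [smul_re]
  simp [D, e, ← Real.exp_add]; ring

theorem D_smul_im (t : ℝ) (z : ℍ) : (D t • z).im = Real.exp t * z.im := by
  have e : Real.exp (-(t / 2)) ^ 2 = (Real.exp t)⁻¹ := by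
    rw [← Real.exp_nat_mul, ← Real.exp_neg]; congr 1; push_cast; ring
  rw [smul_im]
  simp [D, e]; ring

theorem neg_zpow_smul (X : SL(2, ℝ)) (n : ℤ) (z : ℍ) : (-X) ^ n • z = X ^ n • z := by
  rcases Int.even_or_odd n with h | h
  · rw [h.neg_zpow]
  · rw [h.neg_zpow, neg_smul']

/-- An upper triangular element with a diagonal entry `±1` is a translation, up to sign. -/
theorem eq_U_of_upper {X : SL(2, ℝ)} (hc : X 1 0 = 0) (h1 : X 0 0 ^ 2 = 1) :
    ∃ t, X = U t ∨ X = -U t := by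
  have hd := det_entries X
  rw [hc] at hd
  rcases mul_self_eq_one_iff.1 ((sq (X 0 0)).symm.trans h1) with h | h
  · exact ⟨X 0 1, Or.inl (by apply ext_entries <;> simp [U, hc, h]; rw [h] at hd; linarith)⟩
  · exact ⟨-X 0 1, Or.inr (by apply ext_entries <;> simp [U, hc, h]; rw [h] at hd; linarith)⟩

theorem nonneg_of_div_nonneg {a b : ℝ} (hb : 0 < b) (h : 0 ≤ a / b) : 0 ≤ a := by
  have := mul_nonneg h hb.le
  rwa [div_mul_cancel₀ _ hb.ne'] at this

theorem nonneg_of_unbounded {p q r : ℝ} (h : ∀ K : ℝ, ∃ s ≥ K, 0 ≤ p * s ^ 2 + q * s + r) :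
    0 ≤ p := by
  by_contra hp
  push Not at hp
  obtain ⟨s, hs, h0⟩ := h (max 1 ((|q| + |r| + 1) / (-p)))
  have h1 : 1 ≤ s := le_trans (le_max_left _ _) hs
  have h2 : (|q| + |r| + 1) / (-p) ≤ s := le_trans (le_max_right _ _) hs
  rw [div_le_iff₀ (by linarith)] at h2
  have h3 : q * s ≤ |q| * s := by gcongr; exact le_abs_self q
  have h4 : r ≤ |r| * s := (le_abs_self r).trans (by nlinarith [abs_nonneg r])
  nlinarith

/-- The points `h^n z` accumulate at the fixed points of `h` at infinity: a sign of `side Y` that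
is constant along them is the sign of `qf Y` at the eigenvectors of `h`. -/
theorem qf_nonneg_of_side_nonneg {h Y : SL(2, ℝ)} {z : ℍ} {u w a : ℝ} (huw : u ≠ 0 ∨ w ≠ 0)
    (hv : qf h u w = 0) (h1 : h ≠ 1) (h2 : h ≠ -1)
    (H : ∀ n : ℤ, 0 ≤ a * side Y (h ^ n • z)) : 0 ≤ a * qf Y u w := by
  -- the claim in a frame whose first column is the eigenvector
  have key : ∀ N : SL(2, ℝ), N 0 0 = u → N 1 0 = w → ∀ n : ℤ,
      0 ≤ a * side (N⁻¹ * Y * N) ((N⁻¹ * h * N) ^ n • N⁻¹ • z) := by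
    intro N _ _ n
    have e : (N⁻¹ * h * N) ^ n = N⁻¹ * h ^ n * N := by
      have := conj_zpow (a := N⁻¹) (b := h) (i := n)
      rwa [inv_inv] at this
    rw [side_conj, e, smul_smul, smul_smul]
    convert H n using 4
    group
  set N := colFrame u w huw with hN
  have hN0 : N 0 0 = u := rfl
  have hN1 : N 1 0 = w := rfl
  have hc : (N⁻¹ * h * N) 1 0 = 0 := by rw [conj_entry_10, hN0, hN1, hv]
  set h' := N⁻¹ * h * N with hh'
  have hne1 : h' ≠ 1 := by
    intro e; apply h1
    calc h = N * h' * N⁻¹ := by rw [hh']; group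
      _ = 1 := by rw [e]; group
  have hne2 : h' ≠ -1 := by
    intro e; apply h2
    calc h = N * h' * N⁻¹ := by rw [hh']; group
      _ = -1 := by rw [e]; simp
  have hd := det_entries h'
  rw [hc] at hd
  by_cases hl : h' 0 0 ^ 2 = 1
  · obtain ⟨t, ht⟩ := eq_U_of_upper hc hl
    have ht0 : t ≠ 0 := by
      rintro rfl
      rw [U_zero] at ht
      exact ht.elim hne1 hne2
    have hpow : ∀ n : ℤ, h' ^ n • N⁻¹ • z = U (n * t) • N⁻¹ • z := by
      intro n
      rcases ht with ht | ht <;> rw [ht]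
      · rw [U_zpow]
      · rw [neg_zpow_smul, U_zpow]
    set x := N⁻¹ • z with hx
    set Y' := N⁻¹ * Y * N with hY'
    have hq : qf Y u w = Y' 1 0 := by rw [hY', conj_entry_10, hN0, hN1]
    rw [hq]
    have hpos : 0 < t ^ 2 := by positivity
    suffices hs : 0 ≤ a * Y' 1 0 * t ^ 2 by
      by_contra hneg
      push Not at hneg
      nlinarith
    apply nonneg_of_unbounded (q := a * (Y' 1 0 * (2 * x.re * t) + (Y' 1 1 - Y' 0 0) * t))
      (r := a * (Y' 1 0 * (x.re ^ 2 + x.im ^ 2) + (Y' 1 1 - Y' 0 0) * x.re - Y' 0 1))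
    intro K
    obtain ⟨n, hn⟩ := exists_nat_ge K
    refine ⟨n, hn, ?_⟩
    have h3 := key N rfl rfl n
    rw [hpow] at h3
    unfold side at h3
    rw [U_smul_re, U_smul_im, mul_div_assoc'] at h3
    have h4 := nonneg_of_div_nonneg x.im_pos h3
    push_cast at h4
    linarith
  · set t := -h' 0 1 / (h' 0 0 - h' 1 1) with ht
    have hne : h' 0 0 - h' 1 1 ≠ 0 := by
      intro e
      apply hl
      have : h' 1 1 = h' 0 0 := by linarith
      rw [this] at hd; linarith
    set M := N * U t with hM
    have hM0 : M 0 0 = u := by rw [hM, mul_entry]; simp [U, hN0]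
    have hM1 : M 1 0 = w := by rw [hM, mul_entry]; simp [U, hN1]
    set h'' := M⁻¹ * h * M with hh''
    have e : h'' = (U t)⁻¹ * h' * U t := by rw [hh'', hh', hM]; group
    have hc'' : h'' 1 0 = 0 := by rw [hh'', conj_entry_10, hM0, hM1, hv]
    have hb'' : h'' 0 1 = 0 := by
      rw [e, conj_entry_01, qf, hc]; simp only [U, sl_01, sl_11]
      rw [ht]; field_simp; ring
    obtain ⟨δ, hδ⟩ := exists_eq_D hb'' hc''
    have hδ0 : δ ≠ 0 := by
      rintro rfl
      rw [D_zero] at hδ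
      rcases hδ with hδ | hδ
      · apply h1
        calc h = M * h'' * M⁻¹ := by rw [hh'']; group
          _ = 1 := by rw [hδ]; group
      · apply h2
        calc h = M * h'' * M⁻¹ := by rw [hh'']; group
          _ = -1 := by rw [hδ]; simp
    have hpow : ∀ n : ℤ, h'' ^ n • M⁻¹ • z = D (n * δ) • M⁻¹ • z := by
      intro n
      rcases hδ with ht | ht <;> rw [ht]
      · rw [D_zpow]
      · rw [neg_zpow_smul, D_zpow]
    set x := M⁻¹ • z with hx
    set Y' := M⁻¹ * Y * M with hY'
    have hq : qf Y u w = Y' 1 0 := by rw [hY', conj_entry_10, hM0, hM1]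
    rw [hq]
    have hxi := x.im_pos
    have hpos : 0 < x.re ^ 2 + x.im ^ 2 := by positivity
    suffices hs : 0 ≤ a * Y' 1 0 * (x.re ^ 2 + x.im ^ 2) by
      by_contra hneg
      push Not at hneg
      nlinarith
    apply nonneg_of_unbounded (q := a * ((Y' 1 1 - Y' 0 0) * x.re)) (r := -a * Y' 0 1)
    intro K
    obtain ⟨n, hn⟩ : ∃ n : ℤ, K ≤ Real.exp (n * δ) := by
      obtain ⟨m, hm⟩ := exists_nat_ge (K / |δ|)
      rw [div_le_iff₀ (abs_pos.2 hδ0)] at hm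
      have h5 : K ≤ Real.exp (m * |δ|) := hm.trans (by linarith [Real.add_one_le_exp (m * |δ|)])
      rcases abs_choice δ with h | h
      · exact ⟨m, by rw [h] at h5; exact_mod_cast h5⟩
      · refine ⟨-m, ?_⟩
        rw [h] at h5
        convert h5 using 2
        push_cast; ring
    refine ⟨_, hn, ?_⟩
    have h3 := key M hM0 hM1 n
    rw [hpow] at h3
    unfold side at h3
    rw [D_smul_re, D_smul_im, mul_div_assoc'] at h3
    have h4 := nonneg_of_div_nonneg (mul_pos (Real.exp_pos _) x.im_pos) h3
    linarith

/-! ### Traces and configurations of axes -/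

theorem not_both_zero {u w : ℝ} (h : u ≠ 0 ∨ w ≠ 0) : ¬(u = 0 ∧ w = 0) := by tauto

theorem qf_one (u w : ℝ) : qf 1 u w = 0 := by simp [qf]

theorem qf_neg_one (u w : ℝ) : qf (-1) u w = 0 := by rw [qf_neg, qf_one, neg_zero]

theorem eigenvalue_pos {t l : ℝ} (ht : 0 < t) (h : l * (t - l) = 1) : 0 < l := by
  by_contra hl
  push Not at hl
  nlinarith

/-- At an eigenvector of `B` with eigenvalue `l`, the form of `A * B` is `l` times that of `A`. -/
theorem qf_mul_of_eigenvector {A B : SL(2, ℝ)} {u w l : ℝ} (h0 : B 0 0 * u + B 0 1 * w = l * u)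
    (h1 : B 1 0 * u + B 1 1 * w = l * w) : qf (A * B) u w = l * qf A u w := by
  simp only [qf, mul_entry]
  linear_combination (A 1 0 * u - A 0 0 * w) * h0 + (A 1 1 * u - A 0 1 * w) * h1

/-- If `A`, `B` and `A * B` have traces at least `2`, then no region that is invariant under `A`
and `B` can avoid the three axes: comparing the forms of `A`, `B` and `A * B` at the eigenvectors
of each other forces contradicting signs. -/
theorem tr_mul_pos_false {A B : SL(2, ℝ)} {z : ℍ} {a b c : ℝ} (hA : 2 ≤ tr A)
    (hB : 2 ≤ tr B) (hC : 2 ≤ tr (A * B))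
    (hne : ∀ u w, qf A u w = 0 → qf B u w = 0 → u = 0 ∧ w = 0)
    (hAB : ∀ n : ℤ, 0 ≤ a * side A (B ^ n • z)) (hAC : ∀ n : ℤ, 0 ≤ a * side A ((A * B) ^ n • z))
    (hBA : ∀ n : ℤ, 0 ≤ b * side B (A ^ n • z)) (hBC : ∀ n : ℤ, 0 ≤ b * side B ((A * B) ^ n • z))
    (hCA : ∀ n : ℤ, 0 ≤ c * side (A * B) (A ^ n • z))
    (hCB : ∀ n : ℤ, 0 ≤ c * side (A * B) (B ^ n • z))
    (ha : a ≠ 0) (hb : b ≠ 0) (hc : c ≠ 0) : False := by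
  obtain ⟨u, w, hv, hq⟩ := exists_eigenvector (X := B) (hB.trans (le_abs_self _))
  obtain ⟨u', w', hv', hq'⟩ := exists_eigenvector (X := A) (hA.trans (le_abs_self _))
  obtain ⟨u'', w'', hv'', hq''⟩ := exists_eigenvector (X := A * B) (hC.trans (le_abs_self _))
  have nA : A ≠ 1 ∧ A ≠ -1 := ⟨fun e => not_both_zero hv (hne u w (by rw [e, qf_one]) hq),
    fun e => not_both_zero hv (hne u w (by rw [e, qf_neg_one]) hq)⟩
  have nB : B ≠ 1 ∧ B ≠ -1 := ⟨fun e => not_both_zero hv' (hne _ _ hq' (by rw [e, qf_one])),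
    fun e => not_both_zero hv' (hne _ _ hq' (by rw [e, qf_neg_one]))⟩
  have nC : A * B ≠ 1 ∧ A * B ≠ -1 := by
    constructor <;> intro e
    · have e' : B = A⁻¹ := (inv_eq_of_mul_eq_one_right e).symm
      exact not_both_zero hv' (hne _ _ hq' (by rw [e', qf_inv, hq', neg_zero]))
    · have e' : B = -A⁻¹ := by
        calc B = A⁻¹ * (A * B) := by group
          _ = -A⁻¹ := by rw [e]; simp
      exact not_both_zero hv' (hne _ _ hq' (by rw [e', qf_neg, qf_inv, hq']; simp))
  obtain ⟨l, h0, h1, hl⟩ := exists_eigenvalue hv hq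
  have lpos := eigenvalue_pos (by linarith) hl
  have hac : 0 < a * c := by
    have i1 := qf_nonneg_of_side_nonneg hv hq nB.1 nB.2 hAB
    have i2 := qf_nonneg_of_side_nonneg hv hq nB.1 nB.2 hCB
    rw [qf_mul_of_eigenvector h0 h1] at i2
    have i3 : qf A u w ≠ 0 := fun e => not_both_zero hv (hne _ _ e hq)
    have i4 : 0 < l * qf A u w ^ 2 := by positivity
    by_contra hcon
    push Not at hcon
    have i5 : a * c < 0 := lt_of_le_of_ne hcon (mul_ne_zero ha hc)
    nlinarith [mul_nonneg i1 i2]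
  obtain ⟨l', h0', h1', hl'⟩ := exists_eigenvalue hv' hq'
  have lpos' := eigenvalue_pos (by linarith) hl'
  have hbc : 0 < b * c := by
    have i1 := qf_nonneg_of_side_nonneg hv' hq' nA.1 nA.2 hBA
    have i2 := qf_nonneg_of_side_nonneg hv' hq' nA.1 nA.2 hCA
    have hB' : B * A = A⁻¹ * (A * B) * A := by group
    have i0 : l' * qf (A * B) u' w' = qf B u' w' := by
      have hd := det_entries A
      have e1 := qf_conj A (A * B) u' w'
      rw [← hB', h0', h1', qf_mul_of_eigenvector h0' h1'] at e1
      have e2 : qf (A * B) (l' * u') (l' * w') = l' ^ 2 * qf (A * B) u' w' := by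
        simp only [qf]; ring
      rw [e2] at e1
      apply mul_left_cancel₀ lpos'.ne'
      linarith
    have i3 : qf B u' w' ≠ 0 := fun e => not_both_zero hv' (hne _ _ hq' e)
    have i4 : 0 < l' * qf (A * B) u' w' ^ 2 := by
      have : qf (A * B) u' w' ≠ 0 := by intro e; rw [e, mul_zero] at i0; exact i3 i0.symm
      positivity
    by_contra hcon
    push Not at hcon
    have i5 : b * c < 0 := lt_of_le_of_ne hcon (mul_ne_zero hb hc)
    rw [← i0] at i1
    nlinarith [mul_nonneg i1 i2]
  obtain ⟨m, h0'', h1'', hm⟩ := exists_eigenvalue hv'' hq''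
  have mpos := eigenvalue_pos (by linarith) hm
  have hab : a * b < 0 := by
    have i1 := qf_nonneg_of_side_nonneg hv'' hq'' nC.1 nC.2 hAC
    have i2 := qf_nonneg_of_side_nonneg hv'' hq'' nC.1 nC.2 hBC
    have i0 : qf B u'' w'' = -(m * qf A u'' w'') := by
      have := qf_mul_of_eigenvector (A := A⁻¹) h0'' h1''
      rw [inv_mul_cancel_left, qf_inv] at this
      rw [this]; ring
    have i3 : qf A u'' w'' ≠ 0 := fun e => not_both_zero hv'' (hne _ _ e (by rw [i0, e]; simp))
    have i4 : 0 < m * qf A u'' w'' ^ 2 := by positivity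
    by_contra hcon
    push Not at hcon
    have i5 : 0 < a * b := lt_of_le_of_ne hcon (mul_ne_zero ha hb).symm
    rw [i0] at i2
    nlinarith [mul_nonneg i1 i2]
  have h1 : 0 < (a * c) * (b * c) := mul_pos hac hbc
  nlinarith [mul_self_nonneg c]

/-- Three elements `A`, `B`, `A * B` without common fixed points whose axes avoid the region
swept out by `z` have traces of negative product. -/
theorem tr_mul_tr_mul_tr_neg {A B : SL(2, ℝ)} {z : ℍ} (hA : 2 ≤ |tr A|)
    (hB : 2 ≤ |tr B|) (hC : 2 ≤ |tr (A * B)|)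
    (hne : ∀ u w, qf A u w = 0 → qf B u w = 0 → u = 0 ∧ w = 0)
    (h : ∀ X ∈ ({A, B, A * B} : Set SL(2, ℝ)), ∀ g ∈ Subgroup.closure ({A, B} : Set SL(2, ℝ)),
      0 < side X z * side X (g • z)) : tr A * tr B * tr (A * B) < 0 := by
  have mA : A ∈ Subgroup.closure ({A, B} : Set SL(2, ℝ)) := Subgroup.subset_closure (by simp)
  have mB : B ∈ Subgroup.closure ({A, B} : Set SL(2, ℝ)) := Subgroup.subset_closure (by simp)
  have mC := mul_mem mA mB
  have pA : ∀ n : ℤ, _ := fun n => zpow_mem mA n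
  have pB : ∀ n : ℤ, _ := fun n => zpow_mem mB n
  have pC : ∀ n : ℤ, _ := fun n => zpow_mem mC n
  have iA := h A (by simp)
  have iB := h B (by simp)
  have iC := h (A * B) (by simp)
  have nA : side A z ≠ 0 := fun e => by simpa [e] using iA 1 (one_mem _)
  have nB : side B z ≠ 0 := fun e => by simpa [e] using iB 1 (one_mem _)
  have nC : side (A * B) z ≠ 0 := fun e => by simpa [e] using iC 1 (one_mem _)
  have hne' : ∀ X : SL(2, ℝ), 2 ≤ |tr X| → tr X ≠ 0 := by
    rintro X hX e; rw [e, abs_zero] at hX; linarith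
  by_contra hcon
  have hpos : 0 < tr A * tr B * tr (A * B) :=
    lt_of_le_of_ne (not_lt.1 hcon) (mul_ne_zero (mul_ne_zero (hne' _ hA) (hne' _ hB))
      (hne' _ hC)).symm
  -- all signs of `A` and `B` are covered by the case of positive traces
  have key : ∀ A' B' : SL(2, ℝ), (A' = A ∨ A' = -A) → (B' = B ∨ B' = -B) → 2 ≤ tr A' →
      2 ≤ tr B' → 2 ≤ tr (A' * B') → False := by
    intro A' B' hA' hB' tA tB tC
    have s : ∀ X X' : SL(2, ℝ), (X' = X ∨ X' = -X) → ∀ y : ℍ,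
        side X' z * side X' y = side X z * side X y := by
      rintro X X' (rfl | rfl) y
      · rfl
      · rw [side_neg, side_neg]; ring
    have p : ∀ X X' : SL(2, ℝ), (X' = X ∨ X' = -X) → ∀ (n : ℤ) (y : ℍ),
        X' ^ n • y = X ^ n • y := by
      rintro X X' (rfl | rfl) n y
      · rfl
      · rw [neg_zpow_smul]
    have q : ∀ X X' : SL(2, ℝ), (X' = X ∨ X' = -X) → ∀ u w, qf X' u w = 0 → qf X u w = 0 := by
      rintro X X' (rfl | rfl) u w e
      · exact e
      · rwa [qf_neg, neg_eq_zero] at e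
    have r : ∀ X X' : SL(2, ℝ), (X' = X ∨ X' = -X) → side X z ≠ 0 → side X' z ≠ 0 := by
      rintro X X' (rfl | rfl) e
      · exact e
      · rwa [side_neg, neg_ne_zero]
    have hC' : A' * B' = A * B ∨ A' * B' = -(A * B) := by
      rcases hA' with rfl | rfl <;> rcases hB' with rfl | rfl <;> simp
    refine tr_mul_pos_false (z := z) (a := side A' z) (b := side B' z) (c := side (A' * B') z)
      tA tB tC (fun u w h1 h2 => hne u w (q _ _ hA' _ _ h1) (q _ _ hB' _ _ h2)) ?_ ?_ ?_ ?_ ?_ ?_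
      (r _ _ hA' nA) (r _ _ hB' nB) (r _ _ hC' nC) <;> intro n
    · rw [s _ _ hA', p _ _ hB']; exact (iA _ (pB n)).le
    · rw [s _ _ hA', p _ _ hC']; exact (iA _ (pC n)).le
    · rw [s _ _ hB', p _ _ hA']; exact (iB _ (pA n)).le
    · rw [s _ _ hB', p _ _ hC']; exact (iB _ (pC n)).le
    · rw [s _ _ hC', p _ _ hA']; exact (iC _ (pA n)).le
    · rw [s _ _ hC', p _ _ hB']; exact (iC _ (pB n)).le
  rcases le_abs.1 hA with tA | tA <;> rcases le_abs.1 hB with tB | tB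
  · refine key A B (by simp) (by simp) tA tB ?_
    rcases le_abs.1 hC with tC | tC
    · exact tC
    · nlinarith [mul_pos (show 0 < tr A by linarith) (show 0 < tr B by linarith)]
  · refine key A (-B) (by simp) (by simp) tA (by rwa [tr_neg]) ?_
    rw [mul_neg, tr_neg]
    rcases le_abs.1 hC with tC | tC
    · nlinarith [mul_pos (show 0 < tr A by linarith) (show 0 < -tr B by linarith)]
    · exact tC
  · refine key (-A) B (by simp) (by simp) (by rwa [tr_neg]) tB ?_
    rw [neg_mul, tr_neg]
    rcases le_abs.1 hC with tC | tC
    · nlinarith [mul_pos (show 0 < -tr A by linarith) (show 0 < tr B by linarith)]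
    · exact tC
  · refine key (-A) (-B) (by simp) (by simp) (by rwa [tr_neg]) (by rwa [tr_neg]) ?_
    rw [neg_mul_neg]
    rcases le_abs.1 hC with tC | tC
    · exact tC
    · nlinarith [mul_pos (show 0 < -tr A by linarith) (show 0 < -tr B by linarith)]

/-! ### Consequences of discreteness -/

namespace IsSurfaceGroup
variable {Γ : Subgroup SL(2, ℝ)}

theorem two_le_abs_tr (hΓ : IsSurfaceGroup Γ) {X : SL(2, ℝ)} (hX : X ∈ Γ) : 2 ≤ |tr X| := by
  by_contra h
  push Not at h
  obtain ⟨z, hz⟩ := exists_fixed_of_abs_tr_lt h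
  rcases hΓ.free X hX z hz with rfl | rfl
  · rw [tr_one] at h; norm_num at h
  · rw [tr_neg, tr_one] at h; norm_num at h

theorem exists_nhds (hΓ : IsSurfaceGroup Γ) :
    ∃ W ∈ 𝓝 (1 : SL(2, ℝ)), ∀ g ∈ Γ, g ∈ W → g = 1 := by
  have := hΓ.discrete
  obtain ⟨W, hW, hW'⟩ := isOpen_induced_iff.1 (isOpen_discrete ({1} : Set Γ))
  refine ⟨W, hW.mem_nhds ?_, fun g hg hgW => ?_⟩
  · have : (1 : Γ) ∈ Subtype.val ⁻¹' W := by rw [hW']; rfl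
    exact this
  · have : (⟨g, hg⟩ : Γ) ∈ Subtype.val ⁻¹' W := hgW
    rw [hW'] at this
    exact congrArg Subtype.val this

end IsSurfaceGroup

theorem continuous_entry (i j : Fin 2) : Continuous fun g : SL(2, ℝ) => g i j :=
  continuous_subtype_val.matrix_elem i j

theorem continuous_U : Continuous U := by
  refine Continuous.subtype_mk ?_ _
  refine continuous_matrix fun i j => ?_
  fin_cases i <;> fin_cases j <;> simp <;> fun_prop

theorem upper_conj_U {P : SL(2, ℝ)} (hP : P 1 0 = 0) (k : ℝ) :
    P * U k * P⁻¹ = U (P 0 0 ^ 2 * k) := by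
  have hd := det_entries P
  rw [hP] at hd
  apply ext_entries <;>
    simp only [mul_entry, inv_entry_00, inv_entry_01, inv_entry_10, inv_entry_11, U, sl_00, sl_01,
      sl_10, sl_11, hP]
  · linarith
  · ring
  · ring
  · linarith

/-- In a discrete group, a translation fixing a point at infinity that is attracting for another
element is trivial. -/
theorem IsSurfaceGroup.eq_one_of_contracted {Γ : Subgroup SL(2, ℝ)} (hΓ : IsSurfaceGroup Γ)
    {P N : SL(2, ℝ)} {k : ℝ} (hP : P ∈ Γ) (hK : N * U k * N⁻¹ ∈ Γ)
    (hc : (N⁻¹ * P * N) 1 0 = 0) (hl : (N⁻¹ * P * N) 0 0 ^ 2 < 1) : k = 0 := by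
  obtain ⟨W, hW, hW'⟩ := hΓ.exists_nhds
  set Q := N⁻¹ * P * N with hQ
  have e : ∀ n : ℕ, P ^ n * (N * U k * N⁻¹) * (P ^ n)⁻¹ = N * U ((Q 0 0 ^ 2) ^ n * k) * N⁻¹ := by
    intro n
    induction n with
    | zero => simp
    | succ n ih =>
      have hP' : P = N * Q * N⁻¹ := by rw [hQ]; group
      calc P ^ (n + 1) * (N * U k * N⁻¹) * (P ^ (n + 1))⁻¹
          = P * (P ^ n * (N * U k * N⁻¹) * (P ^ n)⁻¹) * P⁻¹ := by rw [pow_succ']; group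
        _ = N * (Q * U ((Q 0 0 ^ 2) ^ n * k) * Q⁻¹) * N⁻¹ := by
            rw [ih]; conv_lhs => rw [hP']
            group
        _ = _ := by rw [upper_conj_U hc]; congr 3; ring
  have hlim : Filter.Tendsto (fun n : ℕ => N * U ((Q 0 0 ^ 2) ^ n * k) * N⁻¹) Filter.atTop
      (𝓝 1) := by
    have h1 := (tendsto_pow_atTop_nhds_zero_of_lt_one (sq_nonneg (Q 0 0)) hl).mul_const k
    rw [zero_mul] at h1
    have h2 := (continuous_U.tendsto 0).comp h1
    rw [U_zero] at h2
    have h3 := (h2.const_mul N).mul_const N⁻¹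
    simpa using h3
  obtain ⟨n, hn⟩ := (hlim.eventually hW).exists
  have h1 := hW' _ (e n ▸ mul_mem (mul_mem (pow_mem hP n) hK) (inv_mem (pow_mem hP n))) hn
  have h2 : U ((Q 0 0 ^ 2) ^ n * k) = 1 := by
    calc _ = N⁻¹ * (N * U ((Q 0 0 ^ 2) ^ n * k) * N⁻¹) * N := by group
      _ = 1 := by rw [h1]; group
  have h3 : (Q 0 0 ^ 2) ^ n * k = 0 := congrArg (fun X : SL(2, ℝ) => X 0 1) h2
  have hd := det_entries Q
  rw [hc] at hd
  have h4 : Q 0 0 ≠ 0 := by intro h; rw [h] at hd; simp at hd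
  exact (mul_eq_zero.1 h3).resolve_left (by positivity)

/-- Two elements of a discrete torsion-free group with a common fixed point at infinity
commute. -/
theorem IsSurfaceGroup.commute_of_common_eigenvector {Γ : Subgroup SL(2, ℝ)}
    (hΓ : IsSurfaceGroup Γ) {A B : SL(2, ℝ)} (hA : A ∈ Γ) (hB : B ∈ Γ) {u w : ℝ}
    (huw : u ≠ 0 ∨ w ≠ 0) (qA : qf A u w = 0) (qB : qf B u w = 0) : A * B = B * A := by
  set N := colFrame u w huw with hN
  have hup : ∀ X : SL(2, ℝ), qf X u w = 0 → (N⁻¹ * X * N) 1 0 = 0 := by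
    intro X hX; rw [conj_entry_10]; exact hX
  have cA := hup A qA
  have cB := hup B qB
  have dA := det_entries (N⁻¹ * A * N)
  have dB := det_entries (N⁻¹ * B * N)
  set A' := N⁻¹ * A * N with hA'
  set B' := N⁻¹ * B * N with hB'
  rw [cA] at dA
  rw [cB] at dB
  obtain ⟨k, hk⟩ : ∃ k, A' * B' * A'⁻¹ * B'⁻¹ = U k := by
    refine ⟨(A' * B' * A'⁻¹ * B'⁻¹) 0 1, ?_⟩
    apply ext_entries <;>
      simp only [mul_entry, inv_entry_00, inv_entry_01, inv_entry_10, inv_entry_11, U, sl_00,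
        sl_01, sl_10, sl_11, cA, cB]
    · linear_combination (B' 0 0 * B' 1 1) * dA + dB
    · ring
    · linear_combination (B' 0 0 * B' 1 1) * dA + dB
  have eA : A = N * A' * N⁻¹ := by rw [hA']; group
  have eB : B = N * B' * N⁻¹ := by rw [hB']; group
  have hK : N * U k * N⁻¹ = A * B * A⁻¹ * B⁻¹ := by rw [← hk, eA, eB]; group
  have hKm : N * U k * N⁻¹ ∈ Γ := by
    rw [hK]; exact mul_mem (mul_mem (mul_mem hA hB) (inv_mem hA)) (inv_mem hB)
  have comm : k = 0 → A * B = B * A := by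
    rintro rfl
    rw [U_zero, mul_one, mul_inv_cancel] at hK
    have := mul_inv_eq_one.1 hK.symm
    exact mul_inv_eq_iff_eq_mul.1 this
  have contr : ∀ X ∈ Γ, qf X u w = 0 → (N⁻¹ * X * N) 0 0 ^ 2 ≠ 1 → k = 0 := by
    intro X hX qX h1
    have cX := hup X qX
    have dX := det_entries (N⁻¹ * X * N)
    rw [cX] at dX
    rcases lt_or_gt_of_ne h1 with h | h
    · exact hΓ.eq_one_of_contracted hX hKm cX h
    · refine hΓ.eq_one_of_contracted (inv_mem hX) hKm (hup _ (by rw [qf_inv, qX, neg_zero])) ?_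
      have e : N⁻¹ * X⁻¹ * N = (N⁻¹ * X * N)⁻¹ := by group
      rw [e, inv_entry_00]
      set p := (N⁻¹ * X * N) 0 0
      set q := (N⁻¹ * X * N) 1 1
      have h2 : p ^ 2 * q ^ 2 = 1 := by
        have : (p * q) ^ 2 = 1 := by rw [show p * q = 1 by linarith]; ring
        linarith [mul_pow p q 2]
      by_contra h3
      push Not at h3
      nlinarith
  by_cases h1 : A' 0 0 ^ 2 = 1
  · by_cases h2 : B' 0 0 ^ 2 = 1
    · obtain ⟨s, hs⟩ := eq_U_of_upper cA h1
      obtain ⟨t, ht⟩ := eq_U_of_upper cB h2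
      have hU : U s * U t = U t * U s := by rw [← U_add, ← U_add, add_comm]
      have : A' * B' = B' * A' := by
        rcases hs with hs | hs <;> rcases ht with ht | ht <;> rw [hs, ht] <;> simp [hU]
      rw [eA, eB]
      calc N * A' * N⁻¹ * (N * B' * N⁻¹) = N * (A' * B') * N⁻¹ := by group
        _ = N * (B' * A') * N⁻¹ := by rw [this]
        _ = _ := by group
    · exact comm (contr B hB qB h2)
  · exact comm (contr A hA qA h1)

/-! ### Conjugate groups -/

/-- The conjugate `M⁻¹ Γ M`, enlarged by `-1`. -/
def conjGroup (Γ : Subgroup SL(2, ℝ)) (M : SL(2, ℝ)) : Subgroup SL(2, ℝ) where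
  carrier := {g | M * g * M⁻¹ ∈ Γ ∨ -(M * g * M⁻¹) ∈ Γ}
  one_mem' := Or.inl (by simp)
  mul_mem' := by
    intro g h hg hh
    have e : M * (g * h) * M⁻¹ = (M * g * M⁻¹) * (M * h * M⁻¹) := by group
    simp only [Set.mem_ofPred_eq] at hg hh ⊢
    rw [e]
    rcases hg with hg | hg <;> rcases hh with hh | hh
    · exact Or.inl (mul_mem hg hh)
    · right; simpa using mul_mem hg hh
    · right; simpa using mul_mem hg hh
    · left; simpa using mul_mem hg hh
  inv_mem' := by
    intro g hg
    have e : M * g⁻¹ * M⁻¹ = (M * g * M⁻¹)⁻¹ := by group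
    have e' : -(M * g * M⁻¹)⁻¹ = (-(M * g * M⁻¹))⁻¹ := inv_neg.symm
    simp only [Set.mem_ofPred_eq] at hg ⊢
    rw [e, e']
    exact hg.imp inv_mem inv_mem

theorem mem_conjGroup {Γ : Subgroup SL(2, ℝ)} {M g : SL(2, ℝ)} :
    g ∈ conjGroup Γ M ↔ M * g * M⁻¹ ∈ Γ ∨ -(M * g * M⁻¹) ∈ Γ := Iff.rfl

theorem neg_mem_conjGroup {Γ : Subgroup SL(2, ℝ)} {M g : SL(2, ℝ)} (h : g ∈ conjGroup Γ M) :
    -g ∈ conjGroup Γ M := by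
  rw [mem_conjGroup] at h ⊢
  simpa [or_comm] using h

theorem neg_one_mem_conjGroup (Γ : Subgroup SL(2, ℝ)) (M : SL(2, ℝ)) : -1 ∈ conjGroup Γ M :=
  neg_mem_conjGroup (one_mem _)

theorem conjGroup_conjGroup (Γ : Subgroup SL(2, ℝ)) (M N : SL(2, ℝ)) :
    conjGroup (conjGroup Γ M) N = conjGroup Γ (M * N) := by
  ext g
  have e : M * (N * g * N⁻¹) * M⁻¹ = M * N * g * (M * N)⁻¹ := by group
  have e' : M * -(N * g * N⁻¹) * M⁻¹ = -(M * N * g * (M * N)⁻¹) := by rw [← e]; simp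
  rw [mem_conjGroup, mem_conjGroup, mem_conjGroup, mem_conjGroup, e, e', neg_neg]
  tauto

theorem discreteTopology_of_nhds {Γ : Subgroup SL(2, ℝ)}
    (h : ∃ W ∈ 𝓝 (1 : SL(2, ℝ)), ∀ g ∈ Γ, g ∈ W → g = 1) : DiscreteTopology Γ := by
  obtain ⟨W, hW, hW'⟩ := h
  apply discreteTopology_of_isOpen_singleton_one
  obtain ⟨O, hO, hOo, h1⟩ := mem_nhds_iff.1 hW
  refine isOpen_induced_iff.2 ⟨O, hOo, ?_⟩
  ext g
  simp only [Set.mem_preimage, Set.mem_singleton_iff]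
  constructor
  · intro hg; exact Subtype.ext (hW' g g.2 (hO hg))
  · rintro rfl; exact h1

theorem eq_one_or_of_sq {g : SL(2, ℝ)} (h : g * g = 1) : g = 1 ∨ g = -1 := by
  have h1 : g = g⁻¹ := eq_inv_of_mul_eq_one_left h
  have e1 : g 0 0 = g 1 1 := by conv_lhs => rw [h1, inv_entry_00]
  have e2 : g 0 1 = 0 := by
    have : g 0 1 = -g 0 1 := by conv_lhs => rw [h1, inv_entry_01]
    linarith
  have e3 : g 1 0 = 0 := by
    have : g 1 0 = -g 1 0 := by conv_lhs => rw [h1, inv_entry_10]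
    linarith
  have hd := det_entries g
  rw [← e1, e2] at hd
  rcases mul_self_eq_one_iff.1 (show g 0 0 * g 0 0 = 1 by linarith) with h0 | h0
  · left; apply ext_entries <;> simp [e2, e3, ← e1, h0]
  · right; apply ext_entries <;> simp [e2, e3, ← e1, h0]

theorem IsSurfaceGroup.conjGroup {Γ : Subgroup SL(2, ℝ)} (hΓ : IsSurfaceGroup Γ)
    (M : SL(2, ℝ)) : IsSurfaceGroup (conjGroup Γ M) where
  discrete := by
    apply discreteTopology_of_nhds
    obtain ⟨W, hW, hW'⟩ := hΓ.exists_nhds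
    -- squares of elements of the enlarged group lie in `Γ`
    have hc : Continuous fun g : SL(2, ℝ) => M * (g * g) * M⁻¹ := by fun_prop
    have h1 : (fun g : SL(2, ℝ) => M * (g * g) * M⁻¹) ⁻¹' W ∈ 𝓝 (1 : SL(2, ℝ)) :=
      hc.continuousAt.preimage_mem_nhds (by simpa using hW)
    have h2 : {g : SL(2, ℝ) | 0 < g 0 0} ∈ 𝓝 (1 : SL(2, ℝ)) :=
      (isOpen_lt continuous_const (continuous_entry 0 0)).mem_nhds (by simp)
    refine ⟨_, Filter.inter_mem h1 h2, ?_⟩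
    rintro g hg ⟨hg1, hg2⟩
    have hsq : M * (g * g) * M⁻¹ ∈ Γ := by
      have e : M * (g * g) * M⁻¹ = (M * g * M⁻¹) * (M * g * M⁻¹) := by group
      rw [e]
      rcases hg with hg | hg
      · exact mul_mem hg hg
      · simpa using mul_mem hg hg
    have h3 := hW' _ hsq hg1
    have h4 : g * g = 1 := by
      calc g * g = M⁻¹ * (M * (g * g) * M⁻¹) * M := by group
        _ = 1 := by rw [h3]; group
    rcases eq_one_or_of_sq h4 with h | h
    · exact h
    · rw [Set.mem_ofPred_eq, h] at hg2; norm_num at hg2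
  free := by
    intro g hg z hz
    have fix : (M * g * M⁻¹) • M • z = M • z := by
      rw [smul_smul, show M * g * M⁻¹ * M = M * g by group, mul_smul, hz]
    have back : ∀ h : SL(2, ℝ), M * g * M⁻¹ = h → g = M⁻¹ * h * M := by
      rintro h rfl; group
    rcases hg with hg | hg
    · rcases hΓ.free _ hg _ fix with h | h
      · left; rw [back _ h]; group
      · right; rw [back _ h]; simp
    · rcases hΓ.free _ hg (M • z) (by rw [neg_smul', fix]) with h | h
      · right; rw [back _ (neg_eq_iff_eq_neg.1 h)]; simp
      · left; rw [back _ (neg_injective h)]; group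

theorem proj_eq_iff {Γ : Subgroup SL(2, ℝ)} {z w : ℍ} :
    proj Γ z = proj Γ w ↔ ∃ g ∈ Γ, g • z = w := by
  unfold proj
  rw [Quotient.eq'']
  change z ∈ MulAction.orbit Γ w ↔ _
  constructor
  · rintro ⟨g, rfl⟩
    exact ⟨(g : SL(2, ℝ))⁻¹, inv_mem g.2, by
      change (g : SL(2, ℝ))⁻¹ • (g : SL(2, ℝ)) • w = w
      rw [inv_smul_smul]⟩
  · rintro ⟨g, hg, rfl⟩
    exact ⟨⟨g, hg⟩⁻¹, by
      change g⁻¹ • g • z = z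
      rw [inv_smul_smul]⟩

theorem proj_smul_eq_iff {Γ : Subgroup SL(2, ℝ)} {M : SL(2, ℝ)} {z w : ℍ} :
    proj Γ (M • z) = proj Γ (M • w) ↔ ∃ g ∈ conjGroup Γ M, g • z = w := by
  rw [proj_eq_iff]
  constructor
  · rintro ⟨g, hg, h⟩
    refine ⟨M⁻¹ * g * M, Or.inl ?_, ?_⟩
    · convert hg using 1; group
    · rw [mul_smul, mul_smul, h, inv_smul_smul]
  · rintro ⟨g, hg | hg, rfl⟩
    · exact ⟨_, hg, by rw [smul_smul, smul_smul]; congr 1; group⟩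
    · exact ⟨_, hg, by rw [neg_smul', smul_smul, smul_smul]; congr 1; group⟩

/-! ### Pairs of parabolic elements -/

/-- The parabolic element `z ↦ z / (t z + 1)`. -/
def Lo (t : ℝ) : SL(2, ℝ) := sl 1 0 t 1 (by ring)

theorem Lo_add (s t : ℝ) : Lo (s + t) = Lo s * Lo t := by
  apply ext_entries <;> rw [mul_entry] <;> simp [Lo]

theorem Lo_zero : Lo 0 = 1 := by apply ext_entries <;> simp [Lo]

theorem Lo_neg (t : ℝ) : Lo (-t) = (Lo t)⁻¹ := by
  rw [eq_inv_iff_mul_eq_one, ← Lo_add, neg_add_cancel, Lo_zero]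

theorem Lo_zpow (t : ℝ) (n : ℤ) : Lo t ^ n = Lo (n * t) := by
  induction n with
  | zero => simp [Lo_zero]
  | succ n ih => rw [zpow_add_one, ih, ← Lo_add]; congr 1; push_cast; ring
  | pred n ih => rw [zpow_sub_one, ih, ← Lo_neg, ← Lo_add]; congr 1; push_cast; ring

/-- Two parabolic elements of trace `2` whose product has trace `-2` or `6` are conjugate to
the standard parabolic elements fixing `∞` and `0`. -/
theorem exists_conj_standard {A B : SL(2, ℝ)} (hA : tr A = 2) (hB : tr B = 2)
    (hAB : |tr (A * B) - 2| = 4) : ∃ N : SL(2, ℝ),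
      (N⁻¹ * A * N = U 2 ∨ N⁻¹ * A * N = U (-2)) ∧
      (N⁻¹ * B * N = Lo 2 ∨ N⁻¹ * B * N = Lo (-2)) := by
  obtain ⟨u, w, hv, qA⟩ := exists_eigenvector (X := A) (by rw [hA]; norm_num)
  obtain ⟨u', w', hv', qB⟩ := exists_eigenvector (X := B) (by rw [hB]; norm_num)
  have unip : ∀ X : SL(2, ℝ), tr X = 2 → X 1 0 = 0 ∨ X 0 1 = 0 → X 0 0 = 1 ∧ X 1 1 = 1 := by
    intro X hX h0
    have hd := det_entries X
    unfold tr at hX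
    have h1 : X 0 0 * X 1 1 = 1 := by rcases h0 with h0 | h0 <;> rw [h0] at hd <;> linarith
    have h2 : (X 0 0 - 1) ^ 2 = 0 := by
      have : X 1 1 = 2 - X 0 0 := by linarith
      rw [this] at h1; linarith
    have h3 : X 0 0 = 1 := by
      have := pow_eq_zero_iff (two_ne_zero) |>.1 h2
      linarith
    exact ⟨h3, by linarith⟩
  have upper : ∀ X : SL(2, ℝ), tr X = 2 → X 1 0 = 0 → ∃ m, X = U m := by
    intro X hX h0
    obtain ⟨h1, h2⟩ := unip X hX (Or.inl h0)
    exact ⟨X 0 1, by apply ext_entries <;> simp [U, h0, h1, h2]⟩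
  have lower : ∀ X : SL(2, ℝ), tr X = 2 → X 0 1 = 0 → ∃ m, X = Lo m := by
    intro X hX h0
    obtain ⟨h1, h2⟩ := unip X hX (Or.inr h0)
    exact ⟨X 1 0, by apply ext_entries <;> simp [Lo, h0, h1, h2]⟩
  have trAB : ∀ N : SL(2, ℝ), tr (A * B) = tr (N⁻¹ * A * N * (N⁻¹ * B * N)) := by
    intro N
    rw [← tr_conj' N]; congr 1; group
  by_cases hδ : u * w' - w * u' = 0
  · exfalso
    have qB' : qf B u w = 0 := by
      have e : ∃ k : ℝ, u = k * u' ∧ w = k * w' := by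
        rcases hv' with h | h
        · exact ⟨u / u', by field_simp, by field_simp; linarith⟩
        · exact ⟨w / w', by field_simp; linarith, by field_simp⟩
      obtain ⟨k, rfl, rfl⟩ := e
      have : qf B (k * u') (k * w') = k ^ 2 * qf B u' w' := by simp only [qf]; ring
      rw [this, qB, mul_zero]
    set N := colFrame u w hv
    obtain ⟨m, hm⟩ := upper (N⁻¹ * A * N) (by rw [tr_conj', hA]) (by rw [conj_entry_10]; exact qA)
    obtain ⟨n, hn⟩ := upper (N⁻¹ * B * N) (by rw [tr_conj', hB]) (by rw [conj_entry_10]; exact qB')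
    rw [trAB N, hm, hn, ← U_add] at hAB
    norm_num [tr, U] at hAB
  · set δ := u * w' - w * u' with hδd
    set N := sl u (u' / δ) w (w' / δ) (by field_simp; rw [hδd]; ring)
    obtain ⟨m, hm⟩ := upper (N⁻¹ * A * N) (by rw [tr_conj', hA]) (by rw [conj_entry_10]; exact qA)
    obtain ⟨n, hn⟩ := lower (N⁻¹ * B * N) (by rw [tr_conj', hB]) (by
      rw [conj_entry_01]
      have : qf B (u' / δ) (w' / δ) = δ⁻¹ ^ 2 * qf B u' w' := by simp only [qf]; ring
      simp only [N, sl_01, sl_11]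
      rw [this, qB]; simp)
    have hmn : |m| * |n| = 4 := by
      rw [trAB N, hm, hn] at hAB
      have : tr (U m * Lo n) - 2 = m * n := by
        simp only [tr, mul_entry, U, Lo, sl_00, sl_01, sl_10, sl_11]; ring
      rw [this, abs_mul] at hAB
      exact hAB
    have hm0 : 0 < |m| := by
      rcases (abs_nonneg m).lt_or_eq with h | h
      · exact h
      · rw [← h] at hmn; norm_num at hmn
    obtain ⟨s, hs⟩ : ∃ s, Real.exp s = |m| / 2 := ⟨Real.log (|m| / 2), Real.exp_log (by positivity)⟩
    have hs2 : Real.exp (s / 2) * Real.exp (s / 2) = |m| / 2 := by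
      rw [← Real.exp_add, add_halves, hs]
    have hs1 : Real.exp (s / 2) * Real.exp (-(s / 2)) = 1 := by rw [← Real.exp_add]; simp
    have hs3 : Real.exp (-(s / 2)) * Real.exp (-(s / 2)) * (|m| / 2) = 1 := by
      rw [← hs2]; linear_combination (Real.exp (s / 2) * Real.exp (-(s / 2)) + 1) * hs1
    have cU : ∀ m', m' * (Real.exp (-(s / 2)) * Real.exp (-(s / 2))) = 2 ∨
        m' * (Real.exp (-(s / 2)) * Real.exp (-(s / 2))) = -2 →
        (D s)⁻¹ * U m' * D s = U 2 ∨ (D s)⁻¹ * U m' * D s = U (-2) := by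
      intro m' h
      have e : (D s)⁻¹ * U m' * D s =
          U (m' * (Real.exp (-(s / 2)) * Real.exp (-(s / 2)))) := by
        apply ext_entries <;>
          simp only [mul_entry, inv_entry_00, inv_entry_01, inv_entry_10, inv_entry_11, U, D,
            sl_00, sl_01, sl_10, sl_11]
        · linear_combination hs1
        · ring
        · ring
        · linear_combination hs1
      rw [e]
      exact h.imp (fun h => by rw [h]) (fun h => by rw [h])
    have cL : ∀ m', m' * (Real.exp (s / 2) * Real.exp (s / 2)) = 2 ∨
        m' * (Real.exp (s / 2) * Real.exp (s / 2)) = -2 →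
        (D s)⁻¹ * Lo m' * D s = Lo 2 ∨ (D s)⁻¹ * Lo m' * D s = Lo (-2) := by
      intro m' h
      have e : (D s)⁻¹ * Lo m' * D s =
          Lo (m' * (Real.exp (s / 2) * Real.exp (s / 2))) := by
        apply ext_entries <;>
          simp only [mul_entry, inv_entry_00, inv_entry_01, inv_entry_10, inv_entry_11, Lo, D,
            sl_00, sl_01, sl_10, sl_11]
        · linear_combination hs1
        · ring
        · ring
        · linear_combination hs1
      rw [e]
      exact h.imp (fun h => by rw [h]) (fun h => by rw [h])
    refine ⟨N * D s, ?_, ?_⟩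
    · rw [show (N * D s)⁻¹ * A * (N * D s) = (D s)⁻¹ * (N⁻¹ * A * N) * D s by group, hm]
      apply cU
      rcases abs_choice m with h | h <;> rw [h] at hs3
      · left; linarith
      · right; linarith
    · rw [show (N * D s)⁻¹ * B * (N * D s) = (D s)⁻¹ * (N⁻¹ * B * N) * D s by group, hn]
      apply cL
      rw [hs2]
      rcases abs_choice n with h | h <;> rw [h] at hmn
      · left; linarith
      · right; linarith

/-! ### The principal congruence subgroup of level two -/

/-- The integral matrices with odd diagonal and even off-diagonal entries, in `SL(2, ℝ)`. -/
def Gamma2 : Subgroup SL(2, ℝ) where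
  carrier := {g | ∃ a b c d : ℤ, g 0 0 = 2 * a + 1 ∧ g 0 1 = 2 * b ∧ g 1 0 = 2 * c ∧
    g 1 1 = 2 * d + 1}
  one_mem' := ⟨0, 0, 0, 0, by simp, by simp, by simp, by simp⟩
  mul_mem' := by
    rintro g h ⟨a, b, c, d, ha, hb, hc, hd⟩ ⟨a', b', c', d', ha', hb', hc', hd'⟩
    refine ⟨2 * a * a' + a + a' + 2 * b * c', (2 * a + 1) * b' + b * (2 * d' + 1),
      c * (2 * a' + 1) + (2 * d + 1) * c', 2 * d * d' + d + d' + 2 * c * b', ?_, ?_, ?_, ?_⟩ <;>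
      simp only [mul_entry, ha, hb, hc, hd, ha', hb', hc', hd'] <;> push_cast <;> ring
  inv_mem' := by
    rintro g ⟨a, b, c, d, ha, hb, hc, hd⟩
    refine ⟨d, -b, -c, a, ?_, ?_, ?_, ?_⟩
    · rw [inv_entry_00, hd]
    · rw [inv_entry_01, hb]; push_cast; ring
    · rw [inv_entry_10, hc]; push_cast; ring
    · rw [inv_entry_11, ha]

theorem mem_Gamma2 {g : SL(2, ℝ)} : g ∈ Gamma2 ↔ ∃ a b c d : ℤ, g 0 0 = 2 * a + 1 ∧
    g 0 1 = 2 * b ∧ g 1 0 = 2 * c ∧ g 1 1 = 2 * d + 1 := Iff.rfl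

theorem neg_one_mem_Gamma2 : -1 ∈ Gamma2 :=
  ⟨-1, 0, 0, -1, by simp; norm_num, by simp, by simp, by simp; norm_num⟩

theorem U_mem_Gamma2 (n : ℤ) : U (2 * n) ∈ Gamma2 :=
  ⟨0, n, 0, 0, by simp [U], by simp [U], by simp [U], by simp [U]⟩

theorem Lo_mem_Gamma2 (n : ℤ) : Lo (2 * n) ∈ Gamma2 :=
  ⟨0, 0, n, 0, by simp [Lo], by simp [Lo], by simp [Lo], by simp [Lo]⟩

/-- The trace of an element of `Gamma2` is congruent to `2` modulo `4`. -/
theorem exists_tr_Gamma2 {g : SL(2, ℝ)} (hg : g ∈ Gamma2) : ∃ n : ℤ, tr g = 4 * n + 2 := by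
  obtain ⟨a, b, c, d, ha, hb, hc, hd⟩ := hg
  have h := det_entries g
  rw [ha, hb, hc, hd] at h
  have h' : (2 * a + 1) * (2 * d + 1) - 2 * b * (2 * c) = 1 := by exact_mod_cast h
  refine ⟨b * c - a * d, ?_⟩
  rw [tr, ha, hd]
  push_cast
  linarith

/-- An element with a fixed point in `ℍ` is elliptic or `±1`. -/
theorem fixed_cases {g : SL(2, ℝ)} {z : ℍ} (h : g • z = z) : g = 1 ∨ g = -1 ∨ |tr g| < 2 := by
  have hd := det_entries g
  have h0 := denom_pos g z
  have hy := z.im_pos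
  have him := congrArg UpperHalfPlane.im h
  have hre := congrArg UpperHalfPlane.re h
  rw [smul_im, div_eq_iff h0.ne'] at him
  rw [smul_re, div_eq_iff h0.ne'] at hre
  have hden : (g 1 0 * z.re + g 1 1) ^ 2 + (g 1 0 * z.im) ^ 2 = 1 := by
    apply mul_left_cancel₀ hy.ne'
    linarith
  rw [hden, mul_one] at hre
  by_cases hc : g 1 0 = 0
  · rw [hc] at hd hden hre
    have h1 : g 1 1 * g 1 1 = 1 := by linarith
    have hda : g 0 0 = g 1 1 := by
      have h2 : g 0 0 * (g 1 1 * g 1 1) = g 1 1 := by linear_combination g 1 1 * hd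
      rwa [h1, mul_one] at h2
    have hb : g 0 1 = 0 := by
      have h3 : g 0 1 * (g 1 1 * g 1 1) = 0 := by
        rw [hda] at hre
        linear_combination g 1 1 * hre - g 1 1 * z.re * h1
      rwa [h1, mul_one] at h3
    rcases mul_self_eq_one_iff.1 h1 with h2 | h2
    · left; apply ext_entries <;> simp [hb, hc, hda, h2]
    · right; left; apply ext_entries <;> simp [hb, hc, hda, h2]
  · right; right
    have hc2 : 0 < (g 1 0 * z.im) ^ 2 := by positivity
    have e : 2 * (g 1 0 * z.re) = g 0 0 - g 1 1 := by
      have h2 : g 1 0 * (g 0 0 * g 1 0 * (z.re ^ 2 + z.im ^ 2) +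
          (g 0 0 * g 1 1 + g 0 1 * g 1 0) * z.re + g 0 1 * g 1 1) = g 1 0 * z.re := by rw [hre]
      have h3 : g 0 0 - (g 1 0 * z.re + g 1 1) = g 1 0 * z.re := by
        linear_combination h2 - g 0 0 * hden + (g 1 0 * z.re + g 1 1) * hd
      linarith
    have h4 : tr g ^ 2 < 4 := by
      have : g 1 0 * z.re + g 1 1 = tr g / 2 := by unfold tr; linarith
      rw [this] at hden
      nlinarith
    exact abs_lt.2 ⟨by nlinarith, by nlinarith⟩

theorem isSurfaceGroup_Gamma2 : IsSurfaceGroup Gamma2 where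
  discrete := by
    apply discreteTopology_of_nhds
    have near : ∀ (i j : Fin 2), {g : SL(2, ℝ) | |g i j - (1 : SL(2, ℝ)) i j| < 1} ∈
        𝓝 (1 : SL(2, ℝ)) := by
      intro i j
      refine (isOpen_lt ?_ continuous_const).mem_nhds (by simp)
      exact ((continuous_entry i j).sub continuous_const).abs
    refine ⟨_, Filter.inter_mem (Filter.inter_mem (near 0 0) (near 0 1))
      (Filter.inter_mem (near 1 0) (near 1 1)), ?_⟩
    rintro g ⟨a, b, c, d, ha, hb, hc, hd⟩ ⟨⟨h1, h2⟩, h3, h4⟩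
    simp only [Set.mem_ofPred_eq, ha, hb, hc, hd, one_entry_00, one_entry_01, one_entry_10,
      one_entry_11] at h1 h2 h3 h4
    have z : ∀ n : ℤ, |(2 * n : ℝ)| < 1 → n = 0 := by
      intro n hn
      have : |2 * n| < 1 := by exact_mod_cast hn
      rw [abs_lt] at this; omega
    have a0 := z a (by simpa using h1)
    have b0 := z b (by simpa using h2)
    have c0 := z c (by simpa using h3)
    have d0 := z d (by simpa using h4)
    apply ext_entries <;> simp [ha, hb, hc, hd, a0, b0, c0, d0]
  free := by
    intro g hg z hz
    rcases fixed_cases hz with h | h | h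
    · exact Or.inl h
    · exact Or.inr h
    · obtain ⟨n, hn⟩ := exists_tr_Gamma2 hg
      rw [hn] at h
      have h' : |4 * n + 2| < 2 := by exact_mod_cast h
      rw [abs_lt] at h'; omega

/-- If the points `t + 2 * n * e` all avoid `(-2, 2)`, then the step `2 * |e|` is `0` or at least
the length `4` of that interval. -/
theorem gap {t e : ℝ} (h : ∀ n : ℤ, 2 ≤ |t + 2 * n * e|) : e = 0 ∨ 2 ≤ |e| := by
  by_cases he : e = 0
  · exact Or.inl he
  · right
    have h1 := h (-round (t / (2 * e)))
    have h2 := abs_sub_round (t / (2 * e))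
    have e1 : t + 2 * ((-round (t / (2 * e)) : ℤ) : ℝ) * e =
        (t / (2 * e) - round (t / (2 * e))) * (2 * e) := by
      push_cast; field_simp; ring
    rw [e1, abs_mul, abs_mul] at h1
    norm_num at h1
    nlinarith [abs_nonneg e]

/-- The group generated by the standard parabolic elements. -/
def stdGroup : Subgroup SL(2, ℝ) := Subgroup.closure {U 2, Lo 2, -1}

theorem U_mem_stdGroup (n : ℤ) : U (2 * n) ∈ stdGroup := by
  have h : U 2 ∈ stdGroup := Subgroup.subset_closure (by simp)
  have := zpow_mem h n
  rwa [U_zpow, mul_comm] at this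

theorem Lo_mem_stdGroup (n : ℤ) : Lo (2 * n) ∈ stdGroup := by
  have h : Lo 2 ∈ stdGroup := Subgroup.subset_closure (by simp)
  have := zpow_mem h n
  rwa [Lo_zpow, mul_comm] at this

theorem neg_one_mem_stdGroup : -1 ∈ stdGroup := Subgroup.subset_closure (by simp)

theorem neg_mem_stdGroup {g : SL(2, ℝ)} (h : g ∈ stdGroup) : -g ∈ stdGroup := by
  simpa using mul_mem neg_one_mem_stdGroup h

/-- The parabolic elements fixing `1`. -/
def parabOne (t : ℝ) : SL(2, ℝ) := sl (1 + t) (-t) t (1 - t) (by ring)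

/-- The parabolic elements fixing `-1`. -/
def parabNegOne (t : ℝ) : SL(2, ℝ) := sl (1 - t) (-t) t (1 + t) (by ring)

theorem parabOne_mem_stdGroup (n : ℤ) : parabOne (2 * n) ∈ stdGroup := by
  have h : parabOne 2 ∈ stdGroup := by
    have e : parabOne 2 = -(U 2 * Lo (-2)) := by
      apply ext_entries <;> rw [neg_entry, mul_entry] <;> simp [parabOne, U, Lo] <;> norm_num
    rw [e]
    have h1 := U_mem_stdGroup 1
    have h2 := Lo_mem_stdGroup (-1)
    push_cast at h1 h2
    norm_num at h1 h2
    exact neg_mem_stdGroup (mul_mem h1 h2)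
  have e : parabOne (2 * n) = U 1 * Lo (2 * n) * (U 1)⁻¹ := by
    apply ext_entries <;>
      simp only [mul_entry, inv_entry_00, inv_entry_01, inv_entry_10, inv_entry_11, U, parabOne, Lo,
        sl_00, sl_01, sl_10, sl_11] <;> ring
  have e1 : parabOne 2 = U 1 * Lo 2 * (U 1)⁻¹ := by
    apply ext_entries <;>
      simp only [mul_entry, inv_entry_00, inv_entry_01, inv_entry_10, inv_entry_11, U, parabOne, Lo,
        sl_00, sl_01, sl_10, sl_11] <;> ring
  have := zpow_mem h n
  rwa [e1, conj_zpow, Lo_zpow, mul_comm (n : ℝ), ← e] at this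

theorem parabNegOne_mem_stdGroup (n : ℤ) : parabNegOne (2 * n) ∈ stdGroup := by
  have h : parabNegOne 2 ∈ stdGroup := by
    have e : parabNegOne 2 = -(Lo (-2) * U 2) := by
      apply ext_entries <;> rw [neg_entry, mul_entry] <;> simp [parabNegOne, U, Lo] <;> norm_num
    rw [e]
    have h1 := U_mem_stdGroup 1
    have h2 := Lo_mem_stdGroup (-1)
    push_cast at h1 h2
    norm_num at h1 h2
    exact neg_mem_stdGroup (mul_mem h2 h1)
  have e : parabNegOne (2 * n) = (U 1)⁻¹ * Lo (2 * n) * (U 1)⁻¹⁻¹ := by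
    rw [inv_inv]
    apply ext_entries <;>
      simp only [mul_entry, inv_entry_00, inv_entry_01, inv_entry_10, inv_entry_11, U,
        parabNegOne, Lo,
        sl_00, sl_01, sl_10, sl_11] <;> ring
  have e1 : parabNegOne 2 = (U 1)⁻¹ * Lo 2 * (U 1)⁻¹⁻¹ := by
    rw [inv_inv]
    apply ext_entries <;>
      simp only [mul_entry, inv_entry_00, inv_entry_01, inv_entry_10, inv_entry_11, U,
        parabNegOne, Lo,
        sl_00, sl_01, sl_10, sl_11] <;> ring
  have := zpow_mem h n
  rwa [e1, conj_zpow, Lo_zpow, mul_comm (n : ℝ), ← e] at this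

theorem im_smul_I (g : SL(2, ℝ)) :
    (g • UpperHalfPlane.I).im = 1 / (g 1 0 ^ 2 + g 1 1 ^ 2) := by
  rw [smul_im]; simp; ring

/-- A discrete torsion-free group containing the standard parabolic elements is generated by them:
in a coset, an element with the smallest bottom row that is not upper triangular would give rise
to an elliptic element. -/
theorem IsSurfaceGroup.le_stdGroup {Γ : Subgroup SL(2, ℝ)} (hΓ : IsSurfaceGroup Γ)
    (hle : stdGroup ≤ Γ) : Γ ≤ stdGroup := by
  have gU : ∀ g ∈ Γ, g 1 0 = 0 ∨ 2 ≤ |g 1 0| := by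
    intro g hg
    apply gap (t := tr g)
    intro n
    have := hΓ.two_le_abs_tr (mul_mem hg (hle (U_mem_stdGroup n)))
    convert this using 2
    simp only [tr, mul_entry, U, sl_00, sl_01, sl_10, sl_11]; ring
  have gL : ∀ g ∈ Γ, g 0 1 = 0 ∨ 2 ≤ |g 0 1| := by
    intro g hg
    apply gap (t := tr g)
    intro n
    have := hΓ.two_le_abs_tr (mul_mem hg (hle (Lo_mem_stdGroup n)))
    convert this using 2
    simp only [tr, mul_entry, Lo, sl_00, sl_01, sl_10, sl_11]; ring
  have g1 : ∀ g ∈ Γ, g 0 0 + g 0 1 - g 1 0 - g 1 1 = 0 ∨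
      2 ≤ |g 0 0 + g 0 1 - g 1 0 - g 1 1| := by
    intro g hg
    apply gap (t := tr g)
    intro n
    have := hΓ.two_le_abs_tr (mul_mem hg (hle (parabOne_mem_stdGroup n)))
    convert this using 2
    simp only [tr, mul_entry, parabOne, sl_00, sl_01, sl_10, sl_11]; ring
  have g2 : ∀ g ∈ Γ, -g 0 0 + g 0 1 - g 1 0 + g 1 1 = 0 ∨
      2 ≤ |-g 0 0 + g 0 1 - g 1 0 + g 1 1| := by
    intro g hg
    apply gap (t := tr g)
    intro n
    have := hΓ.two_le_abs_tr (mul_mem hg (hle (parabNegOne_mem_stdGroup n)))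
    convert this using 2
    simp only [tr, mul_entry, parabNegOne, sl_00, sl_01, sl_10, sl_11]; ring
  -- upper triangular elements are generated
  have tri : ∀ g ∈ Γ, g 1 0 = 0 → g ∈ stdGroup := by
    intro g hg hc
    have hd := det_entries g
    rw [hc] at hd
    have hcomm := hΓ.commute_of_common_eigenvector hg (hle (U_mem_stdGroup 1)) (u := 1) (w := 0)
      (by simp) (by simp [qf, hc]) (by simp [qf, U])
    have h01 := congrArg (fun X : SL(2, ℝ) => X 0 1) hcomm
    simp only [mul_entry] at h01
    simp only [U, sl_00, sl_01, sl_11] at h01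
    push_cast at h01
    have hda : g 0 0 = g 1 1 := by linarith
    obtain ⟨t, ht⟩ := eq_U_of_upper hc (by rw [sq]; nth_rewrite 2 [hda]; linarith)
    have ht' : U t ∈ Γ := by
      rcases ht with h | h
      · rwa [← h]
      · have : U t = -1 * g := by rw [h]; simp
        rw [this]
        exact mul_mem (hle neg_one_mem_stdGroup) hg
    have hUt : U t ∈ stdGroup := by
      set m := round (t / 2)
      have h2 := abs_sub_round (t / 2)
      have h3 : U (t - 2 * m) ∈ Γ := by
        have := mul_mem ht' (hle (U_mem_stdGroup (-m)))
        rw [← U_add] at this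
        convert this using 2
        push_cast; ring
      have h4 := gL _ h3
      simp only [U, sl_01] at h4
      have h5 : t - 2 * m = 0 := by
        refine h4.resolve_right fun h => ?_
        have : t - 2 * m = 2 * (t / 2 - m) := by ring
        rw [this, abs_mul] at h
        norm_num at h
        linarith
      rw [show t = 2 * m by linarith]
      exact U_mem_stdGroup m
    rcases ht with h | h
    · rwa [h]
    · rw [h]; exact neg_mem_stdGroup hUt
  intro g₀ hg₀
  by_contra hg₀'
  set r : SL(2, ℝ) → ℝ := fun g => g 1 0 ^ 2 + g 1 1 ^ 2 with hr
  have rpos : ∀ g, 0 < r g := by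
    intro g
    have := denom_pos g UpperHalfPlane.I
    simp only [UpperHalfPlane.I_re, UpperHalfPlane.I_im] at this
    simp only [hr]; linarith
  -- the elements outside `stdGroup`
  have notin : ∀ g ∈ Γ, g ∉ stdGroup → 1 ≤ r g := by
    intro g hg hg'
    have h1 : g 1 0 ≠ 0 := fun h => hg' (tri g hg h)
    have h2 := (gU g hg).resolve_left h1
    have h3 : 4 ≤ g 1 0 ^ 2 := by rw [← sq_abs]; nlinarith
    simp only [hr]; nlinarith [sq_nonneg (g 1 1)]
  set K : Set ℍ := {z : ℍ | |z.re| ≤ 1 ∧ 1 / r g₀ ≤ z.im ∧ z.im ≤ 1} with hK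
  have hKc : IsCompact K := by
    rw [UpperHalfPlane.isEmbedding_coe.isCompact_iff]
    have : UpperHalfPlane.coe '' K = Set.Icc (-1) 1 ×ℂ Set.Icc (1 / r g₀) 1 := by
      ext z
      constructor
      · rintro ⟨w, ⟨h1, h2, h3⟩, rfl⟩
        exact ⟨abs_le.1 h1, h2, h3⟩
      · rintro ⟨h1, h2, h3⟩
        have : 0 < z.im := lt_of_lt_of_le (by have := rpos g₀; positivity) h2
        exact ⟨⟨z, this⟩, ⟨abs_le.2 h1, h2, h3⟩, rfl⟩
    rw [this]
    exact isCompact_Icc.reProdIm isCompact_Icc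
  have := hΓ.discrete
  have hfin := ProperlyDiscontinuousSMul.finite_disjoint_inter_image (Γ := Γ)
    (isCompact_singleton (x := UpperHalfPlane.I)) hKc
  set S : Set ℝ := {x | ∃ s ∈ stdGroup, x = r (g₀ * s) ∧ r (g₀ * s) ≤ r g₀} with hS
  have hSfin : S.Finite := by
    refine (hfin.image fun g : Γ => r g).subset ?_
    rintro x ⟨s, hs, rfl, hle'⟩
    set g := g₀ * s with hg
    have hgm : g ∈ Γ := mul_mem hg₀ (hle hs)
    have hgn : g ∉ stdGroup := fun h => hg₀' (by
      have := mul_mem h (inv_mem hs); rwa [hg, mul_inv_cancel_right] at this)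
    set n := round ((g • UpperHalfPlane.I).re / 2)
    have h2 := abs_sub_round ((g • UpperHalfPlane.I).re / 2)
    refine ⟨⟨U (2 * (-n : ℤ)) * g, mul_mem (hle (U_mem_stdGroup _)) hgm⟩, ?_, ?_⟩
    · refine ⟨(U (2 * (-n : ℤ)) * g) • UpperHalfPlane.I, ⟨_, rfl, rfl⟩, ?_⟩
      rw [mul_smul]
      refine ⟨?_, ?_, ?_⟩
      · rw [U_smul_re]
        have : (g • UpperHalfPlane.I).re + 2 * ((-n : ℤ) : ℝ) =
          2 * ((g • UpperHalfPlane.I).re / 2 - n) := by push_cast; ring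
        rw [this, abs_mul]; norm_num; linarith
      · rw [U_smul_im, im_smul_I]
        exact one_div_le_one_div_of_le (rpos g) hle'
      · rw [U_smul_im, im_smul_I]
        have := notin g hgm hgn
        rw [div_le_one (rpos g)]; exact this
    · simp only [hr, mul_entry, U, sl_10, sl_11]; ring
  obtain ⟨x, ⟨s, hs, rfl, hsle⟩, hmin⟩ := Set.exists_min_image S id hSfin
    (⟨r g₀, 1, one_mem _, by simp, by simp⟩ : S.Nonempty)
  set g := g₀ * s with hg
  have hgm : g ∈ Γ := mul_mem hg₀ (hle hs)
  have hgn : g ∉ stdGroup := fun h => hg₀' (by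
    have := mul_mem h (inv_mem hs); rwa [hg, mul_inv_cancel_right] at this)
  have min : ∀ s' ∈ stdGroup, r g ≤ r (g * s') := by
    intro s' hs'
    by_contra hlt
    push Not at hlt
    have e : g * s' = g₀ * (s * s') := by rw [hg, mul_assoc]
    have := hmin (r (g * s')) ⟨s * s', mul_mem hs hs', by rw [e], by rw [← e]; linarith⟩
    simp only [id] at this
    linarith
  have hd := det_entries g
  have hc := (gU g hgm).resolve_left fun h => hgn (tri g hgm h)
  have hc0 : g 1 0 ≠ 0 := fun h => hgn (tri g hgm h)
  by_cases hd0 : g 1 1 = 0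
  · rw [hd0] at hd
    have hb := (gL g hgm).resolve_left (by intro h; rw [h] at hd; norm_num at hd)
    have : |g 0 1| * |g 1 0| = 1 := by
      rw [← abs_mul, show g 0 1 * g 1 0 = -1 by linarith]; norm_num
    nlinarith
  · have m1 := min _ (U_mem_stdGroup 1)
    have m2 := min _ (U_mem_stdGroup (-1))
    have m3 := min _ (Lo_mem_stdGroup 1)
    have m4 := min _ (Lo_mem_stdGroup (-1))
    simp only [hr, mul_entry, U, Lo, sl_00, sl_01, sl_10, sl_11] at m1 m2 m3 m4
    push_cast at m1 m2 m3 m4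
    have k1 : |g 1 0| * |g 1 1| ≤ |g 1 0| * |g 1 0| := by
      rw [← abs_mul, abs_mul_abs_self, abs_le]; constructor <;> nlinarith
    have k2 : |g 1 1| * |g 1 0| ≤ |g 1 1| * |g 1 1| := by
      rw [← abs_mul, abs_mul_abs_self, abs_le]; constructor <;> nlinarith
    have k3 := le_of_mul_le_mul_left k1 (abs_pos.2 hc0)
    have k4 := le_of_mul_le_mul_left k2 (abs_pos.2 hd0)
    rcases abs_eq_abs.1 (le_antisymm k4 k3) with h | h
    · have e1 : g 1 0 * (g 0 0 - g 0 1) = 1 := by rw [← h] at hd; linarith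
      have e2 : |-g 0 0 + g 0 1 - g 1 0 + g 1 1| = |g 0 0 - g 0 1| := by
        rw [h, ← abs_neg]; congr 1; ring
      have e3 := congrArg abs e1
      rw [abs_mul, abs_one] at e3
      have h3 := (g2 g hgm).resolve_left (by
        intro h0
        rw [h0, abs_zero] at e2
        rw [← e2] at e3; norm_num at e3)
      rw [e2] at h3
      nlinarith
    · have e1 : g 1 0 * (g 0 0 + g 0 1) = -1 := by
        have : g 1 1 = -g 1 0 := by linarith
        rw [this] at hd; linarith
      have e2 : |g 0 0 + g 0 1 - g 1 0 - g 1 1| = |g 0 0 + g 0 1| := by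
        rw [h]; congr 1; ring
      have e3 := congrArg abs e1
      rw [abs_mul, abs_neg, abs_one] at e3
      have h3 := (g1 g hgm).resolve_left (by
        intro h0
        rw [h0, abs_zero] at e2
        rw [← e2] at e3; norm_num at e3)
      rw [e2] at h3
      nlinarith

theorem stdGroup_le_Gamma2 : stdGroup ≤ Gamma2 := by
  rw [stdGroup, Subgroup.closure_le]
  rintro g (rfl | rfl | rfl)
  · simpa using U_mem_Gamma2 1
  · simpa using Lo_mem_Gamma2 1
  · exact neg_one_mem_Gamma2

/-- A discrete torsion-free group containing `-1` and the standard parabolic elements is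
`Gamma2`. -/
theorem IsSurfaceGroup.eq_Gamma2 {Γ : Subgroup SL(2, ℝ)} (hΓ : IsSurfaceGroup Γ)
    (hU : U 2 ∈ Γ) (hL : Lo 2 ∈ Γ) (h1 : -1 ∈ Γ) : Γ = Gamma2 := by
  have hle : stdGroup ≤ Γ := by
    rw [stdGroup, Subgroup.closure_le]
    rintro g (rfl | rfl | rfl) <;> assumption
  exact le_antisymm ((hΓ.le_stdGroup hle).trans stdGroup_le_Gamma2)
    ((isSurfaceGroup_Gamma2.le_stdGroup stdGroup_le_Gamma2).trans hle)

/-! ### The universal covering and lifts -/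

theorem continuous_proj (Γ : Subgroup SL(2, ℝ)) : Continuous (proj Γ) := continuous_quotient_mk'

theorem proj_surjective (Γ : Subgroup SL(2, ℝ)) : Function.Surjective (proj Γ) :=
  Quotient.mk_surjective

theorem proj_smul {Γ : Subgroup SL(2, ℝ)} {g : SL(2, ℝ)} (hg : g ∈ Γ) (z : ℍ) :
    proj Γ (g • z) = proj Γ z := (proj_eq_iff.2 ⟨g, hg, rfl⟩).symm

theorem IsSurfaceGroup.t2Space {Γ : Subgroup SL(2, ℝ)} (hΓ : IsSurfaceGroup Γ) :
    T2Space (Surface Γ) := by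
  have := hΓ.discrete
  exact t2Space_of_properlyDiscontinuousSMul_of_t2Space

/-- The projection is a covering map. As `-1` may lie in `Γ`, the group of deck transformations is
the image of `Γ` in the group of permutations of `ℍ`. -/
theorem IsSurfaceGroup.isCoveringMap_proj {Γ : Subgroup SL(2, ℝ)} (hΓ : IsSurfaceGroup Γ) :
    IsCoveringMap (proj Γ) := by
  have := hΓ.discrete
  let G := (MulAction.toPermHom Γ ℍ).range
  have hG : ∀ k : G, ∃ g : Γ, ∀ z : ℍ, k • z = g • z := by
    rintro ⟨_, g, rfl⟩
    exact ⟨g, fun z => rfl⟩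
  have : ContinuousConstSMul G ℍ := ⟨fun k => by
    obtain ⟨g, hg⟩ := hG k
    simp_rw [hg]
    exact continuous_const_smul g⟩
  have : ProperlyDiscontinuousSMul G ℍ := ⟨by
    intro K L hK hL
    have hf := ProperlyDiscontinuousSMul.finite_disjoint_inter_image (Γ := Γ) hK hL
    refine (hf.image (MulAction.toPermHom Γ ℍ).rangeRestrict).subset ?_
    rintro ⟨_, g, rfl⟩ hk
    exact ⟨g, hk, rfl⟩⟩
  have hfix : ∀ (k : G) (z : ℍ), k • z = z → k = 1 := by
    rintro ⟨_, g, rfl⟩ z hz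
    apply Subtype.ext
    apply Equiv.ext
    intro w
    rcases hΓ.free g.1 g.2 z hz with h | h
    · change g.1 • w = w
      rw [h, one_smul]
    · change g.1 • w = w
      rw [h, neg_smul', one_smul]
  have : IsCancelSMul G ℍ := isCancelSMul_iff_eq_one_of_smul_eq.2 hfix
  have hq : Topology.IsQuotientMap (proj Γ) := isQuotientMap_quotient_mk'
  refine (hq.isQuotientCoveringMap_of_properlyDiscontinuousSMul (G := G) ?_).isCoveringMap
  intro z w
  rw [eq_comm, proj_eq_iff]
  constructor
  · rintro ⟨g, hg, rfl⟩
    exact ⟨⟨_, ⟨g, hg⟩, rfl⟩, rfl⟩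
  · rintro ⟨⟨_, g, rfl⟩, rfl⟩
    exact ⟨g.1, g.2, rfl⟩

theorem IsSurfaceGroup.eq_of_lifts {Γ : Subgroup SL(2, ℝ)} (hΓ : IsSurfaceGroup Γ) {X : Type*}
    [TopologicalSpace X] [PreconnectedSpace X] {u v : X → ℍ} (hu : Continuous u)
    (hv : Continuous v) (h : ∀ x, proj Γ (u x) = proj Γ (v x)) {x₀ : X} (h₀ : u x₀ = v x₀) :
    u = v :=
  hΓ.isCoveringMap_proj.eq_of_comp_eq hu hv (funext h) x₀ h₀

theorem IsSurfaceGroup.exists_smul_eq_of_lifts {Γ : Subgroup SL(2, ℝ)} (hΓ : IsSurfaceGroup Γ)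
    {X : Type*} [TopologicalSpace X] [ConnectedSpace X] {u v : X → ℍ} (hu : Continuous u)
    (hv : Continuous v) (h : ∀ x, proj Γ (u x) = proj Γ (v x)) : ∃ g ∈ Γ, ∀ x, v x = g • u x := by
  obtain ⟨x₀⟩ : Nonempty X := inferInstance
  obtain ⟨g, hg, e⟩ := proj_eq_iff.1 (h x₀)
  refine ⟨g, hg, fun x => ?_⟩
  refine congrFun (hΓ.eq_of_lifts hv (hu.const_smul g) (fun x => ?_) (x₀ := x₀) e.symm) x
  exact ((proj_smul hg _).trans (h x)).symm

theorem IsSurfaceGroup.exists_path_lift {Γ : Subgroup SL(2, ℝ)} (hΓ : IsSurfaceGroup Γ)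
    {f : I → Surface Γ} (hf : Continuous f) {z : ℍ} (h : proj Γ z = f 0) :
    ∃ F : C(I, ℍ), F 0 = z ∧ ∀ x, proj Γ (F x) = f x := by
  obtain ⟨F, h1, h2⟩ := hΓ.isCoveringMap_proj.exists_path_lifts ⟨f, hf⟩ z h.symm
  exact ⟨F, h2, fun x => congrFun h1 x⟩

/-- Freely homotopic loops have lifts with the same deck transformation. -/
theorem FreelyHomotopic.exists_lift {Γ : Subgroup SL(2, ℝ)} (hΓ : IsSurfaceGroup Γ)
    {u v : I → Surface Γ} (h : FreelyHomotopic u v) {F : C(I, ℍ)} {g : SL(2, ℝ)} (hg : g ∈ Γ)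
    (hF : ∀ t, proj Γ (F t) = u t) (hF1 : F 1 = g • F 0) :
    ∃ F' : C(I, ℍ), (∀ t, proj Γ (F' t) = v t) ∧ F' 1 = g • F' 0 := by
  obtain ⟨H, h0, h1, h2⟩ := h
  have cov := hΓ.isCoveringMap_proj
  have e0 : ∀ a, H (0, a) = (proj Γ) (F a) := fun a => by rw [h0, hF]
  set K := cov.liftHomotopy H F e0 with hK
  have lift : ∀ x, proj Γ (K x) = H x := fun x => congrFun (cov.liftHomotopy_lifts H F e0) x
  have z : ∀ a, K (0, a) = F a := fun a => cov.liftHomotopy_zero H F e0 a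
  refine ⟨⟨fun t => K (1, t), by fun_prop⟩, fun t => ?_, ?_⟩
  · simp only [ContinuousMap.coe_mk]; rw [lift, h1]
  · have : (fun s : I => K (s, 1)) = fun s => g • K (s, 0) := by
      refine hΓ.eq_of_lifts (by fun_prop) ?_ (fun s => ?_) (x₀ := 0) ?_
      · exact Continuous.const_smul (by fun_prop) g
      · rw [proj_smul hg, lift, lift, h2]
      · rw [z, z, hF1]
    exact congrFun this 1

theorem FreelyHomotopic.map {X Y : Type*} [TopologicalSpace X] [TopologicalSpace Y] {u v : I → X}
    (h : FreelyHomotopic u v) {f : X → Y} (hf : Continuous f) :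
    FreelyHomotopic (f ∘ u) (f ∘ v) := by
  obtain ⟨H, h0, h1, h2⟩ := h
  refine ⟨⟨fun p => f (H p), by fun_prop⟩, fun t => ?_, fun t => ?_, fun s => ?_⟩
  · simp [h0]
  · simp [h1]
  · simp [h2 s]

/-! ### Isometric embeddings of the line -/

/-- The rotation about `i` with half angle `θ`. -/
def rot (θ : ℝ) : SL(2, ℝ) :=
  sl (Real.cos θ) (Real.sin θ) (-Real.sin θ) (Real.cos θ)
    (by linear_combination Real.sin_sq_add_cos_sq θ)

theorem geo_zero : geo 0 = UpperHalfPlane.I := by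
  apply UpperHalfPlane.ext_re_im
  · simp
  · simp

theorem rot_smul_I (θ : ℝ) : rot θ • UpperHalfPlane.I = UpperHalfPlane.I := by
  have h := Real.sin_sq_add_cos_sq θ
  apply UpperHalfPlane.ext_re_im
  · rw [smul_re]
    simp [rot]
    ring
  · rw [smul_im]
    simp [rot]

theorem exists_rot_re_eq_zero (w : ℍ) : ∃ θ, (rot θ • w).re = 0 := by
  set v : ℂ := ⟨w.re ^ 2 + w.im ^ 2 - 1, 2 * w.re⟩ with hv
  refine ⟨v.arg / 2, ?_⟩
  rw [smul_re, div_eq_zero_iff]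
  left
  have h1 := Complex.norm_mul_cos_arg v
  have h2 := Complex.norm_mul_sin_arg v
  have e : v.arg = 2 * (v.arg / 2) := by ring
  rw [e, Real.cos_two_mul] at h1
  rw [e, Real.sin_two_mul] at h2
  simp only [hv] at h1 h2
  have h := Real.sin_sq_add_cos_sq (v.arg / 2)
  simp only [rot, sl_00, sl_01, sl_10, sl_11]
  set k := Real.cos (v.arg / 2)
  set s := Real.sin (v.arg / 2)
  set r := ‖v‖
  have h3 : w.re ^ 2 + w.im ^ 2 - 1 = r * (k ^ 2 - s ^ 2) := by
    linear_combination -h1 + r * h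
  linear_combination -(k * s) * h3 - (k ^ 2 - s ^ 2) / 2 * h2

/-- A point of the line `geo` is determined within `ℍ` by its distances to `geo 0` and `geo 1`. -/
theorem eq_geo_of_dist_eq {z : ℍ} {t : ℝ} (h0 : dist z (geo 0) = |t|)
    (h1 : dist z (geo 1) = |t - 1|) :
    z = geo t := by
  have c0 := UpperHalfPlane.cosh_dist z (geo 0)
  have c1 := UpperHalfPlane.cosh_dist z (geo 1)
  rw [h0, Real.cosh_abs] at c0
  rw [h1, Real.cosh_abs] at c1
  have hy := z.im_pos
  have d : ∀ u : ℝ, dist (z : ℂ) (geo u) ^ 2 = z.re ^ 2 + (z.im - Real.exp u) ^ 2 := fun u => by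
    rw [Complex.dist_eq, Complex.sq_norm, Complex.normSq_apply]
    simp
    ring
  rw [d, geo_im, Real.exp_zero] at c0
  rw [d, geo_im] at c1
  have he := Real.exp_pos 1
  have et := Real.exp_pos t
  have he1 : 1 < Real.exp 1 := by simp
  have hne : Real.exp 1 ^ 2 - 1 ≠ 0 := by nlinarith
  rw [Real.cosh_eq, Real.exp_neg] at c0
  rw [Real.cosh_eq, Real.exp_neg, Real.exp_sub] at c1
  set e := Real.exp 1
  set T := Real.exp t with hT
  set x := z.re
  set y := z.im
  have k0 : T * (x ^ 2 + y ^ 2 + 1) = y * (T ^ 2 + 1) := by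
    field_simp at c0; linear_combination -c0
  have k1 : T * (x ^ 2 + y ^ 2 + e ^ 2) = y * (T ^ 2 + e ^ 2) := by
    field_simp at c1; linear_combination -c1
  have hyT : y = T := by
    apply mul_left_cancel₀ hne
    linear_combination k0 - k1
  have hx : x = 0 := by
    rw [hyT] at k0
    have : T * x ^ 2 = 0 := by linear_combination k0
    simpa [et.ne'] using this
  exact UpperHalfPlane.ext_re_im hx hyT

/-- Every isometric embedding of the line into `ℍ` is a translate of the standard one. -/
theorem exists_smul_geo {f : ℝ → ℍ} (hf : Isometry f) : ∃ M : SL(2, ℝ), ∀ t, f t = M • geo t := by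
  suffices h : ∃ N : SL(2, ℝ), N • f 0 = geo 0 ∧ N • f 1 = geo 1 by
    obtain ⟨N, h0, h1⟩ := h
    refine ⟨N⁻¹, fun t => ?_⟩
    rw [eq_inv_smul_iff]
    apply eq_geo_of_dist_eq
    · rw [← h0, dist_smul, hf.dist_eq, Real.dist_eq, sub_zero]
    · rw [← h1, dist_smul, hf.dist_eq, Real.dist_eq]
  set w := (f 0).toSL2R⁻¹ • f 1
  obtain ⟨θ, hθ⟩ := exists_rot_re_eq_zero w
  have h0 : (f 0).toSL2R⁻¹ • f 0 = UpperHalfPlane.I := by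
    rw [inv_smul_eq_iff, UpperHalfPlane.toSL2R_smul_I]
  have hd : dist (rot θ • w) (geo 0) = 1 := by
    rw [geo_zero, ← rot_smul_I θ, dist_smul, ← h0, dist_smul, hf.dist_eq, Real.dist_eq]
    norm_num
  rw [UpperHalfPlane.dist_of_re_eq (by rw [hθ, geo_re]), geo_im, Real.log_exp, Real.dist_eq,
    sub_zero, abs_eq zero_le_one] at hd
  have him : ∀ s, Real.log (rot θ • w).im = s → rot θ • w = geo s := fun s h =>
    UpperHalfPlane.ext_re_im hθ (by rw [geo_im, ← h, Real.exp_log (rot θ • w).im_pos])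
  rcases hd with h | h
  · refine ⟨rot θ * (f 0).toSL2R⁻¹, ?_, ?_⟩
    · rw [mul_smul, h0, rot_smul_I, geo_zero]
    · rw [mul_smul, him _ h]
  · refine ⟨rot (Real.pi / 2) * (rot θ * (f 0).toSL2R⁻¹), ?_, ?_⟩
    · rw [mul_smul, mul_smul, h0, rot_smul_I, rot_smul_I, geo_zero]
    · rw [mul_smul, mul_smul, him _ h]
      apply UpperHalfPlane.ext_re_im
      · rw [smul_re]; simp [rot]
      · rw [smul_im]
        simp [rot]
        rw [Real.exp_neg]
        have := Real.exp_pos 1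
        field_simp

theorem IsClosedGeodesic.exists_frame {Γ : Subgroup SL(2, ℝ)} (hΓ : IsSurfaceGroup Γ)
    {c : ℝ → Surface Γ} {l : ℝ} (hc : IsClosedGeodesic Γ c l) (s : ℝ) :
    ∃ M : SL(2, ℝ), (∀ r, c (s + r) = proj Γ (M • geo r)) ∧ D l ∈ conjGroup Γ M := by
  obtain ⟨f, hf, hcf⟩ := hc.geodesic
  obtain ⟨M, hM⟩ := exists_smul_geo hf
  have e : ∀ r, c (s + r) = proj Γ ((M * D s) • geo r) := fun r => by
    rw [hcf, hM, mul_smul, D_smul_geo, add_comm]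
  refine ⟨M * D s, e, ?_⟩
  obtain ⟨g, hg, h⟩ := hΓ.exists_smul_eq_of_lifts (X := ℝ) (u := fun r => (M * D s) • geo r)
    (v := fun r => (M * D s) • geo (r + l)) (continuous_geo.const_smul _)
    ((continuous_geo.comp (continuous_id.add continuous_const)).const_smul _) (fun r => by
      rw [← e, ← e, ← add_assoc, hc.periodic])
  have h' : ∀ r, ((M * D s)⁻¹ * g * (M * D s)) • geo r = geo (r + l) := fun r => by
    rw [mul_smul, mul_smul, ← h r, inv_smul_smul]
  rcases eq_D_of_smul_geo h' with h1 | h1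
  · left; rw [← h1]; convert hg using 1; group
  · right
    rw [← neg_eq_iff_eq_neg.2 h1, ← neg_one_mul]
    convert hg using 1
    simp only [neg_mul, one_mul, mul_neg, neg_neg]
    group

/-! ### Axes and the translates of a geodesic -/

theorem mul_pos_of_isPreconnected {X : Type*} [TopologicalSpace X] {S : Set X}
    (hS : IsPreconnected S) {f : X → ℝ} (hf : Continuous f) (h : ∀ x ∈ S, f x ≠ 0) {x y : X}
    (hx : x ∈ S) (hy : y ∈ S) : 0 < f x * f y := by
  have hc := (hS.image f hf.continuousOn).ordConnected
  by_contra hneg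
  have h0 : (0 : ℝ) ∈ f '' S := by
    rcases lt_or_gt_of_ne (h x hx) with h1 | h1
    · have h2 : 0 < f y := by
        rcases lt_or_gt_of_ne (h y hy) with h2 | h2
        · exact absurd (mul_pos_of_neg_of_neg h1 h2) hneg
        · exact h2
      exact hc.out ⟨x, hx, rfl⟩ ⟨y, hy, rfl⟩ ⟨h1.le, h2.le⟩
    · have h2 : f y < 0 := by
        rcases lt_or_gt_of_ne (h y hy) with h2 | h2
        · exact h2
        · exact absurd (mul_pos h1 h2) hneg
      exact hc.out ⟨y, hy, rfl⟩ ⟨x, hx, rfl⟩ ⟨h2.le, h1.le⟩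
  obtain ⟨w, hw, e⟩ := h0
  exact h w hw e

/-- If the axis of `Y` misses all translates under the powers of `X` of a connected set joining `z`
to `X • z`, then no fixed point of `X` lies beyond the axis of `Y`, seen from `z`. -/
theorem nonneg_side_mul_qf {X Y : SL(2, ℝ)} {S : Set ℍ} (hS : IsPreconnected S) {z : ℍ}
    (hz : z ∈ S) (hXz : X • z ∈ S) (H : ∀ n : ℤ, ∀ w ∈ S, side Y (X ^ n • w) ≠ 0)
    (h1 : X ≠ 1) (h2 : X ≠ -1) {u w : ℝ} (huw : u ≠ 0 ∨ w ≠ 0) (hv : qf X u w = 0) :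
    0 ≤ side Y z * qf Y u w := by
  apply qf_nonneg_of_side_nonneg (z := z) huw hv h1 h2
  intro n
  have hT : IsPreconnected (⋃ n : ℤ, (X ^ n • · : ℍ → ℍ) '' S) := by
    refine IsPreconnected.iUnion_of_chain (fun n => ?_) fun n => ?_
    · exact hS.image _ (continuous_const_smul _).continuousOn
    · refine ⟨X ^ (n + 1) • z, ⟨X • z, hXz, ?_⟩, ⟨z, hz, rfl⟩⟩
      change X ^ n • X • z = _
      rw [smul_smul, zpow_add_one]
  refine (mul_pos_of_isPreconnected hT (f := side Y) (continuous_side Y) ?_ ?_ ?_).le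
  · rintro x hx
    obtain ⟨m, y, hy, rfl⟩ := Set.mem_iUnion.1 hx
    exact H m y hy
  · exact Set.mem_iUnion.2 ⟨0, z, hz, by simp⟩
  · exact Set.mem_iUnion.2 ⟨n, z, hz, rfl⟩

theorem side_D (l : ℝ) (z : ℍ) :
    side (D l) z = (Real.exp (-(l / 2)) - Real.exp (l / 2)) * z.re / z.im := by
  simp only [side, D, sl_00, sl_01, sl_10, sl_11]; ring

theorem qf_D (l u w : ℝ) :
    qf (D l) u w = (Real.exp (-(l / 2)) - Real.exp (l / 2)) * (u * w) := by
  simp only [qf, D, sl_00, sl_01, sl_10, sl_11]; ring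

theorem exp_neg_sub_exp_neg {l : ℝ} (hl : 0 < l) :
    Real.exp (-(l / 2)) - Real.exp (l / 2) < 0 := by
  have : Real.exp (-(l / 2)) < Real.exp (l / 2) := Real.exp_lt_exp.2 (by linarith)
  linarith

theorem eq_geo_of_re {z : ℍ} (h : z.re = 0) : z = geo (Real.log z.im) :=
  UpperHalfPlane.ext_re_im h (by rw [geo_im, Real.exp_log z.im_pos])

/-- A matrix with off-diagonal entries of the same sign has two eigenvectors on different sides of
the coordinate axes. -/
theorem exists_eigenvectors_of_pos {X : SL(2, ℝ)} (h : 0 < X 0 1 * X 1 0) {a : ℝ} (ha : a ≠ 0) :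
    ∃ u w, (u ≠ 0 ∨ w ≠ 0) ∧ qf X u w = 0 ∧ a * (u * w) < 0 := by
  set e := X 1 1 - X 0 0 with he
  set R := √(e ^ 2 + 4 * (X 0 1 * X 1 0)) with hR
  have hR2 : R ^ 2 = e ^ 2 + 4 * (X 0 1 * X 1 0) := Real.sq_sqrt (by positivity)
  have hRe : |e| < R := by
    rw [hR]; apply Real.lt_sqrt_of_sq_lt; rw [sq_abs]; linarith
  have hc : X 1 0 ≠ 0 := by rintro h0; rw [h0] at h; simp at h
  have hq : ∀ r : ℝ, r ^ 2 = R ^ 2 → qf X (-e + r) (2 * X 1 0) = 0 := by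
    intro r hr
    simp only [qf]
    rw [← he]
    linear_combination X 1 0 * (hr + hR2)
  have hlt := abs_lt.1 hRe
  by_cases hs : 0 < a * X 1 0
  · refine ⟨-e + -R, 2 * X 1 0, Or.inr (by simpa using hc), hq (-R) (by ring), ?_⟩
    nlinarith
  · have hs' : a * X 1 0 < 0 := lt_of_le_of_ne (not_lt.1 hs) (mul_ne_zero ha hc)
    refine ⟨-e + R, 2 * X 1 0, Or.inr (by simpa using hc), hq R rfl, ?_⟩
    nlinarith

theorem mul_vec_ne_zero (g : SL(2, ℝ)) {u w : ℝ} (h : u ≠ 0 ∨ w ≠ 0) :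
    g 0 0 * u + g 0 1 * w ≠ 0 ∨ g 1 0 * u + g 1 1 * w ≠ 0 := by
  by_contra hcon
  push Not at hcon
  obtain ⟨h1, h2⟩ := hcon
  have hd := det_entries g
  have e1 : u = 0 := by linear_combination g 1 1 * h1 - g 0 1 * h2 - u * hd
  have e2 : w = 0 := by linear_combination g 0 0 * h2 - g 1 0 * h1 - w * hd
  rcases h with h | h
  · exact h e1
  · exact h e2

theorem false_of_eq_int_mul {x l : ℝ} {n : ℤ} (h0 : 0 < x) (h1 : x < l) (h : x = n * l) :
    False := by
  have hl : 0 < l := h0.trans h1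
  have n0 : (0 : ℝ) < n := by
    by_contra hn
    push Not at hn
    nlinarith
  have n1 : (n : ℝ) < 1 := by
    by_contra hn
    push Not at hn
    nlinarith
  have n0' : 0 < n := by exact_mod_cast n0
  have n1' : n < 1 := by exact_mod_cast n1
  omega

/-! ### A geodesic with one double point -/

/-- The standard geodesic `geo` projects to a closed geodesic of length `l` in `ℍ/Γ` with exactly
one double point, at the parameters `0` and `d`; the element `A` of `Γ` maps `geo 0` to `geo d`. -/
structure IsFigureEight (Γ : Subgroup SL(2, ℝ)) (l d : ℝ) (A : SL(2, ℝ)) : Prop where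
  surface : IsSurfaceGroup Γ
  neg_one_mem : -1 ∈ Γ
  d_pos : 0 < d
  d_lt : d < l
  D_mem : D l ∈ Γ
  A_mem : A ∈ Γ
  A_smul : A • geo 0 = geo d
  unique : ∀ g ∈ Γ, ∀ r r', g • geo r = geo r' → (∃ n : ℤ, r' = r + n * l) ∨
    ((∃ n : ℤ, r = n * l) ∧ ∃ n : ℤ, r' = d + n * l) ∨
    ((∃ n : ℤ, r = d + n * l) ∧ ∃ n : ℤ, r' = n * l)

namespace IsFigureEight

variable {Γ : Subgroup SL(2, ℝ)} {l d : ℝ} {A : SL(2, ℝ)}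

theorem neg_mem (F : IsFigureEight Γ l d A) {g : SL(2, ℝ)} (h : g ∈ Γ) : -g ∈ Γ := by
  simpa using mul_mem F.neg_one_mem h

theorem eq_int_mul (F : IsFigureEight Γ l d A) {δ : ℝ} (h : D δ ∈ Γ) : ∃ n : ℤ, δ = n * l := by
  have h0 := F.d_pos
  have h1 := F.d_lt
  rcases F.unique _ h (d / 2) _ (D_smul_geo _ _) with ⟨n, hn⟩ | ⟨⟨n, hn⟩, -⟩ | ⟨⟨n, hn⟩, -⟩
  · exact ⟨n, by linarith⟩
  · exact (false_of_eq_int_mul (by linarith) (by linarith) hn).elim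
  · refine (false_of_eq_int_mul (n := -n) (x := d / 2) (l := l) (by linarith) (by linarith) ?_).elim
    push_cast
    linarith

/-- The axis of `X` misses all translates of the geodesic if it misses those that meet a connected
set `S` which contains `z` and `X • z`: an axis missing `S` crosses a translate only if that
translate separates the fixed points of `X`, and hence `S`, or if it is the axis. -/
theorem side_ne_zero (F : IsFigureEight Γ l d A) {X : SL(2, ℝ)} (hX : X ∈ Γ) (h1 : X ≠ 1)
    (h2 : X ≠ -1) (htr : |tr X| < 2 * Real.cosh (l / 2)) {S : Set ℍ} (hS : IsPreconnected S)
    {z : ℍ} (hz : z ∈ S) (hXz : X • z ∈ S)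
    (H : ∀ g ∈ Γ, ∀ t, g • geo t ∈ S → ∀ t', side X (g • geo t') ≠ 0) :
    ∀ g ∈ Γ, ∀ t, side X (g • geo t) ≠ 0 := by
  intro g hg t h0
  have hl : 0 < l := F.d_pos.trans F.d_lt
  have hE := exp_neg_sub_exp_neg hl
  set Y := g * D l * g⁻¹ with hY
  by_cases hm : ∃ n : ℤ, ∃ w ∈ S, side Y (X ^ n • w) = 0
  · obtain ⟨n, w, hw, e⟩ := hm
    have e1 : side (D l) (g⁻¹ • X ^ n • w) = 0 := by
      rw [← e, hY, ← side_smul g (D l) (g⁻¹ • X ^ n • w), smul_inv_smul]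
    have e2 : (g⁻¹ • X ^ n • w).re = 0 := by
      rw [side_D, div_eq_zero_iff] at e1
      rcases e1 with e1 | e1
      · exact (mul_eq_zero.1 e1).resolve_left hE.ne
      · exact absurd e1 (g⁻¹ • X ^ n • w).im_pos.ne'
    have e3 := eq_geo_of_re e2
    rw [inv_smul_eq_iff, ← eq_inv_smul_iff, ← zpow_neg, smul_smul] at e3
    refine H (X ^ (-n) * g) (mul_mem (zpow_mem hX _) hg) _ (e3 ▸ hw) t ?_
    rw [mul_smul, side_zpow_smul, h0]
  · push Not at hm
    have hpos := fun {u w : ℝ} => nonneg_side_mul_qf (u := u) (w := w) hS hz hXz hm h1 h2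
    have ha : side Y z ≠ 0 := by simpa using hm 0 z hz
    rw [← side_conj, side_geo] at h0
    have hXg : g⁻¹ * X * g ∈ Γ := mul_mem (mul_mem (inv_mem hg) hX) hg
    have htr' : |tr (g⁻¹ * X * g)| = |tr X| := by rw [tr_conj']
    by_cases hc : (g⁻¹ * X * g) 1 0 = 0
    · have hb : (g⁻¹ * X * g) 0 1 = 0 := by
        rw [hc] at h0
        have := Real.exp_pos (-t)
        simpa [this.ne'] using h0
      obtain ⟨δ, hδ⟩ := exists_eq_D hb hc
      have hD : D δ ∈ Γ := by
        rcases hδ with h | h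
        · rwa [← h]
        · rw [← neg_eq_iff_eq_neg] at h
          rw [← h]; exact F.neg_mem hXg
      obtain ⟨n, hn⟩ := F.eq_int_mul hD
      have hn0 : n ≠ 0 := by
        rintro rfl
        rw [show δ = 0 by simpa using hn, D_zero] at hδ
        rcases hδ with h | h
        · apply h1
          calc X = g * (g⁻¹ * X * g) * g⁻¹ := by group
            _ = 1 := by rw [h]; simp
        · apply h2
          calc X = g * (g⁻¹ * X * g) * g⁻¹ := by group
            _ = -1 := by rw [h]; simp
      have htr2 : |tr X| = 2 * Real.cosh (δ / 2) := by
        rw [← htr']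
        have := Real.cosh_pos (δ / 2)
        rcases hδ with h | h
        · rw [h, tr_D, abs_of_pos (by positivity)]
        · rw [h, tr_neg, tr_D, abs_neg, abs_of_pos (by positivity)]
      have : Real.cosh (l / 2) ≤ Real.cosh (δ / 2) := by
        rw [Real.cosh_le_cosh, hn, abs_div, abs_div, abs_mul]
        have : (1 : ℝ) ≤ |(n : ℝ)| := by exact_mod_cast Int.one_le_abs hn0
        have := abs_pos.2 hl.ne'
        gcongr
        nlinarith
      linarith
    · have hprod : 0 < (g⁻¹ * X * g) 0 1 * (g⁻¹ * X * g) 1 0 := by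
        have e1 := Real.exp_pos t
        have e2 := Real.exp_pos (-t)
        have e3 : Real.exp t * Real.exp (-t) = 1 := by rw [← Real.exp_add]; simp
        have e4 : (g⁻¹ * X * g) 0 1 = (g⁻¹ * X * g) 1 0 * Real.exp t ^ 2 := by
          linear_combination -Real.exp t * h0 - (g⁻¹ * X * g) 0 1 * e3
        rw [e4]
        have : 0 < (g⁻¹ * X * g) 1 0 ^ 2 := by positivity
        nlinarith [mul_pos this (pow_pos e1 2)]
      obtain ⟨u, w, huw, hq, hneg⟩ := exists_eigenvectors_of_pos hprod (mul_ne_zero ha hE.ne)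
      have := hpos (mul_vec_ne_zero g huw) (by rw [← qf_conj, hq])
      rw [← qf_conj, hY] at this
      rw [show g⁻¹ * (g * D l * g⁻¹) * g = D l by group, qf_D] at this
      linarith

end IsFigureEight

theorem IsSurfaceGroup.smul_eq_smul {Γ : Subgroup SL(2, ℝ)} (hΓ : IsSurfaceGroup Γ)
    {g g' : SL(2, ℝ)} (hg : g ∈ Γ) (hg' : g' ∈ Γ) {z : ℍ} (h : g • z = g' • z) (w : ℍ) :
    g • w = g' • w := by
  have h0 : (g'⁻¹ * g) • z = z := by rw [mul_smul, h, inv_smul_smul]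
  rw [← inv_smul_eq_iff, smul_smul]
  rcases hΓ.free _ (mul_mem (inv_mem hg') hg) z h0 with h1 | h1
  · rw [h1, one_smul]
  · rw [h1, neg_smul', one_smul]

theorem entries_of_smul_geo_zero {g : SL(2, ℝ)} (h : g • geo 0 = geo 0) :
    g 1 1 = g 0 0 ∧ g 1 0 = -g 0 1 := by
  have hd := det_entries g
  have h0 := denom_pos g (geo 0)
  have h1 := congrArg UpperHalfPlane.re h
  have h2 := congrArg UpperHalfPlane.im h
  rw [smul_re, div_eq_iff h0.ne'] at h1
  rw [smul_im, div_eq_iff h0.ne'] at h2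
  simp only [geo_re, geo_im, Real.exp_zero] at h1 h2
  constructor
  · linear_combination -g 1 1 * hd - g 1 0 * h1 - g 0 0 * h2
  · linear_combination -g 1 0 * hd + g 1 1 * h1 + g 0 1 * h2

theorem int_eq_zero_of_abs_lt {l : ℝ} {n : ℤ} (h1 : -l < n * l) (h2 : n * l < l) : n = 0 := by
  have hl : 0 < l := by linarith
  have a : (-1 : ℝ) < n := by
    by_contra hn
    push Not at hn
    nlinarith
  have b : (n : ℝ) < 1 := by
    by_contra hn
    push Not at hn
    nlinarith
  have a' : -1 < n := by exact_mod_cast a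
  have b' : n < 1 := by exact_mod_cast b
  omega

namespace IsFigureEight

variable {Γ : Subgroup SL(2, ℝ)} {l d : ℝ} {A : SL(2, ℝ)}

theorem neg (F : IsFigureEight Γ l d A) : IsFigureEight Γ l d (-A) :=
  { F with
    A_mem := F.neg_mem F.A_mem
    A_smul := by rw [neg_smul', F.A_smul] }

/-- The entries of `A` and of `(D l)⁻¹ * A`. The first is a rotation followed by a translation by
`d`, the second the same rotation followed by a translation by `d - l`. -/
theorem exists_entries (F : IsFigureEight Γ l d A) : ∃ k s p q : ℝ, 1 < p ∧ 1 < q ∧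
    k ^ 2 + s ^ 2 = 1 ∧ 2 * Real.cosh (l / 2) = p * q + p⁻¹ * q⁻¹ ∧
    (A 0 0 = p * k ∧ A 0 1 = p * s ∧ A 1 0 = -(p⁻¹ * s) ∧ A 1 1 = p⁻¹ * k) ∧
    (((D l)⁻¹ * A) 0 0 = q⁻¹ * k ∧ ((D l)⁻¹ * A) 0 1 = q⁻¹ * s ∧
      ((D l)⁻¹ * A) 1 0 = -(q * s) ∧ ((D l)⁻¹ * A) 1 1 = q * k) := by
  set R := D (-d) * A with hR
  have hfix : R • geo 0 = geo 0 := by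
    rw [hR, mul_smul, F.A_smul, D_smul_geo, add_neg_cancel]
  obtain ⟨e1, e2⟩ := entries_of_smul_geo_zero hfix
  have hdet := det_entries R
  rw [e1, e2] at hdet
  have hA : A = D d * R := by rw [hR, ← mul_assoc, ← D_add, add_neg_cancel, D_zero, one_mul]
  have hE : (D l)⁻¹ * A = D (d - l) * R := by
    rw [hA, ← mul_assoc, ← D_neg, ← D_add]; congr 2; ring
  have h0 := F.d_pos
  have h1 := F.d_lt
  have i1 : (Real.exp (d / 2))⁻¹ = Real.exp (-(d / 2)) := (Real.exp_neg _).symm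
  have i2 : (Real.exp ((l - d) / 2))⁻¹ = Real.exp (-((l - d) / 2)) := (Real.exp_neg _).symm
  have i3 : Real.exp ((d - l) / 2) = Real.exp (-((l - d) / 2)) := by congr 1; ring
  have i4 : Real.exp (-((d - l) / 2)) = Real.exp ((l - d) / 2) := by congr 1; ring
  refine ⟨R 0 0, R 0 1, Real.exp (d / 2), Real.exp ((l - d) / 2), by simpa using h0,
    by simpa using h1, by linarith, ?_, ?_, ?_⟩
  · rw [i1, i2, ← Real.exp_add, ← Real.exp_add, Real.cosh_eq]
    ring_nf
  · rw [hA, i1]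
    refine ⟨?_, ?_, ?_, ?_⟩ <;> simp only [mul_entry, D, sl_00, sl_01, sl_10, sl_11, e1, e2] <;>
      ring
  · rw [hE, i2]
    refine ⟨?_, ?_, ?_, ?_⟩ <;>
      simp only [mul_entry, D, sl_00, sl_01, sl_10, sl_11, e1, e2, i3, i4] <;> ring

/-- The translates of the geodesic that meet it. -/
theorem translate_cases (F : IsFigureEight Γ l d A) {g : SL(2, ℝ)} (hg : g ∈ Γ) {t r : ℝ}
    (h : g • geo t = geo r) :
    (∀ t', ∃ t'', g • geo t' = geo t'') ∨
    (∃ n : ℤ, r = n * l ∧ ∀ t', ∃ t'', g • geo t' = D (n * l) • A⁻¹ • geo t'') ∨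
    (∃ n : ℤ, r = d + n * l ∧ ∀ t', ∃ t'', g • geo t' = D (n * l) • A • geo t'') := by
  have hD : ∀ n : ℤ, D (n * l) ∈ Γ := fun n => by rw [← D_zpow]; exact zpow_mem F.D_mem n
  have hA := F.A_mem
  rcases F.unique g hg t r h with ⟨n, hn⟩ | ⟨⟨n, hn⟩, m, hm⟩ | ⟨⟨n, hn⟩, m, hm⟩
  · left
    intro t'
    refine ⟨t' + n * l, ?_⟩
    rw [← D_smul_geo]
    apply F.surface.smul_eq_smul hg (hD n) (z := geo t)
    rw [h, D_smul_geo, hn]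
  · right; right
    refine ⟨m, hm, fun t' => ⟨t' + -(n * l), ?_⟩⟩
    have hn' : D (-(n * l)) ∈ Γ := by rw [D_neg]; exact inv_mem (hD n)
    rw [← D_smul_geo, smul_smul, smul_smul]
    apply F.surface.smul_eq_smul hg (mul_mem (mul_mem (hD m) hA) hn') (z := geo t)
    rw [h, mul_smul, mul_smul, D_smul_geo, hn, add_neg_cancel, F.A_smul, D_smul_geo, hm]
  · right; left
    refine ⟨m, hm, fun t' => ⟨t' + -(n * l), ?_⟩⟩
    have hn' : D (-(n * l)) ∈ Γ := by rw [D_neg]; exact inv_mem (hD n)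
    rw [← D_smul_geo, smul_smul, smul_smul]
    apply F.surface.smul_eq_smul hg (mul_mem (mul_mem (hD m) (inv_mem hA)) hn') (z := geo t)
    rw [h, mul_smul, mul_smul, D_smul_geo, hn, add_neg_cancel_right, ← F.A_smul, inv_smul_smul,
      D_smul_geo, hm, zero_add]

theorem side_geo_ne_zero {X : SL(2, ℝ)} (h : X 0 1 * X 1 0 < 0) (t : ℝ) : side X (geo t) ≠ 0 := by
  rw [side_geo]
  have e1 := Real.exp_pos t
  have e2 := Real.exp_pos (-t)
  intro h0
  have h1 : X 1 0 ^ 2 * Real.exp t = X 0 1 * X 1 0 * Real.exp (-t) := by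
    linear_combination X 1 0 * h0
  have h2 : X 0 1 * X 1 0 * Real.exp (-t) < 0 := mul_neg_of_neg_of_pos h e2
  have h3 : 0 ≤ X 1 0 ^ 2 * Real.exp t := by positivity
  linarith

theorem E_smul (F : IsFigureEight Γ l d A) : ((D l)⁻¹ * A) • geo 0 = geo (d - l) := by
  rw [mul_smul, F.A_smul, ← D_neg, D_smul_geo]; rfl

theorem ne_one_of_side {X : SL(2, ℝ)} {z : ℍ} (h : side X z ≠ 0) : X ≠ 1 ∧ X ≠ -1 := by
  have h1 : side 1 z = 0 := by simp [side]
  constructor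
  · rintro rfl; exact h h1
  · rintro rfl; rw [side_neg, h1] at h; simp at h

/-- The three simple elements determined by the double point: their axes miss all translates of
the geodesic. -/
theorem simple_axes (F : IsFigureEight Γ l d A) :
    (∀ g ∈ Γ, ∀ t, side A (g • geo t) ≠ 0) ∧
    (∀ g ∈ Γ, ∀ t, side ((D l)⁻¹ * A) (g • geo t) ≠ 0) ∧
    (∀ g ∈ Γ, ∀ t, side (A * ((D l)⁻¹ * A)) (g • geo t) ≠ 0) ∧
    0 < side A (geo 0) * side ((D l)⁻¹ * A) (geo 0) := by
  obtain ⟨k, s, p, q, hp, hq, hks, hl, ⟨a00, a01, a10, a11⟩, b00, b01, b10, b11⟩ :=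
    F.exists_entries
  set E := (D l)⁻¹ * A with hE
  have hd0 := F.d_pos
  have hdl := F.d_lt
  have hA := F.A_mem
  have hEm : E ∈ Γ := mul_mem (inv_mem F.D_mem) hA
  have p0 : 0 < p := by linarith
  have q0 : 0 < q := by linarith
  have p1 : 0 < p⁻¹ := by positivity
  have q1 : 0 < q⁻¹ := by positivity
  have pp : p * p⁻¹ = 1 := mul_inv_cancel₀ p0.ne'
  have qq : q * q⁻¹ = 1 := mul_inv_cancel₀ q0.ne'
  have p2 : p⁻¹ < 1 := inv_lt_one_of_one_lt₀ hp
  have q2 : q⁻¹ < 1 := inv_lt_one_of_one_lt₀ hq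
  -- the rotation is neither by a half turn nor trivial
  have hk : k ≠ 0 := by
    rintro rfl
    have := F.surface.two_le_abs_tr hA
    rw [tr, a00, a11] at this
    norm_num at this
  have hs : s ≠ 0 := by
    rintro rfl
    obtain ⟨δ, hδ⟩ := exists_eq_D (X := A) (by rw [a01, mul_zero]) (by rw [a10]; simp)
    have hAg : A • geo 0 = geo (0 + δ) := by
      rcases hδ with h | h
      · rw [h, D_smul_geo]
      · rw [h, neg_smul', D_smul_geo]
    rw [F.A_smul] at hAg
    have hdδ : d = δ := by
      have := congrArg UpperHalfPlane.im hAg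
      rw [geo_im, geo_im, Real.exp_eq_exp] at this
      linarith
    have hD : D δ ∈ Γ := by
      rcases hδ with h | h
      · rwa [← h]
      · rw [← neg_eq_iff_eq_neg] at h
        rw [← h]; exact F.neg_mem hA
    obtain ⟨n, hn⟩ := F.eq_int_mul hD
    exact false_of_eq_int_mul hd0 hdl (hdδ.trans hn)
  have hs2 : 0 < s ^ 2 := by positivity
  have hk2 : 0 < k ^ 2 := by positivity
  have hk1 : k ^ 2 < 1 := by linarith
  have hka : |k| < 1 := by rw [← sq_lt_one_iff_abs_lt_one]; exact hk1
  have hpq : p + p⁻¹ < p * q + p⁻¹ * q⁻¹ := by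
    have h1 : p⁻¹ * q⁻¹ < p := (mul_lt_one_of_nonneg_of_lt_one_left p1.le p2 q2.le).trans hp
    have h2 := mul_pos (sub_pos.2 hq) (sub_pos.2 h1)
    linear_combination h2 - p⁻¹ * qq
  have hqp : q + q⁻¹ < p * q + p⁻¹ * q⁻¹ := by
    have h1 : p⁻¹ * q⁻¹ < q := (mul_lt_one_of_nonneg_of_lt_one_left p1.le p2 q2.le).trans hq
    have h2 := mul_pos (sub_pos.2 hp) (sub_pos.2 h1)
    linear_combination h2 - q⁻¹ * pp
  -- the traces
  have tA : |tr A| < 2 * Real.cosh (l / 2) := by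
    rw [tr, a00, a11, ← add_mul, abs_mul, abs_of_pos (by positivity : 0 < p + p⁻¹), hl]
    have := mul_lt_mul_of_pos_left hka (by positivity : 0 < p + p⁻¹)
    linarith
  have tE : |tr E| < 2 * Real.cosh (l / 2) := by
    rw [tr, b00, b11, ← add_mul, abs_mul, abs_of_pos (by positivity : 0 < q⁻¹ + q), hl]
    have := mul_lt_mul_of_pos_left hka (by positivity : 0 < q⁻¹ + q)
    linarith
  have th : |tr (A * E)| < 2 * Real.cosh (l / 2) := by
    rw [hl]
    have e : tr (A * E) = k ^ 2 * (p * q⁻¹ + p⁻¹ * q) - s ^ 2 * (p * q + p⁻¹ * q⁻¹) := by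
      simp only [tr, mul_entry, a00, a01, a10, a11, b00, b01, b10, b11]; ring
    have h1 : p * q⁻¹ + p⁻¹ * q < p * q + p⁻¹ * q⁻¹ := by
      have : 0 < (p - p⁻¹) * (q - q⁻¹) := by apply mul_pos <;> linarith
      linarith
    have h2 : 0 < p * q⁻¹ + p⁻¹ * q := by positivity
    have h3 : 0 < p * q + p⁻¹ * q⁻¹ := by positivity
    have e' : tr (A * E) = k ^ 2 * (p * q⁻¹ + p⁻¹ * q + (p * q + p⁻¹ * q⁻¹)) -
        (p * q + p⁻¹ * q⁻¹) := by
      rw [e]; linear_combination -(p * q + p⁻¹ * q⁻¹) * hks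
    have h4 := mul_pos hk2 (add_pos h2 h3)
    have h5 := mul_lt_mul_of_pos_right hk1 (add_pos h2 h3)
    rw [e', abs_lt]
    constructor <;> linarith
  -- none of the axes meets the geodesic
  have sA := side_geo_ne_zero (X := A) (by
    rw [a01, a10, show p * s * -(p⁻¹ * s) = -(p * p⁻¹ * s ^ 2) by ring, pp]; linarith)
  have sE := side_geo_ne_zero (X := E) (by
    rw [b01, b10, show q⁻¹ * s * -(q * s) = -(q * q⁻¹ * s ^ 2) by ring, qq]; linarith)
  have sh := side_geo_ne_zero (X := A * E) (by
    have e1 : (A * E) 0 1 = p * (k * s * (q + q⁻¹)) := by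
      simp only [mul_entry, a00, a01, b01, b11]; ring
    have e2 : (A * E) 1 0 = -(p⁻¹ * (k * s * (q + q⁻¹))) := by
      simp only [mul_entry, a10, a11, b00, b10]; ring
    rw [e1, e2, show p * (k * s * (q + q⁻¹)) * -(p⁻¹ * (k * s * (q + q⁻¹))) =
      -(p * p⁻¹ * (k * s * (q + q⁻¹)) ^ 2) by ring, pp]
    have : 0 < (k * s * (q + q⁻¹)) ^ 2 := by positivity
    linarith)
  have shA : ∀ t, side (A * E) (A • geo t) ≠ 0 := by
    intro t
    rw [← side_conj, show A⁻¹ * (A * E) * A = E * A by group]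
    apply side_geo_ne_zero
    have e1 : (E * A) 0 1 = q⁻¹ * (k * s * (p + p⁻¹)) := by
      simp only [mul_entry, b00, b01, a01, a11]; ring
    have e2 : (E * A) 1 0 = -(q * (k * s * (p + p⁻¹))) := by
      simp only [mul_entry, b10, b11, a00, a10]; ring
    rw [e1, e2, show q⁻¹ * (k * s * (p + p⁻¹)) * -(q * (k * s * (p + p⁻¹))) =
      -(q * q⁻¹ * (k * s * (p + p⁻¹)) ^ 2) by ring, qq]
    have : 0 < (k * s * (p + p⁻¹)) ^ 2 := by positivity
    linarith
  -- invariance of `side X` under `X`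
  have inv1 : ∀ (X : SL(2, ℝ)) (z : ℍ), side X (X • z) = side X z := fun X z => by
    simpa using side_zpow_smul X 1 z
  have inv2 : ∀ (X : SL(2, ℝ)) (z : ℍ), side X (X⁻¹ • z) = side X z := fun X z => by
    simpa using side_zpow_smul X (-1) z
  have AE : ∀ t, A⁻¹ • geo t = E⁻¹ • geo (t + -l) := fun t => by
    rw [← D_smul_geo, smul_smul, hE]; congr 1; rw [D_neg]; group
  have shA' : ∀ t, side (A * E) (A⁻¹ • geo t) ≠ 0 := by
    intro t
    rw [AE, ← inv1, mul_smul, smul_inv_smul]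
    exact shA _
  -- the lines through the two arcs of the geodesic
  have lines1 : ∀ g ∈ Γ, ∀ t, g • geo t ∈ geo '' Set.Icc 0 d →
      (∀ t', ∃ t'', g • geo t' = geo t'') ∨ (∀ t', ∃ t'', g • geo t' = A⁻¹ • geo t'') ∨
      (∀ t', ∃ t'', g • geo t' = A • geo t'') := by
    rintro g hg t ⟨r, ⟨hr0, hrd⟩, hr⟩
    rcases F.translate_cases hg hr.symm with h | ⟨n, hn, h⟩ | ⟨n, hn, h⟩
    · exact Or.inl h
    · have n0 : n = 0 := int_eq_zero_of_abs_lt (l := l) (by linarith) (by linarith)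
      right; left; simpa [n0, D_zero] using h
    · have n0 : n = 0 := int_eq_zero_of_abs_lt (l := l) (by linarith) (by linarith)
      right; right; simpa [n0, D_zero] using h
  have lines2 : ∀ g ∈ Γ, ∀ t, g • geo t ∈ geo '' Set.Icc (d - l) 0 →
      (∀ t', ∃ t'', g • geo t' = geo t'') ∨ (∀ t', ∃ t'', g • geo t' = A⁻¹ • geo t'') ∨
      (∀ t', ∃ t'', g • geo t' = E • geo t'') := by
    rintro g hg t ⟨r, ⟨hr0, hrd⟩, hr⟩
    rcases F.translate_cases hg hr.symm with h | ⟨n, hn, h⟩ | ⟨n, hn, h⟩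
    · exact Or.inl h
    · have n0 : n = 0 := int_eq_zero_of_abs_lt (l := l) (by linarith) (by linarith)
      right; left; simpa [n0, D_zero] using h
    · have n0 : n + 1 = 0 := int_eq_zero_of_abs_lt (l := l) (by push_cast; linarith)
        (by push_cast; linarith)
      have n1 : n = -1 := by omega
      right; right
      simpa [n1, D_neg, hE, mul_smul] using h
  have conn : ∀ a b : ℝ, IsPreconnected (geo '' Set.Icc a b) := fun a b =>
    isPreconnected_Icc.image _ continuous_geo.continuousOn
  have hEgeo : E • geo 0 = geo (d - l) := F.E_smul
  have hA1 := ne_one_of_side (sA 0)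
  have hE1 := ne_one_of_side (sE 0)
  have hh1 := ne_one_of_side (sh 0)
  refine ⟨?_, ?_, ?_, ?_⟩
  · refine F.side_ne_zero hA hA1.1 hA1.2 tA (conn 0 d) (z := geo 0)
      ⟨0, ⟨le_rfl, hd0.le⟩, rfl⟩ ⟨d, ⟨hd0.le, le_rfl⟩, F.A_smul.symm⟩ ?_
    intro g hg t ht t'
    rcases lines1 g hg t ht with h | h | h <;> obtain ⟨t'', e⟩ := h t' <;> rw [e]
    · exact sA _
    · rw [inv2]; exact sA _
    · rw [inv1]; exact sA _
  · refine F.side_ne_zero hEm hE1.1 hE1.2 tE (conn (d - l) 0) (z := geo 0)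
      ⟨0, ⟨by linarith, le_rfl⟩, rfl⟩ ⟨d - l, ⟨le_rfl, by linarith⟩, hEgeo.symm⟩ ?_
    intro g hg t ht t'
    rcases lines2 g hg t ht with h | h | h <;> obtain ⟨t'', e⟩ := h t' <;> rw [e]
    · exact sE _
    · rw [AE, inv2]; exact sE _
    · rw [inv1]; exact sE _
  · refine F.side_ne_zero (mul_mem hA hEm) hh1.1 hh1.2 th
      (S := geo '' Set.Icc 0 d ∪ (A • ·) '' (geo '' Set.Icc (d - l) 0)) ?_ (z := geo 0)
      (Or.inl ⟨0, ⟨le_rfl, hd0.le⟩, rfl⟩)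
      (Or.inr ⟨geo (d - l), ⟨d - l, ⟨le_rfl, by linarith⟩, rfl⟩, by rw [mul_smul, hEgeo]⟩) ?_
    · refine IsPreconnected.union (geo d) ⟨d, ⟨hd0.le, le_rfl⟩, rfl⟩
        ⟨geo 0, ⟨0, ⟨by linarith, le_rfl⟩, rfl⟩, F.A_smul⟩ (conn 0 d)
        ((conn (d - l) 0).image _ (continuous_const_smul A).continuousOn)
    · rintro g hg t (ht | ht) t'
      · rcases lines1 g hg t ht with h | h | h <;> obtain ⟨t'', e⟩ := h t' <;> rw [e]
        · exact sh _
        · exact shA' _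
        · exact shA _
      · obtain ⟨w, hw, e0⟩ := ht
        have hw' : (A⁻¹ * g) • geo t ∈ geo '' Set.Icc (d - l) 0 := by
          rw [mul_smul, ← e0]
          simpa using hw
        have back : ∀ {t' : ℝ} {x : ℍ}, (A⁻¹ * g) • geo t' = x → g • geo t' = A • x := by
          rintro t' x rfl
          rw [mul_smul, smul_inv_smul]
        rcases lines2 _ (mul_mem (inv_mem hA) hg) t hw' with h | h | h <;>
          obtain ⟨t'', e⟩ := h t' <;> rw [back e]
        · exact shA _
        · rw [smul_inv_smul]; exact sh _
        · rw [smul_smul, inv1]; exact sh _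
  · rw [side_geo, side_geo, a10, a01, b10, b01]
    simp only [neg_zero, Real.exp_zero, mul_one]
    have : (-(p⁻¹ * s) - p * s) * (-(q * s) - q⁻¹ * s) = s ^ 2 * ((p⁻¹ + p) * (q + q⁻¹)) := by ring
    rw [this]; positivity

/-- The geodesic and its translate by `A`. -/
def cross (A : SL(2, ℝ)) : Set ℍ := Set.range geo ∪ (A • ·) '' Set.range geo

/-- The translates of `cross A` by the powers of `X` form a connected set missing the axis of `Y`
and accumulating at the fixed points of `X`; this fixes the sign of `qf Y` there. -/
theorem nonneg_side_mul_qf_of_simple (F : IsFigureEight Γ l d A) {X Y : SL(2, ℝ)} (hX : X ∈ Γ)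
    (hX0 : X • geo 0 ∈ cross A) (h1 : X ≠ 1) (h2 : X ≠ -1)
    (hY : ∀ g ∈ Γ, ∀ t, side Y (g • geo t) ≠ 0) {u w : ℝ} (huw : u ≠ 0 ∨ w ≠ 0)
    (hv : qf X u w = 0) : 0 ≤ side Y (geo 0) * qf Y u w := by
  have hr : IsPreconnected (Set.range geo) := isPreconnected_range continuous_geo
  have hS : IsPreconnected (cross A) := IsPreconnected.union (geo d) ⟨d, rfl⟩
    ⟨geo 0, ⟨0, rfl⟩, F.A_smul⟩ hr (hr.image _ (continuous_const_smul A).continuousOn)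
  refine nonneg_side_mul_qf hS (Or.inl ⟨0, rfl⟩) hX0 ?_ h1 h2 huw hv
  rintro n x (⟨t, rfl⟩ | ⟨_, ⟨t, rfl⟩, rfl⟩)
  · exact hY _ (zpow_mem hX n) t
  · change side Y (X ^ n • A • geo t) ≠ 0
    rw [smul_smul]
    exact hY _ (mul_mem (zpow_mem hX n) F.A_mem) t

theorem A_smul_mem_cross (F : IsFigureEight Γ l d A) : A • geo 0 ∈ cross A :=
  Or.inl ⟨d, F.A_smul.symm⟩

theorem E_smul_mem_cross (F : IsFigureEight Γ l d A) : ((D l)⁻¹ * A) • geo 0 ∈ cross A :=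
  Or.inl ⟨_, F.E_smul.symm⟩

theorem AE_smul_mem_cross (F : IsFigureEight Γ l d A) :
    (A * ((D l)⁻¹ * A)) • geo 0 ∈ cross A :=
  Or.inr ⟨geo (d - l), ⟨_, rfl⟩, by rw [mul_smul, F.E_smul]⟩

/-- The three simple elements have traces of the signs `+`, `+`, `-`. -/
theorem tr_le (F : IsFigureEight Γ l d A) (h0 : 0 < tr A) :
    2 ≤ tr A ∧ 2 ≤ tr ((D l)⁻¹ * A) ∧ tr (A * ((D l)⁻¹ * A)) ≤ -2 := by
  obtain ⟨hA, hE, hh, hpos⟩ := F.simple_axes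
  obtain ⟨k, s, p, q, hp, hq, hks, hl, ⟨a00, a01, a10, a11⟩, b00, b01, b10, b11⟩ :=
    F.exists_entries
  set E := (D l)⁻¹ * A with hEdef
  have hAm := F.A_mem
  have hEm : E ∈ Γ := mul_mem (inv_mem F.D_mem) hAm
  have tA := F.surface.two_le_abs_tr hAm
  have tE := F.surface.two_le_abs_tr hEm
  have th := F.surface.two_le_abs_tr (mul_mem hAm hEm)
  have k0 : 0 < k := by
    rw [tr, a00, a11, ← add_mul] at h0
    have : 0 < p + p⁻¹ := by positivity
    exact (mul_pos_iff_of_pos_left this).1 h0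
  have tE0 : 0 < tr E := by
    rw [tr, b00, b11, ← add_mul]
    have : 0 < q := by linarith
    positivity
  rw [abs_of_pos h0] at tA
  rw [abs_of_pos tE0] at tE
  refine ⟨tA, tE, ?_⟩
  rcases le_abs.1 th with h | h
  swap
  · linarith
  exfalso
  set X := A * E with hX
  have hXm : X ∈ Γ := mul_mem hAm hEm
  obtain ⟨u, w, huw, qX⟩ := exists_eigenvector (X := X) th
  obtain ⟨m, e1, e2, hm⟩ := exists_eigenvalue huw qX
  have hm0 : 0 < m := eigenvalue_pos (by linarith) hm
  have hX1 := ne_one_of_side (hh 1 (one_mem _) 0)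
  have sign : ∀ Y : SL(2, ℝ), (∀ g ∈ Γ, ∀ t, side Y (g • geo t) ≠ 0) →
      0 ≤ side Y (geo 0) * qf Y u w := fun Y hY =>
    F.nonneg_side_mul_qf_of_simple hXm F.AE_smul_mem_cross hX1.1 hX1.2 hY huw qX
  have s1 := sign A hA
  have s2 := sign E hE
  -- `E` sends the eigenvector `v` of `A * E` to a positive multiple of `A⁻¹ * v`
  have hqf : qf E u w = -m * qf A u w := by
    have hdA := det_entries A
    rw [hX] at e1 e2
    simp only [mul_entry] at e1 e2
    simp only [qf]
    linear_combination -(u * A 1 0 + w * A 1 1) * e1 + (u * A 0 0 + w * A 0 1) * e2 +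
      (E 0 0 * u * w + E 0 1 * w ^ 2 - E 1 0 * u ^ 2 - E 1 1 * u * w) * hdA
  have hqA : qf A u w = 0 := by
    rw [hqf] at s2
    by_contra hne
    have h1 : 0 < qf A u w ^ 2 := by positivity
    have h2 := mul_nonneg s1 s2
    have h3 := mul_pos (mul_pos hm0 hpos) h1
    linarith
  have hqE : qf E u w = 0 := by rw [hqf, hqA, mul_zero]
  have hcomm := F.surface.commute_of_common_eigenvector hAm hEm huw hqA hqE
  have h01 := congrArg (fun Y : SL(2, ℝ) => Y 0 1) hcomm
  simp only [mul_entry, a00, a01, a11, b00, b01, b11] at h01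
  have p0 : 0 < p := by linarith
  have q0 : 0 < q := by linarith
  have h2 : p⁻¹ * q⁻¹ < p * q := by
    rw [← mul_inv]
    exact (inv_lt_one_of_one_lt₀ (one_lt_mul_of_lt_of_le hp hq.le)).trans
      (one_lt_mul_of_lt_of_le hp hq.le)
  have h3 : s * (k * (p * q - p⁻¹ * q⁻¹)) = 0 := by linear_combination h01
  have hs : s = 0 := by
    refine (mul_eq_zero.1 h3).resolve_right (mul_pos k0 (by linarith)).ne'
  have := hA 1 (one_mem _) 0
  rw [one_smul, side_geo, a10, a01, hs] at this
  simp at this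

end IsFigureEight

/-! ### Hyperbolic elements of the principal congruence subgroup -/

/-- Some conjugate of `X` in `Gamma2` has an axis that crosses the axis of `X`: the eigenvectors
of `X` lie on both sides of it. -/
def CrossesConjugate (X : SL(2, ℝ)) : Prop :=
  ∃ g ∈ Gamma2, ∀ a : ℝ, a ≠ 0 → ∃ u w, (u ≠ 0 ∨ w ≠ 0) ∧ qf X u w = 0 ∧
    a * qf (g * X * g⁻¹) u w < 0

theorem CrossesConjugate.of_conj {X S : SL(2, ℝ)} (hS : ∀ g ∈ Gamma2, S * g * S⁻¹ ∈ Gamma2)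
    (h : CrossesConjugate (S⁻¹ * X * S)) : CrossesConjugate X := by
  obtain ⟨g, hg, h⟩ := h
  refine ⟨S * g * S⁻¹, hS g hg, fun a ha => ?_⟩
  obtain ⟨u, w, huw, h0, h1⟩ := h a ha
  refine ⟨_, _, mul_vec_ne_zero S huw, ?_, ?_⟩
  · rw [← qf_conj, h0]
  · rw [← qf_conj]
    convert h1 using 3
    group

theorem U_conj_Gamma2 (n : ℤ) {g : SL(2, ℝ)} (hg : g ∈ Gamma2) : U n * g * (U n)⁻¹ ∈ Gamma2 := by
  obtain ⟨a, b, c, d, ha, hb, hc, hd⟩ := hg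
  refine ⟨a + n * c, b + n * (d - a) - n ^ 2 * c, c, d - n * c, ?_, ?_, ?_, ?_⟩ <;>
    simp only [mul_entry, inv_entry_00, inv_entry_01, inv_entry_10, inv_entry_11, U, sl_00, sl_01,
      sl_10, sl_11, ha, hb, hc, hd] <;> push_cast <;> ring

/-- The half turn about `i`. -/
def halfTurn : SL(2, ℝ) := sl 0 1 (-1) 0 (by norm_num)

theorem halfTurn_conj_Gamma2 {g : SL(2, ℝ)} (hg : g ∈ Gamma2) :
    halfTurn * g * halfTurn⁻¹ ∈ Gamma2 := by
  obtain ⟨a, b, c, d, ha, hb, hc, hd⟩ := hg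
  refine ⟨d, -c, -b, a, ?_, ?_, ?_, ?_⟩ <;>
    simp only [mul_entry, inv_entry_00, inv_entry_01, inv_entry_10, inv_entry_11, halfTurn, sl_00,
      sl_01, sl_10, sl_11, ha, hb, hc, hd] <;> push_cast <;> ring

/-- An axis of diameter greater than `2` crosses its translate by `2`. -/
theorem crossesConjugate_of_lt {X : SL(2, ℝ)} (hc : X 1 0 ≠ 0)
    (h : 4 * X 1 0 ^ 2 < tr X ^ 2 - 4) : CrossesConjugate X := by
  refine ⟨U 2, by simpa using U_mem_Gamma2 1, fun a ha => ?_⟩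
  set c := X 1 0 with hcdef
  set e := X 1 1 - X 0 0 with he
  set R := √(tr X ^ 2 - 4) with hR
  have hd := det_entries X
  have hR2 : R ^ 2 = tr X ^ 2 - 4 := Real.sq_sqrt (by nlinarith [sq_nonneg c])
  have hRc : 2 * |c| < R := by
    rw [hR]; apply Real.lt_sqrt_of_sq_lt
    rw [mul_pow, sq_abs]; linarith
  have disc : e ^ 2 + 4 * X 0 1 * c = R ^ 2 := by
    rw [hR2, tr]; linear_combination -4 * hd
  have hq : ∀ r : ℝ, r ^ 2 = R ^ 2 → qf X (-e + r) (2 * c) = 0 := by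
    intro r hr
    simp only [qf]
    rw [← hcdef, ← he]
    linear_combination c * (hr - disc)
  have hq2 : ∀ r : ℝ, r ^ 2 = R ^ 2 →
      qf (U 2 * X * (U 2)⁻¹) (-e + r) (2 * c) = -8 * c ^ 2 * (r - 2 * c) := by
    intro r hr
    have := hq r hr
    simp only [qf] at this
    simp only [qf, mul_entry, inv_entry_00, inv_entry_01, inv_entry_10, inv_entry_11, U, sl_00,
      sl_01, sl_10, sl_11]
    rw [← hcdef] at this ⊢
    linear_combination this
  have hc2 : 0 < c ^ 2 := by positivity
  have hlt := abs_lt.1 (by linarith : |c| < R / 2)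
  have e1 : 0 < 8 * c ^ 2 * (R - 2 * c) := by apply mul_pos <;> linarith
  have e2 : 0 < 8 * c ^ 2 * (R + 2 * c) := by apply mul_pos <;> linarith
  rcases lt_or_gt_of_ne ha with ha | ha
  · refine ⟨-e + -R, 2 * c, Or.inr (by simpa using hc), hq _ (by ring), ?_⟩
    rw [hq2 _ (by ring)]
    nlinarith
  · refine ⟨-e + R, 2 * c, Or.inr (by simpa using hc), hq _ rfl, ?_⟩
    rw [hq2 _ rfl]
    nlinarith

/-- Every hyperbolic element of `Gamma2` has an axis that crosses one of its translates under
`Gamma2`. After conjugation by an integral matrix making the lower left entry minimal, the axis has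
diameter greater than `2`. -/
theorem crossesConjugate_of_mem {X : SL(2, ℝ)} (hX : X ∈ Gamma2) (h : 2 < |tr X|) :
    CrossesConjugate X := by
  suffices H : ∀ (N : ℕ) (X : SL(2, ℝ)), X ∈ Gamma2 → 2 < |tr X| → |X 1 0| ≤ N →
      CrossesConjugate X by
    obtain ⟨N, hN⟩ := exists_nat_ge |X 1 0|
    exact H N X hX h hN
  intro N
  induction N using Nat.strong_induction_on with
  | _ N ih =>
  intro X hX h hN
  have hc0 : ∀ Z ∈ Gamma2, 2 < |tr Z| → Z 1 0 ≠ 0 := by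
    rintro Z ⟨a, b, c, d, ha, hb, hc, hd⟩ hZ hz
    have hdet := det_entries Z
    rw [hz, ha, hb, hd] at hdet
    have hdet' : (2 * a + 1) * (2 * d + 1) = 1 := by
      have : (((2 * a + 1) * (2 * d + 1) : ℤ) : ℝ) = ((1 : ℤ) : ℝ) := by push_cast; linarith
      exact_mod_cast this
    rw [tr, ha, hd] at hZ
    rcases Int.eq_one_or_neg_one_of_mul_eq_one' hdet' with ⟨h1, h2⟩ | ⟨h1, h2⟩
    · have h1' : (2 * a + 1 : ℝ) = 1 := by exact_mod_cast h1
      have h2' : (2 * d + 1 : ℝ) = 1 := by exact_mod_cast h2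
      rw [h1', h2'] at hZ; norm_num at hZ
    · have h1' : (2 * a + 1 : ℝ) = -1 := by exact_mod_cast h1
      have h2' : (2 * d + 1 : ℝ) = -1 := by exact_mod_cast h2
      rw [h1', h2'] at hZ; norm_num at hZ
  have hcX := hc0 X hX h
  -- a translation makes the entries on the diagonal close to each other
  set n : ℤ := round ((X 0 0 - X 1 1) / (2 * X 1 0)) with hn
  have hround := abs_sub_round ((X 0 0 - X 1 1) / (2 * X 1 0))
  rw [← hn] at hround
  set Z := (U n)⁻¹ * X * U n with hZ
  have hZm : Z ∈ Gamma2 := by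
    have := U_conj_Gamma2 (-n) hX
    push_cast at this
    rwa [U_neg, inv_inv] at this
  have htrZ : tr Z = tr X := tr_conj' _ _
  have z10 : Z 1 0 = X 1 0 := by
    simp only [hZ, mul_entry, inv_entry_10, inv_entry_11, U, sl_00, sl_10]; ring
  have zd : Z 1 1 - Z 0 0 = X 1 1 - X 0 0 + 2 * n * X 1 0 := by
    simp only [hZ, mul_entry, inv_entry_00, inv_entry_01, inv_entry_10, inv_entry_11, U, sl_00,
      sl_01, sl_10, sl_11]
    ring
  have hsmall : |Z 1 1 - Z 0 0| ≤ |Z 1 0| := by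
    rw [zd, z10]
    have e : X 1 1 - X 0 0 + 2 * n * X 1 0 =
        -(((X 0 0 - X 1 1) / (2 * X 1 0) - n) * (2 * X 1 0)) := by field_simp; ring
    rw [e, abs_neg, abs_mul, abs_mul]
    norm_num
    nlinarith [abs_nonneg (X 1 0)]
  apply CrossesConjugate.of_conj (S := U n) (fun g hg => U_conj_Gamma2 n hg)
  rw [← hZ]
  have hZt : 2 < |tr Z| := by rwa [htrZ]
  by_cases hb : |Z 0 1| < |Z 1 0|
  · apply CrossesConjugate.of_conj (S := halfTurn) (fun g hg => halfTurn_conj_Gamma2 hg)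
    set W := halfTurn⁻¹ * Z * halfTurn with hW
    have hWm : W ∈ Gamma2 := by
      have e : W = halfTurn * Z * halfTurn⁻¹ := by
        apply ext_entries <;> simp only [hW, mul_entry, inv_entry_00, inv_entry_01, inv_entry_10,
          inv_entry_11, halfTurn, sl_00, sl_01, sl_10, sl_11] <;> ring
      rw [e]; exact halfTurn_conj_Gamma2 hZm
    have w10 : W 1 0 = -Z 0 1 := by
      simp only [hW, mul_entry, inv_entry_10, inv_entry_11, halfTurn, sl_00, sl_10]; ring
    obtain ⟨a, b, c, d, ha', hb', hc', hd'⟩ := hZm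
    rw [z10] at hc' hb
    rw [hb'] at w10 hb
    rw [hc'] at hb hN
    have hb2 : |2 * b| < |2 * c| := by exact_mod_cast hb
    have hN2 : |2 * c| ≤ N := by exact_mod_cast hN
    refine ih (|2 * b|).toNat ?_ W hWm (by rwa [tr_conj']) ?_
    · have := abs_nonneg (2 * b); omega
    · rw [w10, abs_neg]
      have : ((|2 * b|).toNat : ℤ) = |2 * b| := Int.toNat_of_nonneg (abs_nonneg _)
      have h3 : (((|2 * b|).toNat : ℤ) : ℝ) = ((|2 * b| : ℤ) : ℝ) := by rw [this]
      push_cast at h3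
      rw [← h3]
  · push Not at hb
    apply crossesConjugate_of_lt (hc0 Z hZm hZt)
    have hd := det_entries Z
    have disc : (Z 1 1 - Z 0 0) ^ 2 + 4 * (Z 0 1 * Z 1 0) = tr Z ^ 2 - 4 := by
      rw [tr]; linear_combination -4 * hd
    have hpos : 0 < tr Z ^ 2 - 4 := by rw [← sq_abs]; nlinarith
    have hcZ : 0 < |Z 1 0| := abs_pos.2 (hc0 Z hZm hZt)
    have hsq : (Z 1 1 - Z 0 0) ^ 2 ≤ Z 1 0 ^ 2 := sq_le_sq.2 hsmall
    have hbc : Z 1 0 ^ 2 ≤ |Z 0 1 * Z 1 0| := by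
      rw [abs_mul, ← sq_abs]; nlinarith
    have hbcpos : 0 < Z 0 1 * Z 1 0 := by
      by_contra hneg
      push Not at hneg
      rw [abs_of_nonpos hneg] at hbc
      nlinarith
    rw [abs_of_pos hbcpos] at hbc
    refine lt_of_le_of_ne (by nlinarith [sq_nonneg (Z 1 1 - Z 0 0)]) fun heq => ?_
    -- equality would give a Pell equation without solutions
    obtain ⟨m, hm⟩ := exists_tr_Gamma2 hZm
    obtain ⟨a, b, c, d, ha', hb', hc', hd'⟩ := hZm
    rw [hm, hc'] at heq
    have heq' : (2 * m + 1) ^ 2 - (2 * c) ^ 2 = 1 := by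
      have : (((2 * m + 1) ^ 2 - (2 * c) ^ 2 : ℤ) : ℝ) = ((1 : ℤ) : ℝ) := by push_cast; linarith
      exact_mod_cast this
    have hfac : (2 * m + 1 - 2 * c) * (2 * m + 1 + 2 * c) = 1 := by linarith
    have : 2 * c = 0 := by
      rcases Int.eq_one_or_neg_one_of_mul_eq_one' hfac with ⟨h1, h2⟩ | ⟨h1, h2⟩ <;> omega
    have hz : Z 1 0 = 0 := by rw [hc']; exact_mod_cast this
    rw [hz] at hcZ
    simp at hcZ

/-! ### The length of a geodesic with one double point -/

namespace IsFigureEight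

variable {Γ : Subgroup SL(2, ℝ)} {l d : ℝ} {A : SL(2, ℝ)}

/-- The trace identity for `D l = A * E⁻¹` with `E = (D l)⁻¹ * A`. -/
theorem two_mul_cosh (A : SL(2, ℝ)) (l : ℝ) : 2 * Real.cosh (l / 2) =
    tr A * tr ((D l)⁻¹ * A) - tr (A * ((D l)⁻¹ * A)) := by
  rw [← tr_mul_add, ← tr_D l]
  have : A * ((D l)⁻¹ * A)⁻¹ = D l := by group
  rw [this]; ring

theorem exists_tr_pos (F : IsFigureEight Γ l d A) : ∃ A', IsFigureEight Γ l d A' ∧ 0 < tr A' := by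
  have := F.surface.two_le_abs_tr F.A_mem
  rcases le_abs.1 this with h | h
  · exact ⟨A, F, by linarith⟩
  · exact ⟨-A, F.neg, by rw [tr_neg]; linarith⟩

/-- The lower bound `2 * cosh (l / 2) ≥ 2 * 2 + 2`, from the sizes and signs of the three traces. -/
theorem three_le_cosh (F : IsFigureEight Γ l d A) : 3 ≤ Real.cosh (l / 2) := by
  obtain ⟨A, F, h⟩ := F.exists_tr_pos
  obtain ⟨h1, h2, h3⟩ := F.tr_le h
  have := two_mul_cosh A l
  nlinarith

/-- In `Gamma2` up to conjugation, an element whose axis misses the translates of the geodesic is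
parabolic: otherwise its axis would cross one of its conjugates. -/
theorem abs_tr_eq_two (F : IsFigureEight Γ l d A) {N : SL(2, ℝ)} (hN : conjGroup Γ N = Gamma2)
    {X : SL(2, ℝ)} (hX : X ∈ Γ) (hX0 : X • geo 0 ∈ cross A)
    (hs : ∀ g ∈ Γ, ∀ t, side X (g • geo t) ≠ 0) : |tr X| = 2 := by
  refine le_antisymm ?_ (F.surface.two_le_abs_tr hX)
  by_contra hlt
  push Not at hlt
  have hX1 := ne_one_of_side (hs 1 (one_mem _) 0)
  have hXN : N⁻¹ * X * N ∈ Gamma2 := by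
    rw [← hN]
    left
    convert hX using 1
    group
  obtain ⟨g, hg, H⟩ := crossesConjugate_of_mem hXN (by rwa [tr_conj'])
  have hG : N * g * N⁻¹ ∈ Γ := by
    rw [← hN] at hg
    rcases hg with h | h
    · exact h
    · simpa using F.neg_mem h
  set G := N * g * N⁻¹ with hGdef
  have hY : ∀ g' ∈ Γ, ∀ t, side (G * X * G⁻¹) (g' • geo t) ≠ 0 := by
    intro g' hg' t
    rw [← smul_inv_smul G (g' • geo t), side_smul, smul_smul]
    exact hs _ (mul_mem (inv_mem hG) hg') t
  have ha : side (G * X * G⁻¹) (geo 0) ≠ 0 := by simpa using hY 1 (one_mem _) 0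
  obtain ⟨u, w, huw, h0, h1⟩ := H _ ha
  have := F.nonneg_side_mul_qf_of_simple hX hX0 hX1.1 hX1.2 hY (mul_vec_ne_zero N huw)
    (by rw [← qf_conj, h0])
  rw [← qf_conj] at this
  have e : N⁻¹ * (G * X * G⁻¹) * N = g * (N⁻¹ * X * N) * g⁻¹ := by rw [hGdef]; group
  rw [e] at this
  linarith

/-- Equality means that the three simple elements are parabolic, and then two of them generate the
congruence subgroup up to conjugation and sign. -/
theorem cosh_eq_three_iff (F : IsFigureEight Γ l d A) :
    Real.cosh (l / 2) = 3 ↔ ∃ N, conjGroup Γ N = Gamma2 := by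
  obtain ⟨A, F, h⟩ := F.exists_tr_pos
  obtain ⟨h1, h2, h3⟩ := F.tr_le h
  have hc := two_mul_cosh A l
  have hEm : (D l)⁻¹ * A ∈ Γ := mul_mem (inv_mem F.D_mem) F.A_mem
  constructor
  · intro h6
    rw [h6] at hc
    have tA : tr A = 2 := by nlinarith
    have tE : tr ((D l)⁻¹ * A) = 2 := by nlinarith
    have tAB : tr (A * ((D l)⁻¹ * A)⁻¹) = 6 := by
      have := tr_mul_add A ((D l)⁻¹ * A)
      linarith
    obtain ⟨N, hU, hL⟩ := exists_conj_standard tA (by rw [tr_inv, tE]) (by rw [tAB]; norm_num)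
    have hconj : ∀ X ∈ Γ, N⁻¹ * X * N ∈ conjGroup Γ N := by
      intro X hX
      left
      convert hX using 1
      group
    refine ⟨N, (F.surface.conjGroup N).eq_Gamma2 ?_ ?_ (neg_one_mem_conjGroup _ _)⟩
    · have := hconj _ F.A_mem
      rcases hU with h | h
      · rwa [← h]
      · rw [← neg_neg (2 : ℝ), U_neg, ← h]; exact inv_mem this
    · have := hconj _ (inv_mem hEm)
      rcases hL with h | h
      · rwa [← h]
      · rw [← neg_neg (2 : ℝ), Lo_neg, ← h]; exact inv_mem this
  · rintro ⟨N, hN⟩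
    obtain ⟨sA, sE, sh, -⟩ := F.simple_axes
    have tA := F.abs_tr_eq_two hN F.A_mem F.A_smul_mem_cross sA
    have tE := F.abs_tr_eq_two hN hEm F.E_smul_mem_cross sE
    have th := F.abs_tr_eq_two hN (mul_mem F.A_mem hEm) F.AE_smul_mem_cross sh
    rw [abs_of_pos h] at tA
    rw [abs_of_pos (by linarith)] at tE
    rw [abs_of_neg (by linarith)] at th
    rw [tA, tE] at hc
    linarith

end IsFigureEight

theorem proj_geo_eq_iff {Γ : Subgroup SL(2, ℝ)} {M : SL(2, ℝ)} {c : ℝ → Surface Γ} {s : ℝ}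
    (h : ∀ r, c (s + r) = proj Γ (M • geo r)) (r r' : ℝ) :
    c (s + r) = c (s + r') ↔ ∃ g ∈ conjGroup Γ M, g • geo r = geo r' := by
  rw [h, h, proj_smul_eq_iff]

/-- A geodesic with one double point, moved to the imaginary axis so that the double point is the
image of `geo 0`. -/
theorem HasExactlyOneDoublePoint.exists_isFigureEight {Γ : Subgroup SL(2, ℝ)}
    (hΓ : IsSurfaceGroup Γ) {c : ℝ → Surface Γ} {l : ℝ} (hc : IsClosedGeodesic Γ c l)
    (hd : HasExactlyOneDoublePoint c l) :
    ∃ M d A, IsFigureEight (conjGroup Γ M) l d A := by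
  obtain ⟨⟨s, s'⟩, ⟨h0, h1, h2, h3⟩, huniq⟩ := hd
  simp only at h0 h1 h2 h3
  obtain ⟨M, hM, hD⟩ := hc.exists_frame hΓ s
  have hl := hc.pos
  obtain ⟨A, hA, hA0⟩ := (proj_geo_eq_iff hM 0 (s' - s)).1 (by simpa using h3)
  refine ⟨M, s' - s, A, hΓ.conjGroup M, neg_one_mem_conjGroup _ _, by linarith, by linarith, hD,
    hA, hA0, ?_⟩
  intro g hg r r' hr
  have hcr := (proj_geo_eq_iff hM r r').2 ⟨g, hg, hr⟩
  -- the representatives of the parameters in the fundamental period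
  have red : ∀ x : ℝ, ∃ n : ℤ, ∃ y, x = y + n * l ∧ 0 ≤ y ∧ y < l ∧ c y = c x := by
    intro x
    have h := toIcoMod_mem_Ico hl 0 x
    rw [zero_add] at h
    refine ⟨toIcoDiv hl 0 x, toIcoMod hl 0 x, ?_, h.1, h.2, ?_⟩
    · have := toIcoMod_add_toIcoDiv_zsmul hl 0 x
      rw [zsmul_eq_mul] at this; exact this.symm
    · rw [toIcoMod, zsmul_eq_mul, hc.periodic.sub_int_mul_eq]
  obtain ⟨n, t, ht, t0, t1, ct⟩ := red (s + r)
  obtain ⟨m, t', ht', t0', t1', ct'⟩ := red (s + r')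
  have htt : c t = c t' := by rw [ct, ct', hcr]
  rcases lt_trichotomy t t' with hlt | heq | hgt
  · have := huniq (t, t') ⟨t0, hlt, t1', htt⟩
    simp only [Prod.mk.injEq] at this
    obtain ⟨e1, e2⟩ := this
    right; left
    exact ⟨⟨n, by linarith⟩, m, by linarith⟩
  · left
    refine ⟨m - n, ?_⟩
    push_cast
    linarith
  · have := huniq (t', t) ⟨t0', hgt, t1, htt.symm⟩
    simp only [Prod.mk.injEq] at this
    obtain ⟨e1, e2⟩ := this
    right; right
    exact ⟨⟨n, by linarith⟩, m, by linarith⟩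

/-- A closed geodesic with exactly one double point has length at least `2 * arcosh 3`, with
equality exactly on the surfaces uniformised by `Gamma2`. -/
theorem HasExactlyOneDoublePoint.le_length {Γ : Subgroup SL(2, ℝ)}
    (hΓ : IsSurfaceGroup Γ) {c : ℝ → Surface Γ} {l : ℝ} (hc : IsClosedGeodesic Γ c l)
    (hd : HasExactlyOneDoublePoint c l) :
    2 * Real.arcosh 3 ≤ l ∧ (l = 2 * Real.arcosh 3 ↔ ∃ N, conjGroup Γ N = Gamma2) := by
  obtain ⟨M, d, A, F⟩ := hd.exists_isFigureEight hΓ hc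
  have hl := hc.pos
  have e3 : Real.cosh (Real.arcosh 3) = 3 := Real.cosh_arcosh (by norm_num)
  have h3 : 0 ≤ Real.arcosh 3 := Real.arcosh_nonneg (by norm_num)
  constructor
  · have := F.three_le_cosh
    rw [← e3, Real.cosh_le_cosh, abs_of_nonneg h3, abs_of_pos (by positivity)] at this
    linarith
  · have e : l = 2 * Real.arcosh 3 ↔ Real.cosh (l / 2) = 3 := by
      constructor
      · rintro rfl
        rw [mul_div_cancel_left₀ _ (by norm_num : (2 : ℝ) ≠ 0), e3]
      · intro h
        have := Real.arcosh_cosh (by positivity : 0 ≤ l / 2)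
        rw [h] at this
        linarith
    rw [e, F.cosh_eq_three_iff]
    constructor
    · rintro ⟨N, hN⟩
      exact ⟨M * N, by rw [← conjGroup_conjGroup, hN]⟩
    · rintro ⟨N, hN⟩
      exact ⟨M⁻¹ * N, by rw [conjGroup_conjGroup, mul_inv_cancel_left, hN]⟩

/-! ### The shortest geodesic with one double point -/

theorem exp_arcosh_three : Real.exp (Real.arcosh 3) = 3 + 2 * √2 := by
  rw [Real.exp_arcosh (by norm_num)]
  rw [show (3 : ℝ) ^ 2 - 1 = 2 ^ 2 * 2 by norm_num, Real.sqrt_mul (by norm_num),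
    Real.sqrt_sq (by norm_num)]

theorem arcosh_three : Real.arcosh 3 = Real.log (3 + 2 * √2) := by
  rw [← exp_arcosh_three, Real.log_exp]

theorem exp_half_arcosh_three : Real.exp (Real.arcosh 3 / 2) = 1 + √2 := by
  have h2 : √2 ^ 2 = (2 : ℝ) := Real.sq_sqrt (by norm_num)
  have h : Real.exp (Real.arcosh 3 / 2) ^ 2 = (1 + √2) ^ 2 := by
    rw [← Real.exp_nat_mul]
    rw [show ((2 : ℕ) : ℝ) * (Real.arcosh 3 / 2) = Real.arcosh 3 by push_cast; ring,
      exp_arcosh_three]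
    linear_combination -h2
  exact (pow_left_inj₀ (Real.exp_pos _).le (by positivity) (by norm_num)).1 h

/-- The normalising factor of `axisFrame`. -/
def axisScale : ℝ := (√(2 * √2))⁻¹

theorem axisScale_sq : axisScale ^ 2 * (2 * √2) = 1 := by
  have : (0 : ℝ) < 2 * √2 := by positivity
  rw [axisScale, inv_pow, Real.sq_sqrt this.le, inv_mul_cancel₀ this.ne']

/-- The matrix that maps the standard geodesic to the axis of `[[5, 2], [2, 1]]`, which runs from
`1 - √2` to `1 + √2`. -/
def axisFrame : SL(2, ℝ) :=
  sl (axisScale * (1 + √2)) (axisScale * (1 - √2)) axisScale axisScale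
    (by linear_combination axisScale_sq)

theorem axisFrame_conj : axisFrame * D (2 * Real.arcosh 3) * axisFrame⁻¹ =
    sl 5 2 2 1 (by norm_num) := by
  have h2 : √2 ^ 2 = (2 : ℝ) := Real.sq_sqrt (by norm_num)
  have hk := axisScale_sq
  have e1 : Real.exp (2 * Real.arcosh 3 / 2) = 3 + 2 * √2 := by
    rw [mul_div_cancel_left₀ _ (by norm_num : (2 : ℝ) ≠ 0), exp_arcosh_three]
  have e2 : Real.exp (-(2 * Real.arcosh 3 / 2)) = 3 - 2 * √2 := by
    rw [Real.exp_neg, e1]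
    exact inv_eq_of_mul_eq_one_right (by linear_combination -4 * h2)
  apply ext_entries <;>
    simp only [mul_entry, inv_entry_00, inv_entry_01, inv_entry_10, inv_entry_11, axisFrame, D,
      sl_00, sl_01, sl_10, sl_11, e1, e2]
  · linear_combination 5 * hk
  · linear_combination 2 * hk + 4 * axisScale ^ 2 * √2 * h2
  · linear_combination 2 * hk
  · linear_combination hk

theorem pell_cases {a b : ℕ} (h : a * a + 1 = 2 * (b * b)) (hb : b ≤ 24) :
    (a = 1 ∧ b = 1) ∨ (a = 7 ∧ b = 5) := by
  have ha : a ≤ 34 := by nlinarith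
  have key : ∀ b ≤ 24, ∀ a ≤ 34, a * a + 1 = 2 * (b * b) → (a = 1 ∧ b = 1) ∨ (a = 7 ∧ b = 5) := by
    decide
  exact key b hb a ha h

/-- The units of norm `-1` in `ℤ[√2]` between `1` and `(1 + √2) ^ 4`. -/
theorem unit_cases {r j : ℤ} (pell : (r : ℝ) ^ 2 + 1 = 2 * j ^ 2) {e : ℝ} (h1 : 1 ≤ e)
    (h4 : e < (1 + √2) ^ 4) (hsq : e ^ 2 = (√2 * j - r) ^ 2) :
    e = 1 + √2 ∨ e = (1 + √2) ^ 3 := by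
  have h2 : √2 ^ 2 = (2 : ℝ) := Real.sq_sqrt (by norm_num)
  have s1 : 1 < √2 := by rw [Real.lt_sqrt (by norm_num)]; norm_num
  have s2 : √2 < 3 / 2 := by rw [Real.sqrt_lt' (by norm_num)]; norm_num
  have hpell : r.natAbs * r.natAbs + 1 = 2 * (j.natAbs * j.natAbs) := by
    have : r ^ 2 + 1 = 2 * j ^ 2 := by exact_mod_cast pell
    zify
    rw [← sq, ← sq, sq_abs, sq_abs]
    exact this
  have hx : (r.natAbs : ℝ) = |(r : ℝ)| := by rw [Nat.cast_natAbs, Int.cast_abs]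
  have hy : (j.natAbs : ℝ) = |(j : ℝ)| := by rw [Nat.cast_natAbs, Int.cast_abs]
  set x := r.natAbs
  set y := j.natAbs
  have hpell' : (x : ℝ) * x + 1 = 2 * (y * y) := by exact_mod_cast hpell
  have hy1 : 1 ≤ y := by
    by_contra hy1
    have : y = 0 := by omega
    rw [this] at hpell
    omega
  have hy1' : (1 : ℝ) ≤ y := by exact_mod_cast hy1
  have x0 : (0 : ℝ) ≤ x := by positivity
  have hprod : (√2 * y + x) * (√2 * y - x) = 1 := by
    linear_combination (y : ℝ) ^ 2 * h2 - hpell'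
  have hlt : 1 < √2 * y + x := by nlinarith
  have hpos' : 0 < √2 * y - x := by
    by_contra hn
    push Not at hn
    have := mul_nonpos_of_nonneg_of_nonpos (by linarith : 0 ≤ √2 * y + x) hn
    linarith
  have hexp : e = √2 * y + x := by
    have hcases : e ^ 2 = (√2 * y + x) ^ 2 ∨ e ^ 2 = (√2 * y - x) ^ 2 := by
      rw [hsq, hx, hy]
      rcases abs_cases (r : ℝ) with ⟨h3, -⟩ | ⟨h3, -⟩ <;>
        rcases abs_cases (j : ℝ) with ⟨h4, -⟩ | ⟨h4, -⟩ <;> rw [h3, h4]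
      · right; ring
      · left; ring
      · left; ring
      · right; ring
    have he : 0 ≤ e := by linarith
    rcases hcases with h3 | h3
    · exact (pow_left_inj₀ he (by linarith) (by norm_num)).1 h3
    · have h4 := (pow_left_inj₀ he hpos'.le (by norm_num)).1 h3
      rw [← h4] at hprod
      nlinarith
  have hxy : (y : ℝ) ≤ x := by
    have h3 : 1 * 1 ≤ y * y := Nat.mul_self_le_mul_self hy1
    have h4 : y * y ≤ x * x := by omega
    exact_mod_cast Nat.mul_self_le_mul_self_iff.1 h4
  have hy24 : y ≤ 24 := by
    have e4 : (1 + √2) ^ 4 = (1 + √2) * (7 + 5 * √2) := by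
      linear_combination (√2 ^ 2 + 4 * √2 + 3) * h2
    rw [e4, hexp] at h4
    have h5 : (1 + √2) * y < (1 + √2) * (7 + 5 * √2) := by linarith
    have h6 := lt_of_mul_lt_mul_left h5 (by positivity)
    have h7 : (y : ℝ) < 24 := by linarith
    exact_mod_cast h7.le
  rcases pell_cases hpell hy24 with ⟨hx1, hy1⟩ | ⟨hx1, hy1⟩
  · left
    rw [hexp, hx1, hy1]
    push_cast
    ring
  · right
    rw [hexp, hx1, hy1]
    push_cast
    linear_combination -(√2 + 3) * h2

/-- The parameters in a period at which the geodesic meets another of its lifts. -/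
theorem eq_of_axis_meets {g : SL(2, ℝ)} (hg : g ∈ Gamma2) {t t' : ℝ}
    (h : g • axisFrame • geo t = axisFrame • geo t') (h0 : 0 ≤ t')
    (h1 : t' < 2 * Real.arcosh 3) (hne : t ≠ t') (habs : |t' - t| < 2 * Real.arcosh 3) :
    t' = Real.arcosh 3 / 2 ∨ t' = 3 * (Real.arcosh 3 / 2) := by
  have h2 : √2 ^ 2 = (2 : ℝ) := Real.sq_sqrt (by norm_num)
  have s0 : 0 < √2 := by positivity
  have hk := axisScale_sq
  have hk2 : 0 < axisScale ^ 2 := by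
    have : axisScale ≠ 0 := by
      intro h; rw [h] at hk; norm_num at hk
    positivity
  set l := 2 * Real.arcosh 3 with hl
  have hl0 : 0 < l := by linarith
  set M := axisFrame with hM
  set G := M⁻¹ * g * M with hG
  have hGt : G • geo t = geo t' := by
    rw [hG, mul_smul, mul_smul, h, inv_smul_smul]
  set Y := G * D l * G⁻¹ with hY
  have hside : Y 1 0 * Real.exp t' - Y 0 1 * Real.exp (-t') = 0 := by
    rw [← side_geo, ← hGt, hY, side_smul, side_D]
    simp
  -- the integral matrix with the axis `g • axis`
  obtain ⟨a, b, c, d, ha, hb, hc, hd⟩ := id hg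
  set p : ℤ := (2 * a + 1) * (2 * d + 1) + 2 * b * (2 * d + 1) - (2 * a + 1) * (2 * c) + 4 * b * c
    with hp
  set q : ℤ := (2 * a + 1) ^ 2 - 2 * (2 * a + 1) * (2 * b) - (2 * b) ^ 2 with hq
  set r : ℤ := (2 * d + 1) ^ 2 + 2 * (2 * c) * (2 * d + 1) - (2 * c) ^ 2 with hr
  have hdet := det_entries g
  set Z := g * sl 5 2 2 1 (by norm_num) * g⁻¹ with hZ
  have z00 : Z 0 0 = 3 + 2 * p := by
    simp only [hZ, mul_entry, inv_entry_00, inv_entry_10, sl_00, sl_01, sl_10,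
      sl_11]
    rw [ha, hb, hc, hd] at hdet ⊢
    rw [hp]; push_cast
    linear_combination 3 * hdet
  have z01 : Z 0 1 = 2 * q := by
    simp only [hZ, mul_entry, inv_entry_01, inv_entry_11, sl_00, sl_01, sl_10,
      sl_11]
    rw [ha, hb] at hdet ⊢
    rw [hq]; push_cast
    ring
  have z10 : Z 1 0 = 2 * r := by
    simp only [hZ, mul_entry, inv_entry_00, inv_entry_10, sl_00, sl_01, sl_10,
      sl_11]
    rw [hc, hd] at hdet ⊢
    rw [hr]; push_cast
    ring
  have z11 : Z 1 1 = 3 - 2 * p := by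
    simp only [hZ, mul_entry, inv_entry_01, inv_entry_11, sl_00, sl_01, sl_10,
      sl_11]
    rw [ha, hb, hc, hd] at hdet ⊢
    rw [hp]; push_cast
    linear_combination 3 * hdet
  have hYZ : Y = M⁻¹ * Z * M := by
    rw [hY, hZ, ← axisFrame_conj, hG, ← hl, ← hM]; group
  -- the determinant of `Z`
  have hpqr : (p : ℝ) ^ 2 + q * r = 2 := by
    have := det_entries Z
    rw [z00, z01, z10, z11] at this
    linear_combination -this / 4
  set m := 1 + √2 with hm
  set m' := 1 - √2 with hm'
  set u := r * m ^ 2 - 2 * p * m - q with hu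
  set v := r * m' ^ 2 - 2 * p * m' - q with hv
  have y10 : Y 1 0 = 2 * axisScale ^ 2 * u := by
    rw [hYZ, conj_entry_10, qf, z00, z01, z10, z11, hM, axisFrame, sl_00, sl_10]
    rw [hu]; ring
  have y01 : Y 0 1 = -(2 * axisScale ^ 2 * v) := by
    rw [hYZ, conj_entry_01, qf, z00, z01, z10, z11, hM, axisFrame, sl_01, sl_11]
    rw [hv]; ring
  have huv : u * v = (2 * p + q + r) ^ 2 - 16 := by
    have e1 : m + m' = 2 := by rw [hm, hm']; ring
    have e2 : m * m' = -1 := by rw [hm, hm']; linear_combination -h2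
    have e3 : m ^ 2 + m' ^ 2 = 6 := by rw [hm, hm']; linear_combination 2 * h2
    rw [hu, hv]
    linear_combination (r ^ 2 * (m * m' - 1) - 2 * p * r * (m + m') + 4 * p ^ 2) * e2 +
      (2 * p * r + 2 * p * q) * e1 - q * r * e3 - 8 * hpqr
  have et := Real.exp_pos t'
  have ett : Real.exp t' * Real.exp (-t') = 1 := by rw [← Real.exp_add]; simp
  have huv' : v = -u * Real.exp t' ^ 2 := by
    rw [y10, y01] at hside
    have h3 : axisScale ^ 2 * (v + u * Real.exp t' ^ 2) = 0 := by
      linear_combination Real.exp t' / 2 * hside - axisScale ^ 2 * v * ett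
    have := (mul_eq_zero.1 h3).resolve_left hk2.ne'
    linarith
  -- by `huv` the axes of `Z` and of `!![5, 2; 2, 1]` cross if and only if `V ^ 2 < 1`
  obtain ⟨V, hV⟩ : ∃ V : ℤ, 2 * p + q + r = 4 * V := by
    refine ⟨1 + 2 * a * d + a + d + 2 * b * d + b - 2 * a * c - c + 2 * b * c + a ^ 2 + a -
      b * (2 * a + 1) - b ^ 2 + d ^ 2 + d + c * (2 * d + 1) - c ^ 2, ?_⟩
    rw [hp, hq, hr]; ring
  have hVr : (2 * p + q + r : ℝ) = 4 * V := by exact_mod_cast hV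
  have hu2 : u ^ 2 * Real.exp t' ^ 2 = 16 - 16 * (V : ℝ) ^ 2 := by
    rw [hVr, huv'] at huv
    linear_combination -huv
  have hV1 : V ^ 2 ≤ 1 := by
    have h3 : 0 ≤ u ^ 2 * Real.exp t' ^ 2 := by positivity
    have : (V : ℝ) ^ 2 ≤ 1 := by linarith
    exact_mod_cast this
  by_cases hV0 : V = 0
  · -- the axes cross: the crossing point is given by a unit of norm `-1` in `ℤ[√2]`
    obtain ⟨j, hj⟩ : ∃ j : ℤ, r - p = 2 * j := by
      refine ⟨2 * d ^ 2 + 2 * d + 2 * c * (2 * d + 1) - 2 * c ^ 2 - 2 * a * d - a - d - 2 * b * d -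
        b + 2 * a * c + c - 2 * b * c, ?_⟩
      rw [hp, hr]; ring
    have hjr : (r - p : ℝ) = 2 * j := by exact_mod_cast hj
    rw [hV0] at hVr hu2
    push_cast at hVr hu2
    have hqr : (q : ℝ) = -2 * p - r := by linarith
    have hpr : (p : ℝ) = r - 2 * j := by linarith
    have pell : (r : ℝ) ^ 2 + 1 = 2 * j ^ 2 := by
      rw [hqr, hpr] at hpqr
      linear_combination -hpqr / 2
    have hu4 : u = 4 * (√2 * j + r) := by
      rw [hu, hqr, hpr, hm]
      linear_combination (r : ℝ) * h2
    have hsq : Real.exp t' ^ 2 = (√2 * j - r) ^ 2 := by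
      rw [hu4] at hu2
      have h3 : (√2 * j + r) * (√2 * j - r) = 1 := by
        linear_combination (j : ℝ) ^ 2 * h2 - pell
      linear_combination (√2 * j - r) ^ 2 / 16 * hu2 -
        Real.exp t' ^ 2 * ((√2 * j + r) * (√2 * j - r) + 1) * h3
    have hm1 := exp_half_arcosh_three
    have hbound : Real.exp t' < (1 + √2) ^ 4 := by
      rw [← hm1, ← Real.exp_nat_mul, Real.exp_lt_exp]
      push_cast
      linarith
    rcases unit_cases pell (Real.one_le_exp h0) hbound hsq with h3 | h3
    · left
      rw [← Real.exp_eq_exp, h3, hm1]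
    · right
      rw [← Real.exp_eq_exp, h3, show 3 * (Real.arcosh 3 / 2) = (3 : ℕ) * (Real.arcosh 3 / 2) by
        push_cast; ring, Real.exp_nat_mul, hm1]
  · -- the axes agree
    exfalso
    have hV2 : V ^ 2 = 1 := by
      have : 0 < V ^ 2 := by positivity
      omega
    have hV2r : (V : ℝ) ^ 2 = 1 := by exact_mod_cast hV2
    have u0 : u = 0 := by
      rw [hV2r] at hu2
      have : u ^ 2 * Real.exp t' ^ 2 = 0 := by linarith
      have h3 := (mul_eq_zero.1 this).resolve_right (by positivity)
      exact pow_eq_zero_iff (by norm_num) |>.1 h3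
    have v0 : v = 0 := by rw [huv', u0]; ring
    have hE := exp_neg_sub_exp_neg hl0
    have k1 : G 1 0 * G 1 1 = 0 := by
      have : G 1 0 * G 1 1 * (Real.exp (-(l / 2)) - Real.exp (l / 2)) = 0 := by
        rw [u0, hY] at y10
        simp only [mul_entry, inv_entry_00, inv_entry_10, D, sl_00, sl_01, sl_10, sl_11] at y10
        linear_combination -y10
      exact (mul_eq_zero.1 this).resolve_right hE.ne
    have k2 : G 0 0 * G 0 1 = 0 := by
      have : G 0 0 * G 0 1 * (Real.exp (-(l / 2)) - Real.exp (l / 2)) = 0 := by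
        rw [v0, hY] at y01
        simp only [mul_entry, inv_entry_01, inv_entry_11, D, sl_00, sl_01, sl_10, sl_11] at y01
        linear_combination y01
      exact (mul_eq_zero.1 this).resolve_right hE.ne
    have hdG := det_entries G
    obtain ⟨n, hn⟩ := exists_tr_Gamma2 hg
    rw [← tr_conj' M, ← hG] at hn
    by_cases h00 : G 0 0 = 0
    · have h11 : G 1 1 = 0 := by
        refine (mul_eq_zero.1 k1).resolve_left fun h10 => ?_
        rw [h00, h10] at hdG; norm_num at hdG
      rw [tr, h00, h11] at hn
      have : (0 : ℤ) = 4 * n + 2 := by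
        have h3 : ((0 : ℤ) : ℝ) = ((4 * n + 2 : ℤ) : ℝ) := by push_cast; linarith
        exact_mod_cast h3
      omega
    · have h01 := (mul_eq_zero.1 k2).resolve_left h00
      have h10 : G 1 0 = 0 := by
        refine (mul_eq_zero.1 k1).resolve_right fun h11 => ?_
        rw [h01, h11] at hdG; norm_num at hdG
      obtain ⟨δ, hδ⟩ := exists_eq_D h01 h10
      have ht : t' = t + δ := by
        have : geo t' = geo (t + δ) := by
          rw [← hGt]
          rcases hδ with h | h
          · rw [h, D_smul_geo]
          · rw [h, neg_smul', D_smul_geo]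
        have := congrArg UpperHalfPlane.im this
        rwa [geo_im, geo_im, Real.exp_eq_exp] at this
      have htr : |(4 * n + 2 : ℝ)| = 2 * Real.cosh (δ / 2) := by
        rw [← hn]
        have := Real.cosh_pos (δ / 2)
        rcases hδ with h | h
        · rw [h, tr_D, abs_of_pos (by positivity)]
        · rw [h, tr_neg, tr_D, abs_neg, abs_of_pos (by positivity)]
      have c1 : 1 < Real.cosh (δ / 2) := by
        rw [Real.one_lt_cosh]
        intro h3
        apply hne
        linarith
      have c2 : Real.cosh (δ / 2) < 3 := by
        rw [← Real.cosh_arcosh (x := 3) (by norm_num), Real.cosh_lt_cosh, abs_div]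
        rw [ht, add_sub_cancel_left] at habs
        rw [abs_of_pos (by linarith : 0 < Real.arcosh 3)]
        norm_num
        linarith
      have h3 : (2 : ℝ) < |(4 * n + 2 : ℝ)| := by rw [htr]; linarith
      have h4 : |(4 * n + 2 : ℝ)| < 6 := by rw [htr]; linarith
      have h3' : (2 : ℤ) < |4 * n + 2| := by exact_mod_cast h3
      have h4' : |4 * n + 2| < (6 : ℤ) := by exact_mod_cast h4
      rw [abs_lt] at h4'
      rw [lt_abs] at h3'
      omega

theorem isometry_geo : Isometry geo := UpperHalfPlane.isometry_vertical_line 0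

theorem axisScale_pos : 0 < axisScale := by unfold axisScale; positivity

theorem axisFrame_smul_geo_re (t : ℝ) : (axisFrame • geo t).re =
    ((1 + √2) * Real.exp t ^ 2 + (1 - √2)) / (Real.exp t ^ 2 + 1) := by
  have h0 := denom_pos axisFrame (geo t)
  have hk := axisScale_pos
  rw [smul_re, div_eq_div_iff h0.ne' (by positivity)]
  simp only [axisFrame, sl_00, sl_01, sl_10, sl_11, geo_re, geo_im]
  ring

theorem axisFrame_smul_geo_im (t : ℝ) : (axisFrame • geo t).im =
    2 * √2 * Real.exp t / (Real.exp t ^ 2 + 1) := by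
  have h0 := denom_pos axisFrame (geo t)
  rw [smul_im, div_eq_div_iff h0.ne' (by positivity)]
  simp only [axisFrame, sl_10, sl_11, geo_re, geo_im]
  linear_combination -(Real.exp t * (Real.exp t ^ 2 + 1)) * axisScale_sq

/-- The self-intersection of the geodesic lifts to the points `i` and `2 + i`. -/
theorem U_smul_axisFrame : U 2 • axisFrame • geo (-(Real.arcosh 3 / 2)) =
    axisFrame • geo (Real.arcosh 3 / 2) := by
  have h2 : √2 ^ 2 = (2 : ℝ) := Real.sq_sqrt (by norm_num)
  have h1 := exp_half_arcosh_three
  have h1' : Real.exp (-(Real.arcosh 3 / 2)) = √2 - 1 := by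
    rw [Real.exp_neg, h1]
    exact inv_eq_of_mul_eq_one_right (by linear_combination h2)
  have e1 : (√2 - 1) ^ 2 + 1 ≠ 0 := by positivity
  have e2 : (1 + √2) ^ 2 + 1 ≠ 0 := by positivity
  apply UpperHalfPlane.ext_re_im
  · rw [U_smul_re, axisFrame_smul_geo_re, axisFrame_smul_geo_re, h1, h1', div_add' _ _ _ e1,
      div_eq_div_iff e1 e2]
    linear_combination 2 * (√2 ^ 2 - 2) * h2
  · rw [U_smul_im, axisFrame_smul_geo_im, axisFrame_smul_geo_im, h1, h1', div_eq_div_iff e1 e2]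
    linear_combination 4 * √2 * h2

/-- The projection of the axis of `!![5, 2; 2, 1]` has length `2 * arcosh 3` and one double point,
at the parameters `arcosh 3 / 2` and `3 * arcosh 3 / 2`. -/
theorem exists_length_eq {Γ : Subgroup SL(2, ℝ)} {N : SL(2, ℝ)} (hN : conjGroup Γ N = Gamma2) :
    ∃ c : ℝ → Surface Γ, IsClosedGeodesic Γ c (2 * Real.arcosh 3) ∧
      HasExactlyOneDoublePoint c (2 * Real.arcosh 3) := by
  set c : ℝ → Surface Γ := fun t => proj Γ (N • axisFrame • geo t) with hc
  have hpos : 0 < Real.arcosh 3 := Real.arcosh_pos (by norm_num)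
  set C : SL(2, ℝ) := sl 5 2 2 1 (by norm_num) with hCdef
  have hC : C ∈ Gamma2 := by
    refine ⟨2, 1, 1, 0, ?_, ?_, ?_, ?_⟩ <;> simp [hCdef]
    norm_num
  have hCt : ∀ t, C • axisFrame • geo t = axisFrame • geo (t + 2 * Real.arcosh 3) := by
    intro t
    rw [hCdef, ← axisFrame_conj, smul_smul, inv_mul_cancel_right, mul_smul, D_smul_geo]
  have hceq : ∀ t t', c t = c t' ↔ ∃ g ∈ Gamma2, g • axisFrame • geo t = axisFrame • geo t' := by
    intro t t'
    rw [hc, ← hN]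
    exact proj_smul_eq_iff
  refine ⟨c, ⟨by positivity, ⟨fun t => N • axisFrame • geo t, ?_, fun t => rfl⟩, ?_⟩, ?_⟩
  · exact (isometry_smul ℍ N).comp ((isometry_smul ℍ axisFrame).comp isometry_geo)
  · intro t
    exact ((hceq _ _).2 ⟨C, hC, hCt t⟩).symm
  · refine ⟨(Real.arcosh 3 / 2, 3 * (Real.arcosh 3 / 2)), ⟨by positivity, by simp only; linarith,
      by simp only; linarith, ?_⟩, ?_⟩
    · refine (hceq _ _).2 ⟨C * (U 2)⁻¹, mul_mem hC (inv_mem ?_), ?_⟩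
      · simpa using U_mem_Gamma2 1
      · rw [mul_smul, ← U_smul_axisFrame, inv_smul_smul, hCt]
        congr 2
        ring
    · rintro ⟨t, t'⟩ ⟨h0, h1, h2, h3⟩
      -- `eq_of_axis_meets` applied in both directions leaves two values for each parameter
      simp only at h0 h1 h2 h3
      obtain ⟨g, hg, h⟩ := (hceq _ _).1 h3
      have h' : g⁻¹ • axisFrame • geo t' = axisFrame • geo t := by rw [← h, inv_smul_smul]
      have c1 := eq_of_axis_meets hg h (by linarith) h2 h1.ne
        (by rw [abs_of_pos (by linarith)]; linarith)
      have c2 := eq_of_axis_meets (inv_mem hg) h' h0 (by linarith) h1.ne'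
        (by rw [abs_of_neg (by linarith)]; linarith)
      rcases c1 with c1 | c1 <;> rcases c2 with c2 | c2
      · linarith
      · linarith
      · rw [c1, c2]
      · linarith

/-! ### Holonomy of loops -/

/-- The loop `u` in `ℍ/Γ` lifts to a path from some `z` to `g • z`, with `g ∈ Γ`. -/
def HasHolonomy (Γ : Subgroup SL(2, ℝ)) (u : I → Surface Γ) (g : SL(2, ℝ)) : Prop :=
  g ∈ Γ ∧ ∃ F : C(I, ℍ), (∀ t, proj Γ (F t) = u t) ∧ F 1 = g • F 0

variable {Γ : Subgroup SL(2, ℝ)} {u v : I → Surface Γ} {g g' : SL(2, ℝ)}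

theorem HasHolonomy.of_freelyHomotopic (h : HasHolonomy Γ u g) (hΓ : IsSurfaceGroup Γ)
    (huv : FreelyHomotopic u v) : HasHolonomy Γ v g := by
  obtain ⟨hg, F, hF, hF1⟩ := h
  exact ⟨hg, huv.exists_lift hΓ hg hF hF1⟩

/-- The holonomy of a loop is unique up to conjugation and sign. -/
theorem HasHolonomy.unique (hΓ : IsSurfaceGroup Γ) (h : HasHolonomy Γ u g)
    (h' : HasHolonomy Γ u g') : ∃ k ∈ Γ, g' = k * g * k⁻¹ ∨ g' = -(k * g * k⁻¹) := by
  obtain ⟨hg, F, hF, hF1⟩ := h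
  obtain ⟨hg', F', hF', hF1'⟩ := h'
  obtain ⟨k, hk, e⟩ := hΓ.exists_smul_eq_of_lifts F.continuous F'.continuous
    (fun t => (hF t).trans (hF' t).symm)
  refine ⟨k, hk, ?_⟩
  have h1 : (k * g * k⁻¹) • F' 0 = g' • F' 0 := by
    rw [← hF1', e 1, hF1, e 0, mul_smul, mul_smul, inv_smul_smul]
  have h2 : (g' * (k * g * k⁻¹)⁻¹) • g' • F' 0 = g' • F' 0 := by
    conv_lhs => rw [← h1, mul_smul, inv_smul_smul]
  rcases hΓ.free _ (mul_mem hg' (inv_mem (mul_mem (mul_mem hk hg) (inv_mem hk)))) _ h2 with h3 | h3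
  · left
    exact mul_inv_eq_one.1 h3
  · right
    rw [mul_inv_eq_iff_eq_mul] at h3
    rw [h3, neg_one_mul]

theorem HasHolonomy.abs_tr_eq (hΓ : IsSurfaceGroup Γ) (h : HasHolonomy Γ u g)
    (h' : HasHolonomy Γ u g') : |tr g'| = |tr g| := by
  obtain ⟨k, -, e | e⟩ := h.unique hΓ h'
  · rw [e, tr_conj]
  · rw [e, tr_neg, abs_neg, tr_conj]

/-- The points of `ℍ` on the axis of `g` project to `S`. -/
def AxisProjectsTo (Γ : Subgroup SL(2, ℝ)) (g : SL(2, ℝ)) (S : Set (Surface Γ)) : Prop :=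
  ∀ z, side g z = 0 → proj Γ z ∈ S

theorem AxisProjectsTo.of_holonomy {S : Set (Surface Γ)} (hS : AxisProjectsTo Γ g S)
    (hΓ : IsSurfaceGroup Γ) (h : HasHolonomy Γ u g) (h' : HasHolonomy Γ u g') :
    AxisProjectsTo Γ g' S := by
  obtain ⟨k, hk, e⟩ := h.unique hΓ h'
  intro z hz
  have h0 : side (k * g * k⁻¹) z = 0 := by
    rcases e with e | e
    · rw [← e, hz]
    · rw [e, side_neg, neg_eq_zero] at hz; exact hz
  rw [← smul_inv_smul k z, side_smul] at h0
  have := hS _ h0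
  rwa [proj_smul (inv_mem hk)] at this

theorem IsClosedGeodesic.exists_hasHolonomy (hΓ : IsSurfaceGroup Γ) {c : ℝ → Surface Γ} {l : ℝ}
    (hc : IsClosedGeodesic Γ c l) : ∃ M g, (∀ r, c r = proj Γ (M • geo r)) ∧ g ∈ Γ ∧
      (g = M * D l * M⁻¹ ∨ g = -(M * D l * M⁻¹)) := by
  obtain ⟨M, hM, hD⟩ := hc.exists_frame hΓ 0
  rcases hD with h | h
  · exact ⟨M, _, by simpa using hM, h, Or.inl rfl⟩
  · exact ⟨M, _, by simpa using hM, h, Or.inr rfl⟩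

theorem side_eq_zero_of_conj_D {M : SL(2, ℝ)} {l : ℝ} (hl : 0 < l) {z : ℍ}
    (h : side (M * D l * M⁻¹) z = 0) : ∃ r, z = M • geo r := by
  rw [← smul_inv_smul M z, side_smul, side_D, div_eq_zero_iff] at h
  have h1 := (h.resolve_right (M⁻¹ • z).im_pos.ne')
  have h2 := (mul_eq_zero.1 h1).resolve_left (exp_neg_sub_exp_neg hl).ne
  exact ⟨_, by rw [← inv_smul_eq_iff]; exact eq_geo_of_re h2⟩

/-- A loop that runs exactly once around a simple closed curve winds once. -/
theorem lift_eq_add_or_sub {l : ℝ} (hl : 0 < l) {f : I → ℝ} (hf : Continuous f)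
    (hinj : ∀ s t : I, s ≠ 1 → t ≠ 1 → (∃ n : ℤ, f s = f t + n * l) → s = t)
    (h1 : ∃ n : ℤ, f 1 = f 0 + n * l) : f 1 = f 0 + l ∨ f 1 = f 0 - l := by
  obtain ⟨n, hn⟩ := h1
  have h01 : (0 : I) ≠ 1 := zero_ne_one
  by_cases n0 : n = 0
  · -- otherwise a value is taken before and after the parameter `1 / 2`
    exfalso
    rw [n0, Int.cast_zero, zero_mul, add_zero] at hn
    set h : I := ⟨1 / 2, by norm_num, by norm_num⟩ with hh
    have hh1 : h < 1 := by rw [← Subtype.coe_lt_coe, hh]; norm_num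
    have hh0 : 0 < h := by rw [← Subtype.coe_lt_coe, hh]; norm_num
    have hne : f h ≠ f 0 := fun e =>
      hh0.ne' (hinj h 0 hh1.ne h01 ⟨0, by rw [e]; simp⟩)
    set w := (f 0 + f h) / 2 with hw
    have hw0 : w ≠ f 0 := fun e => hne (by linarith)
    have hwh : w ≠ f h := fun e => hne (by linarith)
    have m1 : w ∈ Set.uIcc (f 0) (f h) := by
      rw [Set.mem_uIcc]
      rcases le_total (f 0) (f h) with h3 | h3
      · left; constructor <;> linarith
      · right; constructor <;> linarith
    have m2 : w ∈ Set.uIcc (f h) (f 1) := by rwa [hn, Set.uIcc_comm]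
    obtain ⟨t₁, ht₁, e₁⟩ := intermediate_value_uIcc hf.continuousOn m1
    obtain ⟨t₂, ht₂, e₂⟩ := intermediate_value_uIcc hf.continuousOn m2
    rw [Set.uIcc_of_le hh0.le] at ht₁
    rw [Set.uIcc_of_le hh1.le] at ht₂
    have h3 : t₂ ≠ 1 := by rintro rfl; exact hw0 (by rw [← e₂, hn])
    have h4 : t₁ ≠ 1 := (ht₁.2.trans_lt hh1).ne
    have h5 := hinj t₁ t₂ h4 h3 ⟨0, by rw [e₁, e₂]; simp⟩
    have h6 : t₁ = h := le_antisymm ht₁.2 (h5 ▸ ht₂.1)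
    exact hwh (by rw [← e₁, h6])
  · -- otherwise the starting point is met again
    by_contra hcon
    push Not at hcon
    have key : ∀ x : ℝ, (∃ m : ℤ, x = f 0 + m * l) → x ≠ f 0 → x ≠ f 1 →
        x ∉ Set.uIcc (f 0) (f 1) := by
      rintro x hm hx0 hx1 hx
      obtain ⟨t, -, rfl⟩ := intermediate_value_uIcc hf.continuousOn hx
      have ht1 : t ≠ 1 := by rintro rfl; exact hx1 rfl
      have := hinj t 0 ht1 h01 hm
      exact hx0 (by rw [this])
    rcases lt_or_gt_of_ne n0 with hneg | hpos
    · refine key (f 0 - l) ⟨-1, by push_cast; ring⟩ (by linarith) (Ne.symm hcon.2) ?_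
      have : (n : ℝ) ≤ -1 := by exact_mod_cast (by omega : n ≤ -1)
      rw [Set.mem_uIcc]
      right
      constructor <;> nlinarith
    · refine key (f 0 + l) ⟨1, by push_cast; ring⟩ (by linarith) (Ne.symm hcon.1) ?_
      have : (1 : ℝ) ≤ n := by exact_mod_cast (by omega : 1 ≤ n)
      rw [Set.mem_uIcc]
      left
      constructor <;> nlinarith

/-- The holonomy of a loop that runs exactly once around a simple closed geodesic. -/
theorem IsClosedGeodesic.tr_holonomy (hΓ : IsSurfaceGroup Γ) {c : ℝ → Surface Γ} {l : ℝ}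
    (hc : IsClosedGeodesic Γ c l) (hinj : Set.InjOn c (Set.Ico 0 l)) (hu : Continuous u)
    (hu1 : u 1 = u 0) (hui : ∀ s t : I, s ≠ 1 → t ≠ 1 → u s = u t → s = t)
    (hur : ∀ t, u t ∈ Set.range c) (hg : HasHolonomy Γ u g) :
    |tr g| = 2 * Real.cosh (l / 2) ∧ AxisProjectsTo Γ g (Set.range c) := by
  obtain ⟨M, k, hM, hk, hkM⟩ := hc.exists_hasHolonomy hΓ
  have hl := hc.pos
  have : Fact (0 < l) := ⟨hl⟩
  have := hΓ.t2Space
  have hcc : Continuous c := by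
    have : c = fun r => proj Γ (M • geo r) := funext hM
    rw [this]
    exact (continuous_proj Γ).comp (continuous_geo.const_smul M)
  -- the curve factors through the circle
  set e : AddCircle l → Surface Γ := hc.periodic.lift with he
  have hec : Continuous e := continuous_coinduced_dom.2 hcc
  have hei : Function.Injective e := by
    intro x y hxy
    obtain ⟨a, ha, rfl⟩ : ∃ a ∈ Set.Ico (0 : ℝ) l, (a : AddCircle l) = x := by
      have := AddCircle.coe_image_Ico_eq l 0
      rw [zero_add] at this
      have hx : x ∈ ((↑) : ℝ → AddCircle l) '' Set.Ico 0 l := by rw [this]; trivial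
      exact hx
    obtain ⟨b, hb, rfl⟩ : ∃ a ∈ Set.Ico (0 : ℝ) l, (a : AddCircle l) = y := by
      have := AddCircle.coe_image_Ico_eq l 0
      rw [zero_add] at this
      have hx : y ∈ ((↑) : ℝ → AddCircle l) '' Set.Ico 0 l := by rw [this]; trivial
      exact hx
    rw [hinj ha hb hxy]
  have hemb : Topology.IsClosedEmbedding e := hec.isClosedEmbedding hei
  have hrange : ∀ t, u t ∈ Set.range e := by
    intro t
    obtain ⟨r, hr⟩ := hur t
    exact ⟨r, hr⟩
  choose κ hκ using hrange
  have hκc : Continuous κ := by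
    rw [hemb.isEmbedding.continuous_iff]
    convert hu using 1
    exact funext hκ
  obtain ⟨f, hf⟩ : ∃ f : C(I, ℝ), ∀ t, ((f t : ℝ) : AddCircle l) = κ t := by
    obtain ⟨r, hr⟩ := QuotientAddGroup.mk_surjective (κ 0)
    obtain ⟨f, h1, -⟩ := (AddCircle.isCoveringMap_coe l).exists_path_lifts ⟨κ, hκc⟩ r hr.symm
    exact ⟨f, fun t => congrFun h1 t⟩
  have hcf : ∀ t, c (f t) = u t := fun t => by
    rw [← hκ, ← hf]; rfl
  have hcoe : ∀ x y : ℝ, (x : AddCircle l) = y ↔ ∃ n : ℤ, x = y + n * l := by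
    intro x y
    rw [← sub_eq_zero, ← AddCircle.coe_sub, AddCircle.coe_eq_zero_iff]
    constructor
    · rintro ⟨n, hn⟩
      exact ⟨n, by rw [zsmul_eq_mul] at hn; linarith⟩
    · rintro ⟨n, hn⟩
      exact ⟨n, by rw [zsmul_eq_mul]; linarith⟩
  have hwind := lift_eq_add_or_sub hl f.continuous (fun s t hs ht h => by
      apply hui s t hs ht
      rw [← hκ, ← hκ, ← hf, ← hf, (hcoe _ _).2 h]) (by
    rw [← hcoe, hf, hf]
    apply hei
    rw [hκ, hκ, hu1])
  -- the lift along the geodesic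
  have key : ∀ X : SL(2, ℝ), X ∈ Γ → |tr X| = 2 * Real.cosh (l / 2) →
      AxisProjectsTo Γ X (Set.range c) → M • geo (f 1) = X • M • geo (f 0) →
      |tr g| = 2 * Real.cosh (l / 2) ∧ AxisProjectsTo Γ g (Set.range c) := by
    intro X hX ht ha h1
    have hXu : HasHolonomy Γ u X := by
      refine ⟨hX, ⟨fun t => M • geo (f t), ?_⟩, fun t => ?_, h1⟩
      · exact (continuous_geo.comp f.continuous).const_smul M
      · rw [← hcf, hM]; rfl
    exact ⟨by rw [hXu.abs_tr_eq hΓ hg, ht], ha.of_holonomy hΓ hXu hg⟩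
  have htk : |tr k| = 2 * Real.cosh (l / 2) := by
    have := Real.cosh_pos (l / 2)
    rcases hkM with h | h
    · rw [h, tr_conj, tr_D, abs_of_pos (by positivity)]
    · rw [h, tr_neg, tr_conj, tr_D, abs_neg, abs_of_pos (by positivity)]
  have hak : AxisProjectsTo Γ k (Set.range c) := by
    intro z hz
    have h0 : side (M * D l * M⁻¹) z = 0 := by
      rcases hkM with h | h
      · rw [← h, hz]
      · rw [h, side_neg, neg_eq_zero] at hz; exact hz
    obtain ⟨r, rfl⟩ := side_eq_zero_of_conj_D hl h0
    exact ⟨r, hM r⟩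
  have hks : ∀ r, k • M • geo r = M • geo (r + l) := by
    intro r
    rw [← D_smul_geo]
    rcases hkM with h | h
    · rw [h, mul_smul, mul_smul, inv_smul_smul]
    · rw [h, neg_smul', mul_smul, mul_smul, inv_smul_smul]
  rcases hwind with h | h
  · exact key k hk htk hak (by rw [h, hks])
  · refine key k⁻¹ (inv_mem hk) (by rw [tr_inv, htk]) (fun z hz => hak z ?_) ?_
    · rw [side_inv, neg_eq_zero] at hz; exact hz
    · rw [h, eq_inv_smul_iff, hks, sub_add_cancel]

theorem sq_tr_of_isParabolic (hg : (g : Matrix (Fin 2) (Fin 2) ℝ).IsParabolic) :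
    tr g ^ 2 = 4 := by
  have h := hg.2
  rw [Matrix.discr_fin_two, Matrix.trace_fin_two, g.det_coe] at h
  rw [tr]
  linarith

theorem abs_tr_of_isParabolic (hg : (g : Matrix (Fin 2) (Fin 2) ℝ).IsParabolic) :
    |tr g| = 2 := by
  rw [← abs_of_pos (by norm_num : (0 : ℝ) < 2), ← sq_eq_sq_iff_abs_eq_abs,
    sq_tr_of_isParabolic hg]
  norm_num

/-- The form of a parabolic element is semidefinite, so its axis is empty. -/
theorem side_ne_zero_of_isParabolic (hg : (g : Matrix (Fin 2) (Fin 2) ℝ).IsParabolic) (z : ℍ) :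
    side g z ≠ 0 := by
  intro h
  have ht := sq_tr_of_isParabolic hg
  have hd := det_entries g
  rw [tr] at ht
  rw [side, div_eq_zero_iff] at h
  have h0 := h.resolve_right z.im_pos.ne'
  have hsq : (g 1 0 * z.re + (g 1 1 - g 0 0) / 2) ^ 2 + (g 1 0 * z.im) ^ 2 = 0 := by
    linear_combination g 1 0 * h0 + ht / 4 - hd
  have hc : g 1 0 = 0 := by
    have : (g 1 0 * z.im) ^ 2 = 0 := by
      nlinarith [sq_nonneg (g 1 0 * z.re + (g 1 1 - g 0 0) / 2), sq_nonneg (g 1 0 * z.im)]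
    have := pow_eq_zero_iff (by norm_num) |>.1 this
    exact (mul_eq_zero.1 this).resolve_right z.im_pos.ne'
  have hda : g 1 1 = g 0 0 := by
    rw [hc] at hsq
    have : ((g 1 1 - g 0 0) / 2) ^ 2 = 0 := by linarith
    have := pow_eq_zero_iff (by norm_num) |>.1 this
    linarith
  have hb : g 0 1 = 0 := by
    rw [hc, hda] at h0
    linarith
  refine hg.1 ⟨g 0 0, ?_⟩
  ext i j
  fin_cases i <;> fin_cases j <;> simp [hc, hda, hb]

/-! ### Loops in the three-holed sphere -/

theorem mem_pantsModel_of_le {J : Set (Fin 3)} {z : ℂ} (h₂ : ‖z‖ ≤ 3) (h₀ : 1 / 2 ≤ ‖z + 1‖)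
    (h₁ : 1 / 2 ≤ ‖z - 1‖) (hJ : ∀ i ∈ J, z ∉ holeCircle i) : z ∈ pantsModel J := by
  refine ⟨⟨by simpa using h₂, ?_⟩, ?_⟩
  · simp only [Set.mem_union, Metric.mem_ball, dist_eq_norm, sub_neg_eq_add]
    rintro (h | h) <;> linarith
  · simpa using hJ

theorem mem_holeCircle_zero {z : ℂ} : z ∈ holeCircle 0 ↔ ‖z + 1‖ = 1 / 2 := by
  simp [holeCircle]

theorem mem_holeCircle_one {z : ℂ} : z ∈ holeCircle 1 ↔ ‖z - 1‖ = 1 / 2 := by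
  simp [holeCircle]

theorem mem_holeCircle_two {z : ℂ} : z ∈ holeCircle 2 ↔ ‖z‖ = 3 := by
  simp [holeCircle]

/-- The centre of the circle parametrised by the loop around a hole. -/
def holeCenter : Fin 3 → ℂ := ![-1, 1, 0]

/-- The point of the circle of radius `ρ` parallel to a hole, in the parametrisation of
`holeLoop`. -/
def holeParam (i : Fin 3) (ρ : ℝ) (t : I) : ℂ :=
  holeCenter i + ρ * ((![1, -1, 1] : Fin 3 → ℂ) i * unitCircle t)

/-- The radius of a boundary circle. -/
def holeRadius : Fin 3 → ℝ := ![1 / 2, 1 / 2, 3]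

/-- The radius of the loop around a hole. -/
def loopRadius : Fin 3 → ℝ := ![1, 1, 5 / 2]

theorem holeLoop_eq (J : Set (Fin 3)) (i : Fin 3) (t : I) :
    (holeLoop J i t : ℂ) = holeParam i (loopRadius i) t := by
  fin_cases i
  · simp [holeLoop, holeParam, holeCenter, loopRadius, loopA]
  · simp [holeLoop, holeParam, holeCenter, loopRadius, loopB]; ring
  · simp [holeLoop, holeParam, holeCenter, loopRadius, loopC]

theorem norm_holeParam_sub (i : Fin 3) {ρ : ℝ} (hρ : 0 ≤ ρ) (t : I) :
    ‖holeParam i ρ t - holeCenter i‖ = ρ := by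
  rw [holeParam, add_sub_cancel_left, norm_mul, norm_mul, norm_unitCircle, Complex.norm_real,
    Real.norm_of_nonneg hρ]
  fin_cases i <;> simp

theorem holeParam_mem_holeCircle (i : Fin 3) (t : I) :
    holeParam i (holeRadius i) t ∈ holeCircle i := by
  have h := norm_holeParam_sub i (ρ := holeRadius i)
    (by fin_cases i <;> norm_num [holeRadius]) t
  fin_cases i
  · rw [show ((⟨0, by norm_num⟩ : Fin 3)) = 0 from rfl, mem_holeCircle_zero] at *
    simpa [holeCenter, holeRadius] using h
  · rw [show ((⟨1, by norm_num⟩ : Fin 3)) = 1 from rfl, mem_holeCircle_one] at *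
    simpa [holeCenter, holeRadius] using h
  · rw [show ((⟨2, by norm_num⟩ : Fin 3)) = 2 from rfl, mem_holeCircle_two] at *
    simpa [holeCenter, holeRadius] using h

theorem continuous_holeParam (i : Fin 3) : Continuous fun p : ℝ × I => holeParam i p.1 p.2 := by
  have := continuous_unitCircle
  unfold holeParam
  fun_prop

/-- The circles between the loop around a hole and the boundary circle lie in the pair of
pants. -/
theorem holeParam_mem_pantsModel {J : Set (Fin 3)} {i : Fin 3} (hi : i ∉ J) {ρ : ℝ}
    (hρ : ρ ∈ segment ℝ (loopRadius i) (holeRadius i)) (t : I) :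
    holeParam i ρ t ∈ pantsModel J := by
  rw [segment_eq_uIcc] at hρ
  have hn := norm_holeParam_sub i (ρ := ρ) (by
    have : (0 : ℝ) ≤ min (loopRadius i) (holeRadius i) := by
      fin_cases i <;> norm_num [loopRadius, holeRadius]
    exact this.trans hρ.1) t
  generalize holeParam i ρ t = z at hn
  fin_cases i
  · simp [loopRadius, holeRadius] at hρ
    rw [Set.uIcc_of_ge (by norm_num)] at hρ
    obtain ⟨h1, h2⟩ := hρ
    simp [holeCenter] at hn
    have e1 := norm_add_le (z + 1) (-1)
    have e2 := norm_sub_le (z + 1) (z - 1)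
    ring_nf at e1 e2
    rw [show (1 : ℂ) + z = z + 1 by ring, hn] at e1 e2
    rw [show (-1 : ℂ) + z = z - 1 by ring] at e2
    norm_num at e1 e2
    refine mem_pantsModel_of_le (by linarith) (by linarith) (by linarith) fun j hj hz => ?_
    fin_cases j
    · exact hi hj
    · have := mem_holeCircle_one.1 hz; linarith
    · have := mem_holeCircle_two.1 hz; linarith
  · simp [loopRadius, holeRadius] at hρ
    rw [Set.uIcc_of_ge (by norm_num)] at hρ
    obtain ⟨h1, h2⟩ := hρ
    simp [holeCenter] at hn
    have e1 := norm_add_le (z - 1) 1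
    have e2 := norm_sub_le (z + 1) (z - 1)
    ring_nf at e1 e2
    rw [show (-1 : ℂ) + z = z - 1 by ring, hn] at e1 e2
    rw [show (1 : ℂ) + z = z + 1 by ring] at e2
    norm_num at e1 e2
    refine mem_pantsModel_of_le (by linarith) (by linarith) (by linarith) fun j hj hz => ?_
    fin_cases j
    · have := mem_holeCircle_zero.1 hz; linarith
    · exact hi hj
    · have := mem_holeCircle_two.1 hz; linarith
  · simp [loopRadius, holeRadius] at hρ
    rw [Set.uIcc_of_le (by norm_num)] at hρ
    obtain ⟨h1, h2⟩ := hρ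
    simp [holeCenter] at hn
    have e1 := norm_sub_le (z + 1) 1
    have e2 := norm_add_le (z - 1) 1
    rw [add_sub_cancel_right, hn] at e1
    rw [sub_add_cancel, hn] at e2
    norm_num at e1 e2
    refine mem_pantsModel_of_le (by linarith) (by linarith) (by linarith) fun j hj hz => ?_
    fin_cases j
    · have := mem_holeCircle_zero.1 hz; linarith
    · have := mem_holeCircle_one.1 hz; linarith
    · exact hi hj

/-- The parametrisation of a boundary circle that is not deleted. -/
def boundaryLoop {J : Set (Fin 3)} {i : Fin 3} (hi : i ∉ J) (t : I) : pantsModel J :=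
  ⟨holeParam i (holeRadius i) t, holeParam_mem_pantsModel hi (right_mem_segment ..) t⟩

theorem holeLoop_freelyHomotopic {J : Set (Fin 3)} {i : Fin 3} (hi : i ∉ J) :
    FreelyHomotopic (holeLoop J i) (boundaryLoop hi) := by
  have hm : ∀ s : I, (AffineMap.lineMap (loopRadius i) (holeRadius i) (s : ℝ) : ℝ) ∈
      segment ℝ (loopRadius i) (holeRadius i) := fun s => by
    rw [segment_eq_image_lineMap]
    exact ⟨s, s.2, rfl⟩
  refine ⟨⟨fun p => ⟨_, holeParam_mem_pantsModel hi (hm p.1) p.2⟩, ?_⟩, fun t => ?_, fun t => ?_,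
    fun s => ?_⟩
  · refine Continuous.subtype_mk ?_ _
    refine (continuous_holeParam i).comp (Continuous.prodMk ?_ continuous_snd)
    exact AffineMap.lineMap_continuous.comp (continuous_subtype_val.comp continuous_fst)
  · apply Subtype.ext
    rw [holeLoop_eq]
    simp
  · apply Subtype.ext
    simp [boundaryLoop]
  · apply Subtype.ext
    simp [holeParam, unitCircle_zero, unitCircle_one]

theorem unitCircle_injective {s t : I} (hs : s ≠ 1) (ht : t ≠ 1)
    (h : unitCircle s = unitCircle t) : s = t := by
  rw [unitCircle, unitCircle, Complex.exp_eq_exp_iff_exists_int] at h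
  obtain ⟨n, hn⟩ := h
  have hpi : (2 * Real.pi * Complex.I : ℂ) ≠ 0 := by
    simp [Real.pi_ne_zero]
  have h1 : ((s : ℝ) : ℂ) = (t : ℝ) + n := by
    apply mul_left_cancel₀ hpi
    linear_combination hn
  have h2 : (s : ℝ) = t + n := by exact_mod_cast h1
  have s0 := s.2.1
  have t0 := t.2.1
  have s1 : (s : ℝ) < 1 := lt_of_le_of_ne s.2.2 fun e => hs (Subtype.ext e)
  have t1 : (t : ℝ) < 1 := lt_of_le_of_ne t.2.2 fun e => ht (Subtype.ext e)
  have h3 : (n : ℝ) < 1 := by linarith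
  have h4 : (-1 : ℝ) < n := by linarith
  have h5 : n < 1 := by exact_mod_cast h3
  have h6 : -1 < n := by exact_mod_cast h4
  have : n = 0 := by omega
  apply Subtype.ext
  rw [h2, this]
  simp

theorem boundaryLoop_injective {J : Set (Fin 3)} {i : Fin 3} (hi : i ∉ J) {s t : I} (hs : s ≠ 1)
    (ht : t ≠ 1) (h : boundaryLoop hi s = boundaryLoop hi t) : s = t := by
  apply unitCircle_injective hs ht
  have h1 := congrArg Subtype.val h
  simp only [boundaryLoop, holeParam] at h1
  have h2 := add_left_cancel h1
  have h3 : ((holeRadius i : ℝ) : ℂ) ≠ 0 := by fin_cases i <;> simp [holeRadius]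
  have h4 := mul_left_cancel₀ h3 h2
  refine mul_left_cancel₀ ?_ h4
  fin_cases i <;> simp

/-- The points of `a * b` in polar coordinates. -/
theorem loopA_trans_loopB_eq (J : Set (Fin 3)) (t : I) :
    (((loopA J).trans (loopB J) t : pantsModel J) : ℂ) =
      2 * |Real.sin (2 * Real.pi * t)| * Complex.I * unitCircle t := by
  have key : ∀ φ : ℝ, Complex.exp ((2 * φ : ℝ) * Complex.I) - 1 =
      2 * Real.sin φ * Complex.I * Complex.exp (φ * Complex.I) := by
    intro φ
    apply Complex.ext
    · rw [Complex.sub_re, Complex.exp_ofReal_mul_I_re, Complex.exp_mul_I]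
      simp [← Complex.ofReal_cos, ← Complex.ofReal_sin, Real.cos_two_mul]
      nlinarith [Real.sin_sq_add_cos_sq φ]
    · rw [Complex.sub_im, Complex.exp_ofReal_mul_I_im, Complex.exp_mul_I]
      simp [← Complex.ofReal_cos, ← Complex.ofReal_sin, Real.sin_two_mul]
  have k := key (2 * Real.pi * t)
  have e : unitCircle t = Complex.exp ((2 * Real.pi * t : ℝ) * Complex.I) := by
    rw [unitCircle]; push_cast; rfl
  rw [Path.trans_apply]
  split_ifs with ht
  · have hs : 0 ≤ Real.sin (2 * Real.pi * t) := by
      apply Real.sin_nonneg_of_nonneg_of_le_pi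
      · have := t.2.1; positivity
      · nlinarith [Real.pi_pos]
    rw [abs_of_nonneg hs, e, ← k]
    simp only [loopA, Path.coe_mk_mk, unitCircle]
    push_cast
    ring_nf
  · push Not at ht
    have hs : Real.sin (2 * Real.pi * t) ≤ 0 := by
      rw [← Real.sin_sub_two_pi]
      apply Real.sin_nonpos_of_nonpos_of_neg_pi_le
      · have := t.2.2; nlinarith [Real.pi_pos]
      · nlinarith [Real.pi_pos]
    rw [abs_of_nonpos hs, e]
    simp only [loopB, Path.coe_mk_mk, unitCircle]
    have h2 : Complex.exp (2 * Real.pi * ((2 * t - 1 : ℝ) : ℂ) * Complex.I) =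
        Complex.exp ((2 * (2 * Real.pi * t) : ℝ) * Complex.I) := by
      rw [Complex.exp_eq_exp_iff_exists_int]
      exact ⟨-1, by push_cast; ring⟩
    rw [h2]
    push_cast at k ⊢
    linear_combination -k

theorem mem_pantsModel_polar {J : Set (Fin 3)} {ρ : ℝ} {t : I} (h0 : ρ ≤ 5 / 2)
    (h1 : 2 * |Real.sin (2 * Real.pi * t)| ≤ ρ) :
    (ρ * Complex.I * unitCircle t : ℂ) ∈ pantsModel J := by
  have hρ : 0 ≤ ρ := le_trans (by positivity) h1
  have e : unitCircle t = Complex.exp ((2 * Real.pi * t : ℝ) * Complex.I) := by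
    rw [unitCircle]; push_cast; rfl
  set φ := 2 * Real.pi * (t : ℝ) with hφ
  have hre : (ρ * Complex.I * unitCircle t : ℂ).re = -ρ * Real.sin φ := by
    rw [mul_assoc, Complex.re_ofReal_mul, e, Complex.I_mul_re, Complex.exp_ofReal_mul_I_im]
    ring
  have him : (ρ * Complex.I * unitCircle t : ℂ).im = ρ * Real.cos φ := by
    rw [mul_assoc, Complex.im_ofReal_mul, e, Complex.I_mul_im, Complex.exp_ofReal_mul_I_re]
  have hcs := Real.sin_sq_add_cos_sq φ
  have ha := abs_le.1 (le_refl |Real.sin φ|)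
  have k1 : 0 ≤ ρ * (ρ - 2 * Real.sin φ) := mul_nonneg hρ (by linarith)
  have k2 : 0 ≤ ρ * (ρ + 2 * Real.sin φ) := mul_nonneg hρ (by linarith)
  have k3 : ρ ^ 2 * Real.sin φ ^ 2 + ρ ^ 2 * Real.cos φ ^ 2 = ρ ^ 2 := by
    rw [← mul_add, hcs, mul_one]
  refine mem_pantsModel ?_ ?_ ?_
  · rw [norm_mul, norm_mul, norm_unitCircle, Complex.norm_real, Real.norm_of_nonneg hρ]
    norm_num
    linarith
  · refine lt_of_lt_of_le (by norm_num : (1 / 2 : ℝ) < 1) ?_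
    rw [← one_le_sq_iff₀ (norm_nonneg _), Complex.sq_norm, Complex.normSq_apply]
    simp only [Complex.add_re, Complex.add_im, hre, him, Complex.one_re, Complex.one_im]
    linarith
  · refine lt_of_lt_of_le (by norm_num : (1 / 2 : ℝ) < 1) ?_
    rw [← one_le_sq_iff₀ (norm_nonneg _), Complex.sq_norm, Complex.normSq_apply]
    simp only [Complex.sub_re, Complex.sub_im, hre, him, Complex.one_re, Complex.one_im]
    linarith

/-- The loop `loopC` turned by a quarter of a turn. -/
def loopCTurned (J : Set (Fin 3)) (t : I) : pantsModel J :=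
  ⟨(5 / 2 : ℝ) * Complex.I * unitCircle t, mem_pantsModel_polar le_rfl (by
    have := Real.abs_sin_le_one (2 * Real.pi * t); linarith)⟩

/-- The loop `a * b` is pushed radially outwards to the circle of radius `5 / 2`. -/
theorem loopA_trans_loopB_freelyHomotopic (J : Set (Fin 3)) :
    FreelyHomotopic (fun t => (loopA J).trans (loopB J) t) (loopCTurned J) := by
  have hs : ∀ t : I, 2 * |Real.sin (2 * Real.pi * t)| ≤ 5 / 2 := fun t => by
    have := Real.abs_sin_le_one (2 * Real.pi * t); linarith
  refine ⟨⟨fun p => ⟨(AffineMap.lineMap (2 * |Real.sin (2 * Real.pi * p.2)|) (5 / 2 : ℝ)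
    (p.1 : ℝ) : ℝ) * Complex.I * unitCircle p.2, mem_pantsModel_polar ?_ ?_⟩, ?_⟩, fun t => ?_,
    fun t => ?_, fun s => ?_⟩
  · have h1 := hs p.2
    have h2 := p.1.2.1
    have h3 := p.1.2.2
    rw [AffineMap.lineMap_apply_module]
    simp only [smul_eq_mul]
    nlinarith
  · have h1 := hs p.2
    have h2 := p.1.2.1
    have h3 := p.1.2.2
    rw [AffineMap.lineMap_apply_module]
    simp only [smul_eq_mul]
    nlinarith
  · have := continuous_unitCircle
    simp only [AffineMap.lineMap_apply_module]
    refine Continuous.subtype_mk ?_ _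
    fun_prop
  · apply Subtype.ext
    rw [loopA_trans_loopB_eq]
    simp
  · apply Subtype.ext
    simp [loopCTurned]
  · apply Subtype.ext
    simp [unitCircle_zero, unitCircle_one]

theorem loopCTurned_freelyHomotopic (J : Set (Fin 3)) :
    FreelyHomotopic (loopCTurned J) (loopC J) := by
  have hm : ∀ s t : I, (5 / 2 * (Complex.exp (((1 - s) * (Real.pi / 2) : ℝ) * Complex.I) *
      unitCircle t) : ℂ) ∈ pantsModel J := by
    intro s t
    have h5 : ‖(5 / 2 * (Complex.exp (((1 - s) * (Real.pi / 2) : ℝ) * Complex.I) *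
      unitCircle t) : ℂ)‖ = 5 / 2 := by
      rw [norm_mul, norm_mul, norm_unitCircle, Complex.norm_exp_ofReal_mul_I]; norm_num
    generalize (5 / 2 * (Complex.exp (((1 - s) * (Real.pi / 2) : ℝ) * Complex.I) *
      unitCircle t) : ℂ) = z at h5
    have e1 := norm_sub_le (z + 1) 1
    have e2 := norm_add_le (z - 1) 1
    rw [add_sub_cancel_right, h5] at e1
    rw [sub_add_cancel, h5] at e2
    norm_num at e1 e2
    exact mem_pantsModel (by rw [h5]; norm_num) (by linarith) (by linarith)
  refine ⟨⟨fun p => ⟨_, hm p.1 p.2⟩, ?_⟩, fun t => ?_, fun t => ?_, fun s => ?_⟩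
  · have := continuous_unitCircle
    refine Continuous.subtype_mk ?_ _
    fun_prop
  · apply Subtype.ext
    have := Complex.exp_pi_div_two_mul_I 
    simp only [loopCTurned, Set.Icc.coe_zero, sub_zero, one_mul, ContinuousMap.coe_mk]
    push_cast
    rw [this]
    ring
  · apply Subtype.ext
    simp [loopC]
  · apply Subtype.ext
    simp [unitCircle_zero, unitCircle_one]

/-! ### Holonomy of a pair of pants -/

/-- The loop `u` in `ℍ/Γ` lifts to a path from `z` to `g • z`, with `g ∈ Γ`. -/
def HasHolonomyAt (Γ : Subgroup SL(2, ℝ)) (z : ℍ) (u : I → Surface Γ) (g : SL(2, ℝ)) : Prop :=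
  g ∈ Γ ∧ ∃ F : Path z (g • z), ∀ t, proj Γ (F t) = u t

section

variable {Γ : Subgroup SL(2, ℝ)} {z : ℍ} {x : Surface Γ} {p q : Path x x} {A B : SL(2, ℝ)}

theorem HasHolonomyAt.hasHolonomy {u : I → Surface Γ} (h : HasHolonomyAt Γ z u A) :
    HasHolonomy Γ u A := by
  obtain ⟨hA, F, hF⟩ := h
  exact ⟨hA, F.toContinuousMap, hF, by simp⟩

/-- A lift of `q` is translated by `A` to continue the lift of `p`. -/
theorem HasHolonomyAt.trans (hp : HasHolonomyAt Γ z p A) (hq : HasHolonomyAt Γ z q B) :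
    HasHolonomyAt Γ z (p.trans q) (A * B) := by
  obtain ⟨hA, F, hF⟩ := hp
  obtain ⟨hB, G, hG⟩ := hq
  refine ⟨mul_mem hA hB,
    (F.trans (G.map (continuous_const_smul A))).cast rfl (mul_smul A B z), fun t => ?_⟩
  rw [Path.cast_coe, Path.trans_apply, Path.trans_apply]
  split_ifs
  · exact hF _
  · rw [Path.map_coe, Function.comp_apply, proj_smul hA]
    exact hG _

theorem HasHolonomyAt.symm (hp : HasHolonomyAt Γ z p A) : HasHolonomyAt Γ z p.symm A⁻¹ := by
  obtain ⟨hA, F, hF⟩ := hp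
  refine ⟨inv_mem hA, (F.symm.map (continuous_const_smul A⁻¹)).cast
    (inv_smul_smul A z).symm rfl, fun t => ?_⟩
  rw [Path.cast_coe, Path.map_coe, Function.comp_apply, proj_smul (inv_mem hA), Path.symm_apply,
    Path.symm_apply]
  exact hF _

theorem IsSurfaceGroup.exists_hasHolonomyAt (hΓ : IsSurfaceGroup Γ) (p : Path x x)
    (hz : proj Γ z = x) : ∃ A, HasHolonomyAt Γ z p A := by
  obtain ⟨F, h0, hF⟩ := hΓ.exists_path_lift p.continuous (z := z) (by simpa using hz)
  obtain ⟨A, hA, e⟩ := proj_eq_iff.1 (show proj Γ z = proj Γ (F 1) by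
    rw [hz, hF]; simp)
  exact ⟨A, hA, ⟨F, h0, e.symm⟩, hF⟩

/-- If no translate of the chosen generating paths meets the axis of `X`, then the orbit of the
base point stays on one side of it. -/
theorem side_mul_side_pos {X : SL(2, ℝ)} {T : Set (Surface Γ)} (hX : AxisProjectsTo Γ X T)
    (hA : HasHolonomyAt Γ z p A) (hB : HasHolonomyAt Γ z q B) (hp : ∀ t, p t ∉ T)
    (hq : ∀ t, q t ∉ T) : ∀ g ∈ Subgroup.closure ({A, B} : Set SL(2, ℝ)),
      0 < side X z * side X (g • z) := by
  have key : ∀ (r : Path x x) (C : SL(2, ℝ)), HasHolonomyAt Γ z r C → (∀ t, r t ∉ T) →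
      ∀ g ∈ Γ, 0 < side X (g • z) * side X ((g * C) • z) := by
    rintro r C ⟨hC, F, hF⟩ hr g hg
    have := mul_pos_of_isPreconnected (f := fun t => side X (g • F t)) (S := Set.univ)
      isPreconnected_univ
      ((continuous_side X).comp (F.continuous.const_smul g))
      (fun t _ h => hr t (by rw [← hF t, ← proj_smul hg]; exact hX _ h))
      (Set.mem_univ 0) (Set.mem_univ 1)
    simpa [mul_smul] using this
  have hcomb : ∀ a b c : ℝ, 0 < a * b → 0 < b * c → 0 < a * c := by
    intro a b c h1 h2
    rcases pos_and_pos_or_neg_and_neg_of_mul_pos h1 with ⟨ha, hb⟩ | ⟨ha, hb⟩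
    · exact mul_pos ha (pos_of_mul_pos_right h2 hb.le)
    · exact mul_pos_of_neg_of_neg ha (neg_of_mul_pos_right h2 hb.le)
  have hne : side X z ≠ 0 := fun h => hp 0 (by
    rw [p.source]
    obtain ⟨hA, F, hF⟩ := hA
    have := hF 0
    rw [F.source, p.source] at this
    rw [← this]; exact hX z h)
  have hle : Subgroup.closure ({A, B} : Set SL(2, ℝ)) ≤ Γ := by
    rw [Subgroup.closure_le]
    rintro g (rfl | rfl)
    exacts [hA.1, hB.1]
  have step : ∀ C ∈ ({A, B} : Set SL(2, ℝ)), ∀ g ∈ Γ,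
      0 < side X (g • z) * side X ((g * C) • z) := by
    rintro C (rfl | rfl)
    exacts [key p _ hA hp, key q _ hB hq]
  intro g hg
  induction hg using Subgroup.closure_induction_right with
  | one => rw [one_smul]; exact mul_self_pos.2 hne
  | mul_right g hg C hC ih => exact hcomb _ _ _ ih (step C hC g (hle hg))
  | mul_inv_cancel g hg C hC ih =>
    refine hcomb _ _ _ ih ?_
    have h := step C hC (g * C⁻¹) (mul_mem (hle hg) (inv_mem (hle (Subgroup.subset_closure hC))))
    rwa [inv_mul_cancel_right, mul_comm] at h

end

section

variable {Γ : Subgroup SL(2, ℝ)} {J : Set (Fin 3)} {h : pantsModel J → Surface Γ}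
  {L : Fin 3 → ℝ} {A B X : SL(2, ℝ)} {z : ℍ}

/-- The holonomy of the loop around a hole, and its axis. -/
theorem IsPairOfPants.tr_holonomy (hP : IsPairOfPants Γ J h L) (hΓ : IsSurfaceGroup Γ) (i : Fin 3)
    (hX : HasHolonomy Γ (h ∘ holeLoop J i) X) : |tr X| = 2 * Real.cosh (L i / 2) ∧
      AxisProjectsTo Γ X (h '' {z | (z : ℂ) ∈ holeCircle i}) := by
  have hh := hP.isClosedEmbedding
  by_cases hi : i ∈ J
  · obtain ⟨⟨w, g, hw, hg, hwg, hpar⟩, hL⟩ := hP.cusp i hi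
    have hu : HasHolonomy Γ (h ∘ holeLoop J i) g := ⟨hg, w, hw, hwg⟩
    refine ⟨?_, AxisProjectsTo.of_holonomy (fun z hz => ?_) hΓ hu hX⟩
    · rw [hu.abs_tr_eq hΓ hX, abs_tr_of_isParabolic hpar, hL]
      simp
    · exact absurd hz (side_ne_zero_of_isParabolic hpar z)
  · obtain ⟨c, hc, hinj, hr⟩ := hP.boundary i hi
    rw [← hr]
    refine hc.tr_holonomy hΓ hinj (u := h ∘ boundaryLoop hi) ?_ ?_ ?_ ?_ ?_
    · refine hh.continuous.comp (Continuous.subtype_mk ?_ _)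
      exact (continuous_holeParam i).comp (continuous_const.prodMk continuous_id)
    · simp [boundaryLoop, holeParam, unitCircle_zero, unitCircle_one]
    · intro s t hs ht e
      exact boundaryLoop_injective hi hs ht (hh.injective e)
    · intro t
      rw [hr]
      exact ⟨_, holeParam_mem_holeCircle i t, rfl⟩
    · exact hX.of_freelyHomotopic hΓ ((holeLoop_freelyHomotopic hi).map hh.continuous)

/-- `A` and `B` are the holonomies of the loops `a` and `b`, lifted from `z`. -/
structure IsPantsHolonomy (Γ : Subgroup SL(2, ℝ)) {J : Set (Fin 3)} {h : pantsModel J → Surface Γ}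
    (hh : Continuous h) (z : ℍ) (A B : SL(2, ℝ)) : Prop where
  left : HasHolonomyAt Γ z ((loopA J).map hh) A
  right : HasHolonomyAt Γ z ((loopB J).map hh) B

theorem exists_isPantsHolonomy (hΓ : IsSurfaceGroup Γ) (hh : Continuous h) :
    ∃ z A B, IsPantsHolonomy Γ hh z A B := by
  obtain ⟨z, hz⟩ := proj_surjective Γ (h (base J))
  obtain ⟨A, hA⟩ := hΓ.exists_hasHolonomyAt ((loopA J).map hh) hz
  obtain ⟨B, hB⟩ := hΓ.exists_hasHolonomyAt ((loopB J).map hh) hz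
  exact ⟨z, A, B, hA, hB⟩

theorem IsPantsHolonomy.loopA {hh : Continuous h} (H : IsPantsHolonomy Γ hh z A B) :
    HasHolonomy Γ (h ∘ holeLoop J 0) A := H.left.hasHolonomy

theorem IsPantsHolonomy.loopB {hh : Continuous h} (H : IsPantsHolonomy Γ hh z A B) :
    HasHolonomy Γ (h ∘ holeLoop J 1) B := H.right.hasHolonomy

theorem IsPantsHolonomy.loopC {hh : Continuous h} (H : IsPantsHolonomy Γ hh z A B)
    (hΓ : IsSurfaceGroup Γ) : HasHolonomy Γ (h ∘ holeLoop J 2) (A * B) := by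
  have h1 := (H.left.trans H.right).hasHolonomy
  rw [← Path.map_trans] at h1
  exact (h1.of_freelyHomotopic hΓ ((loopA_trans_loopB_freelyHomotopic J).map hh)).of_freelyHomotopic
    hΓ ((loopCTurned_freelyHomotopic J).map hh)

theorem IsPantsHolonomy.figureEight {hh : Continuous h} (H : IsPantsHolonomy Γ hh z A B) :
    HasHolonomy Γ (fun t => h (figureEight J t)) (A⁻¹ * B) := by
  have h1 := (H.left.symm.trans H.right).hasHolonomy
  rwa [Path.map_symm, ← Path.map_trans] at h1

theorem loopA_notMem_holeCircle (t : I) (i : Fin 3) : (loopA J t : ℂ) ∉ holeCircle i := by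
  have hn : ‖(loopA J t : ℂ) + 1‖ = 1 := by simp [loopA, norm_unitCircle]
  generalize (loopA J t : ℂ) = z at hn
  have e1 := norm_add_le (z + 1) (-1)
  have e2 := norm_sub_le (z + 1) (z - 1)
  rw [show z + 1 + -1 = z by ring, hn] at e1
  rw [show z + 1 - (z - 1) = 2 by ring, hn] at e2
  norm_num at e1 e2
  intro hz
  fin_cases i
  · have := mem_holeCircle_zero.1 hz; linarith
  · have := mem_holeCircle_one.1 hz; linarith
  · have := mem_holeCircle_two.1 hz; linarith

theorem loopB_notMem_holeCircle (t : I) (i : Fin 3) : (loopB J t : ℂ) ∉ holeCircle i := by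
  have hn : ‖(loopB J t : ℂ) - 1‖ = 1 := by simp [loopB, norm_unitCircle]
  generalize (loopB J t : ℂ) = z at hn
  have e1 := norm_add_le (z - 1) 1
  have e2 := norm_sub_le (z + 1) (z - 1)
  rw [show z - 1 + 1 = z by ring, hn] at e1
  rw [show z + 1 - (z - 1) = 2 by ring, hn] at e2
  norm_num at e1 e2
  intro hz
  fin_cases i
  · have := mem_holeCircle_zero.1 hz; linarith
  · have := mem_holeCircle_one.1 hz; linarith
  · have := mem_holeCircle_two.1 hz; linarith

/-- The traces of the holonomies of a pair of pants multiply to a negative number: the axes are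
disjoint, and the base point lies between them. -/
theorem IsPairOfPants.tr_mul_tr_mul_tr_neg (hP : IsPairOfPants Γ J h L) (hΓ : IsSurfaceGroup Γ)
    (H : IsPantsHolonomy Γ hP.isClosedEmbedding.continuous z A B) (hAB : A * B ≠ B * A) :
    tr A * tr B * tr (A * B) < 0 := by
  have hA := H.left.1
  have hB := H.right.1
  have hinj := hP.isClosedEmbedding.injective
  refine HyperbolicPants.tr_mul_tr_mul_tr_neg (z := z) (hΓ.two_le_abs_tr hA)
    (hΓ.two_le_abs_tr hB) (hΓ.two_le_abs_tr (mul_mem hA hB)) (fun u w qA qB => ?_) ?_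
  · by_contra huw
    rw [not_and_or] at huw
    exact hAB (hΓ.commute_of_common_eigenvector hA hB huw qA qB)
  · have key : ∀ i X, HasHolonomy Γ (h ∘ holeLoop J i) X →
        ∀ g ∈ Subgroup.closure ({A, B} : Set SL(2, ℝ)), 0 < side X z * side X (g • z) := by
      intro i X hX
      refine side_mul_side_pos (hP.tr_holonomy hΓ i hX).2 H.left H.right ?_ ?_
      · rintro t ⟨w, hw, e⟩
        rw [hinj e] at hw
        exact loopA_notMem_holeCircle t i hw
      · rintro t ⟨w, hw, e⟩
        rw [hinj e] at hw
        exact loopB_notMem_holeCircle t i hw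
    rintro X (rfl | rfl | rfl)
    exacts [key 0 _ H.loopA, key 1 _ H.loopB, key 2 _ (H.loopC hΓ)]

end

/-! ### Commuting holonomies -/

/-- A hyperbolic element has an axis in `ℍ`. -/
theorem exists_side_eq_zero {A : SL(2, ℝ)} (h : 2 < |tr A|) : ∃ z, side A z = 0 := by
  have hd := det_entries A
  have h2 : 4 < tr A ^ 2 := by
    rw [← sq_abs]; nlinarith
  rw [tr] at h2
  by_cases hc : A 1 0 = 0
  · have hne : A 1 1 - A 0 0 ≠ 0 := by
      intro e
      rw [hc] at hd
      nlinarith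
    refine ⟨⟨⟨A 0 1 / (A 1 1 - A 0 0), 1⟩, one_pos⟩, ?_⟩
    rw [side, div_eq_zero_iff]
    left
    simp [UpperHalfPlane.re, UpperHalfPlane.im, hc]
    field_simp
    ring
  · set δ := (A 0 0 + A 1 1) ^ 2 - 4 with hδ
    have hpos : 0 < δ := by linarith
    have hs := Real.sq_sqrt hpos.le
    refine ⟨⟨⟨(A 0 0 - A 1 1) / (2 * A 1 0), √δ / (2 * |A 1 0|)⟩, by
      have := Real.sqrt_pos.2 hpos
      have := abs_pos.2 hc
      positivity⟩, ?_⟩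
    rw [side, div_eq_zero_iff]
    left
    simp only [UpperHalfPlane.re, UpperHalfPlane.im]
    rw [div_pow, div_pow, mul_pow, mul_pow, sq_abs, hs, hδ]
    field_simp
    linear_combination 4 * hd

theorem entries_of_commute {A B : SL(2, ℝ)} (h : A * B = B * A) :
    A 0 1 * B 1 0 = B 0 1 * A 1 0 ∧ A 0 1 * (B 1 1 - B 0 0) = B 0 1 * (A 1 1 - A 0 0) ∧
      A 1 0 * (B 1 1 - B 0 0) = B 1 0 * (A 1 1 - A 0 0) := by
  have e : ∀ i j, (A * B) i j = (B * A) i j := fun i j => by rw [h]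
  have e00 := e 0 0
  have e01 := e 0 1
  have e10 := e 1 0
  rw [mul_entry, mul_entry] at e00 e01 e10
  refine ⟨by linarith, by linarith, by linarith⟩

/-- Commuting hyperbolic elements have the same axis. -/
theorem side_eq_zero_of_commute {A B : SL(2, ℝ)} (h : A * B = B * A) (hA : 2 < |tr A|) {z : ℍ}
    (hz : side A z = 0) : side B z = 0 := by
  obtain ⟨e1, e2, e3⟩ := entries_of_commute h
  have hd := det_entries A
  have h2 : 4 < tr A ^ 2 := by
    rw [← sq_abs]; nlinarith
  rw [tr] at h2
  rw [side, div_eq_zero_iff] at hz ⊢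
  left
  have hz := hz.resolve_right z.im_pos.ne'
  by_cases h0 : A 1 0 = 0
  · have hne : A 1 1 - A 0 0 ≠ 0 := by
      intro e
      rw [h0] at hd
      nlinarith
    apply mul_left_cancel₀ hne
    linear_combination (B 1 1 - B 0 0) * hz - (z.re ^ 2 + z.im ^ 2) * e3 + e2
  · apply mul_left_cancel₀ h0
    linear_combination B 1 0 * hz + z.re * e3 + e1

/-- The product of commuting parabolic elements is parabolic or `±1`. -/
theorem abs_tr_of_commute {A B : SL(2, ℝ)} (h : A * B = B * A) (hA : |tr A| = 2)
    (hB : |tr B| = 2) : |tr (A⁻¹ * B)| = 2 := by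
  obtain ⟨e1, e2, e3⟩ := entries_of_commute h
  have dA := det_entries A
  have dB := det_entries B
  have hA2 : (A 0 0 + A 1 1) ^ 2 = 4 := by
    have : tr A ^ 2 = 4 := by rw [← sq_abs, hA]; norm_num
    rwa [tr] at this
  have hB2 : (B 0 0 + B 1 1) ^ 2 = 4 := by
    have : tr B ^ 2 = 4 := by rw [← sq_abs, hB]; norm_num
    rwa [tr] at this
  have pA : (A 1 1 - A 0 0) ^ 2 + 4 * A 0 1 * A 1 0 = 0 := by linear_combination hA2 - 4 * dA
  have pB : (B 1 1 - B 0 0) ^ 2 + 4 * B 0 1 * B 1 0 = 0 := by linear_combination hB2 - 4 * dB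
  have p0 : (A 1 1 - A 0 0) * (B 1 1 - B 0 0) + 2 * (A 0 1 * B 1 0 + A 1 0 * B 0 1) = 0 := by
    apply pow_eq_zero_iff (two_ne_zero) |>.1
    linear_combination ((B 1 1 - B 0 0) ^ 2 + 4 * B 0 1 * B 1 0) * pA +
      4 * B 1 0 * (A 1 1 - A 0 0) * e2 - 4 * A 0 1 * (B 1 1 - B 0 0) * e3 +
      (4 * (A 0 1 * B 1 0 - B 0 1 * A 1 0) - 4 * (A 1 1 - A 0 0) * (B 1 1 - B 0 0)) * e1
  have ht : tr (A⁻¹ * B) = (A 0 0 + A 1 1) * (B 0 0 + B 1 1) / 2 := by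
    rw [tr, mul_entry, mul_entry]
    simp only [inv_entry_00, inv_entry_01, inv_entry_10, inv_entry_11]
    linear_combination -p0 / 2
  rw [← abs_of_pos (by norm_num : (0 : ℝ) < 2), ← sq_eq_sq_iff_abs_eq_abs, ht, div_pow, mul_pow,
    hA2, hB2]
  norm_num

/-! ### The length formula -/

/-- With the signs of the traces settled, the length formula is the trace identity for `A⁻¹ * B`. -/
theorem IsPairOfPants.cosh_length {Γ : Subgroup SL(2, ℝ)} (hΓ : IsSurfaceGroup Γ)
    {J : Set (Fin 3)} {h : pantsModel J → Surface Γ} {L : Fin 3 → ℝ} (hP : IsPairOfPants Γ J h L)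
    {c : ℝ → Surface Γ} {l : ℝ} (hc : IsClosedGeodesic Γ c l)
    (hch : FreelyHomotopic (fun t : I => c (l * t)) (fun t => h (figureEight J t))) :
    Real.cosh (l / 2) =
      2 * Real.cosh (L 0 / 2) * Real.cosh (L 1 / 2) + Real.cosh (L 2 / 2) := by
  have hh := hP.isClosedEmbedding
  obtain ⟨z, A, B, H⟩ := exists_isPantsHolonomy hΓ hh.continuous
  obtain ⟨tA, aA⟩ := hP.tr_holonomy hΓ 0 H.loopA
  obtain ⟨tB, aB⟩ := hP.tr_holonomy hΓ 1 H.loopB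
  obtain ⟨tC, -⟩ := hP.tr_holonomy hΓ 2 (H.loopC hΓ)
  have tE : |tr (A⁻¹ * B)| = 2 * Real.cosh (l / 2) := by
    obtain ⟨M, g, hM, hg, hgM⟩ := hc.exists_hasHolonomy hΓ
    have hu : HasHolonomy Γ (fun t : I => c (l * t)) g := by
      refine ⟨hg, ⟨fun t => M • geo (l * t), ?_⟩, fun t => (hM _).symm, ?_⟩
      · exact (continuous_geo.comp (by fun_prop)).const_smul M
      · have : M • geo (l * (1 : I)) = (M * D l * M⁻¹) • M • geo (l * (0 : I)) := by
          rw [mul_smul, mul_smul, inv_smul_smul, D_smul_geo]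
          simp
        rcases hgM with e | e
        · rw [e]; exact this
        · rw [e, neg_smul']; exact this
    rw [(hu.of_freelyHomotopic hΓ hch).abs_tr_eq hΓ H.figureEight]
    have := Real.cosh_pos (l / 2)
    rcases hgM with e | e
    · rw [e, tr_conj, tr_D, abs_of_pos (by positivity)]
    · rw [e, tr_neg, tr_conj, tr_D, abs_neg, abs_of_pos (by positivity)]
  have hl : 1 < Real.cosh (l / 2) := Real.one_lt_cosh.2 (by have := hc.pos; positivity)
  have hAB : A * B ≠ B * A := by
    intro hAB
    -- a common point of the two axes would lie on two boundary geodesics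
    have hdisj : ∀ w, side A w = 0 → side B w = 0 → False := by
      intro w h1 h2
      obtain ⟨x, hx, e⟩ := aA w h1
      obtain ⟨y, hy, e'⟩ := aB w h2
      rw [hh.injective (e'.trans e.symm)] at hy
      have n1 := mem_holeCircle_zero.1 hx
      have n2 := mem_holeCircle_one.1 hy
      have := norm_sub_le ((x : ℂ) + 1) (x - 1)
      rw [show (x : ℂ) + 1 - (x - 1) = 2 by ring, n1, n2] at this
      norm_num at this
    by_cases h2A : 2 < |tr A|
    · obtain ⟨w, hw⟩ := exists_side_eq_zero h2A
      exact hdisj w hw (side_eq_zero_of_commute hAB h2A hw)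
    by_cases h2B : 2 < |tr B|
    · obtain ⟨w, hw⟩ := exists_side_eq_zero h2B
      exact hdisj w (side_eq_zero_of_commute hAB.symm h2B hw) hw
    have := abs_tr_of_commute hAB (le_antisymm (not_lt.1 h2A) (hΓ.two_le_abs_tr H.left.1))
      (le_antisymm (not_lt.1 h2B) (hΓ.two_le_abs_tr H.right.1))
    linarith
  have hneg := hP.tr_mul_tr_mul_tr_neg hΓ H hAB
  have hsum : tr (A⁻¹ * B) = tr A * tr B - tr (A * B) := by
    have e := tr_mul_add B A
    have e' : tr (B * A⁻¹) = tr (A⁻¹ * B) := tr_mul_comm _ _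
    have e'' : tr (B * A) = tr (A * B) := tr_mul_comm _ _
    linear_combination e - e' - e''
  have habs : |tr A * tr B - tr (A * B)| = |tr A * tr B| + |tr (A * B)| := by
    rw [sub_eq_add_neg, ← abs_neg (tr (A * B)), abs_add_eq_add_abs_iff]
    rcases mul_neg_iff.1 hneg with ⟨h1, h2⟩ | ⟨h1, h2⟩
    · left; constructor <;> linarith
    · right; constructor <;> linarith
  rw [hsum, habs, abs_mul, tA, tB, tC] at tE
  linarith

/-! ### Commuting parabolic elements -/

theorem sq_entry_of_abs_tr {A : SL(2, ℝ)} (hc : A 1 0 = 0) (h : |tr A| = 2) : A 0 0 ^ 2 = 1 := by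
  have hd := det_entries A
  have h2 : tr A ^ 2 = 4 := by rw [← sq_abs, h]; norm_num
  rw [tr] at h2
  rw [hc] at hd
  have h3 : (A 0 0 - A 1 1) ^ 2 = 0 := by linear_combination h2 - 4 * hd
  have h4 := pow_eq_zero_iff two_ne_zero |>.1 h3
  linear_combination hd + A 0 0 * h4

/-- Commuting parabolic elements of a discrete torsion-free group are powers of one element, up to
sign. -/
theorem IsSurfaceGroup.exists_zpow_of_commute {Γ : Subgroup SL(2, ℝ)} (hΓ : IsSurfaceGroup Γ)
    {A B : SL(2, ℝ)} (hA : A ∈ Γ) (hB : B ∈ Γ) (h : A * B = B * A) (tA : |tr A| = 2)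
    (tB : |tr B| = 2) (hA1 : ∃ z, side A z ≠ 0) : ∃ X ∈ Γ, ∃ i j : ℤ,
      (∀ z : ℍ, A • z = X ^ i • z) ∧ ∀ z : ℍ, B • z = X ^ j • z := by
  obtain ⟨u, w, huw, qA⟩ := exists_eigenvector tA.ge
  obtain ⟨e1, e2, e3⟩ := entries_of_commute h
  have qB : qf B u w = 0 := by
    unfold qf at qA ⊢
    have f1 : A 1 0 * (B 1 0 * u ^ 2 + (B 1 1 - B 0 0) * u * w - B 0 1 * w ^ 2) = 0 := by
      linear_combination B 1 0 * qA + u * w * e3 + w ^ 2 * e1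
    have f2 : (A 1 1 - A 0 0) * (B 1 0 * u ^ 2 + (B 1 1 - B 0 0) * u * w - B 0 1 * w ^ 2) = 0 := by
      linear_combination (B 1 1 - B 0 0) * qA - u ^ 2 * e3 + w ^ 2 * e2
    have f3 : A 0 1 * (B 1 0 * u ^ 2 + (B 1 1 - B 0 0) * u * w - B 0 1 * w ^ 2) = 0 := by
      linear_combination B 0 1 * qA + u ^ 2 * e1 + u * w * e2
    by_contra hne
    obtain ⟨z, hz⟩ := hA1
    apply hz
    rw [side, (mul_eq_zero.1 f1).resolve_right hne, (mul_eq_zero.1 f2).resolve_right hne,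
      (mul_eq_zero.1 f3).resolve_right hne]
    simp
  set N := colFrame u w huw with hN
  have hup : ∀ X ∈ Γ, qf X u w = 0 → |tr X| = 2 →
      ∃ t, U t ∈ HyperbolicPants.conjGroup Γ N ∧ ∀ z : ℍ, X • z = N • U t • N⁻¹ • z := by
    intro X hX qX tX
    have h0 : (N⁻¹ * X * N) 1 0 = 0 := by rw [conj_entry_10]; exact qX
    have e : N * (N⁻¹ * X * N) * N⁻¹ = X := by group
    obtain ⟨t, ht⟩ := eq_U_of_upper h0 (sq_entry_of_abs_tr h0 (by rw [tr_conj', tX]))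
    refine ⟨t, ?_, fun z => ?_⟩
    · rcases ht with ht | ht
      · exact Or.inl (by rw [← ht, e]; exact hX)
      · refine Or.inr ?_
        rw [← neg_eq_iff_eq_neg.2 ht]
        convert hX using 1
        rw [mul_neg, neg_mul, neg_neg, e]
    · conv_lhs => rw [← e, mul_smul, mul_smul]
      rcases ht with ht | ht
      · rw [ht]
      · rw [ht, neg_smul']
  obtain ⟨s, hs, sA⟩ := hup A hA qA tA
  obtain ⟨t, ht, tB⟩ := hup B hB qB tB
  let S : AddSubgroup ℝ :=
    { carrier := {r | U r ∈ HyperbolicPants.conjGroup Γ N}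
      zero_mem' := by rw [Set.mem_ofPred_eq, U_zero]; exact one_mem _
      add_mem' := fun {a b} ha hb => by
        rw [Set.mem_ofPred_eq] at *; rw [U_add]; exact mul_mem ha hb
      neg_mem' := fun {a} ha => by
        rw [Set.mem_ofPred_eq] at *; rw [U_neg]; exact inv_mem ha }
  obtain ⟨a, ha⟩ : ∃ a, S = AddSubgroup.closure {a} := by
    obtain ⟨W, hW, hW'⟩ := (hΓ.conjGroup N).exists_nhds
    have h1 : U ⁻¹' W ∈ 𝓝 (0 : ℝ) := continuous_U.continuousAt (by rwa [U_zero])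
    obtain ⟨ε, hε, hball⟩ := Metric.mem_nhds_iff.1 h1
    refine AddSubgroup.cyclic_of_isolated_zero hε (Set.disjoint_left.2 fun r hr hr' => ?_)
    have h2 := hW' _ hr (hball (by
      rw [Metric.mem_ball, dist_zero_right, Real.norm_of_nonneg hr'.1.le]; exact hr'.2))
    have h3 : r = 0 := congrArg (fun X : SL(2, ℝ) => X 0 1) h2
    exact hr'.1.ne' h3
  have haS : U a ∈ HyperbolicPants.conjGroup Γ N := by
    have : a ∈ S := by rw [ha]; exact AddSubgroup.subset_closure rfl
    exact this
  obtain ⟨X, hX, hXz⟩ : ∃ X ∈ Γ, ∀ (n : ℤ) (z : ℍ), X ^ n • z = N • U (n * a) • N⁻¹ • z := by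
    have e : ∀ (n : ℤ) (z : ℍ), (N * U a * N⁻¹) ^ n • z = N • U (n * a) • N⁻¹ • z := by
      intro n z
      rw [conj_zpow, U_zpow, mul_smul, mul_smul]
    rcases haS with h | h
    · exact ⟨_, h, e⟩
    · exact ⟨_, h, fun n z => by rw [neg_zpow_smul, e]⟩
  have hmul : ∀ r, U r ∈ HyperbolicPants.conjGroup Γ N → ∃ n : ℤ, r = n * a := by
    intro r hr
    have : r ∈ S := hr
    rw [ha, AddSubgroup.mem_closure_singleton] at this
    obtain ⟨n, hn⟩ := this
    exact ⟨n, by rw [← hn, zsmul_eq_mul]⟩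
  obtain ⟨i, rfl⟩ := hmul s hs
  obtain ⟨j, rfl⟩ := hmul t ht
  exact ⟨X, hX, i, j, fun z => by rw [sA, hXz], fun z => by rw [tB, hXz]⟩

/-! ### Winding numbers -/

/-- A nonvanishing function on the simply connected `ℍ` has a logarithm. -/
theorem exists_log {f : ℍ → ℂ} (hf : Continuous f) (h0 : ∀ z, f z ≠ 0) :
    ∃ F : C(ℍ, ℂ), ∀ z, Complex.exp (F z) = f z := by
  obtain ⟨F, ⟨-, h⟩, -⟩ := Complex.isCoveringMap_exp.existsUnique_continuousMap_lifts
    (⟨fun z => ⟨f z, h0 z⟩, hf.subtype_mk _⟩ : C(ℍ, {z : ℂ // z ≠ 0})) UpperHalfPlane.I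
    (Complex.log (f UpperHalfPlane.I)) (Subtype.ext (Complex.exp_log (h0 _)))
  exact ⟨F, fun z => congrArg Subtype.val (congrFun h z)⟩

theorem sub_eq_sub_of_exp_eq {X : Type*} [TopologicalSpace X] [PreconnectedSpace X] {u v : X → ℂ}
    (hu : Continuous u) (hv : Continuous v) (h : ∀ x, Complex.exp (u x) = Complex.exp (v x))
    (x y : X) : u x - u y = v x - v y := by
  have h1 : u = fun x => v x + (u y - v y) := by
    refine Complex.isCoveringMap_exp.eq_of_comp_eq hu (by fun_prop) ?_ y (by ring)
    funext x
    apply Subtype.ext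
    simp only [Function.comp_apply]
    rw [Complex.exp_add, Complex.exp_sub, h y, div_self (Complex.exp_ne_zero _), mul_one, h]
  have := congrFun h1 x
  rw [this]
  ring

/-- The holonomies of the loops around two punctures do not commute: they are not powers of one
element, since the first one winds around the first puncture and the second one does not. -/
theorem IsPantsHolonomy.mul_ne_mul {Γ : Subgroup SL(2, ℝ)} (hΓ : IsSurfaceGroup Γ)
    (h : pantsModel Set.univ ≃ₜ Surface Γ) {z : ℍ} {A B : SL(2, ℝ)}
    (H : IsPantsHolonomy Γ h.continuous z A B) (tA : |tr A| = 2) (tB : |tr B| = 2)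
    (sA : ∃ z, side A z ≠ 0) (sB : ∃ z, side B z ≠ 0) : A * B ≠ B * A := by
  intro hAB
  obtain ⟨X, hX, i, j, hi, hj⟩ := hΓ.exists_zpow_of_commute H.left.1 H.right.1 hAB tA tB sA
  have hne : ∀ w : pantsModel Set.univ, (w : ℂ) + 1 ≠ 0 := by
    intro w e
    apply w.2.1.2
    left
    rw [Metric.mem_ball, dist_eq_norm, sub_neg_eq_add, e]
    norm_num
  obtain ⟨F, hF⟩ := exists_log (f := fun w => (h.symm (proj Γ w) : ℂ) + 1)
    ((continuous_subtype_val.comp (h.symm.continuous.comp (continuous_proj Γ))).add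
      continuous_const) (fun w => hne _)
  -- the winding number of `X`
  have hadd : ∀ w, F (X • w) = F w + (F (X • z) - F z) := by
    intro w
    have := sub_eq_sub_of_exp_eq (u := fun w => F (X • w)) (v := F)
      (F.continuous.comp (continuous_const_smul X)) F.continuous
      (fun w => by rw [hF, hF, proj_smul hX]) w z
    linear_combination this
  set c := F (X • z) - F z with hc
  have hpow : ∀ n : ℤ, F (X ^ n • z) = F z + n * c := by
    intro n
    induction n with
    | zero => simp
    | succ n ih =>
      rw [add_comm, zpow_add, zpow_one, mul_smul, hadd, ih]; push_cast; ring
    | pred n ih =>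
      have := hadd (X ^ (-(n : ℤ) - 1) • z)
      rw [← mul_smul, ← zpow_one_add, add_sub_cancel, ih] at this
      push_cast at this ⊢
      linear_combination -this
  have hlift : ∀ {p : Path (base Set.univ) (base Set.univ)} {C : SL(2, ℝ)} {v : I → ℂ},
      HasHolonomyAt Γ z (p.map h.continuous) C → Continuous v →
      (∀ t, Complex.exp (v t) = (p t : ℂ) + 1) → F (C • z) - F z = v 1 - v 0 := by
    rintro p C v ⟨-, P, hP⟩ hv he
    have := sub_eq_sub_of_exp_eq (u := fun t => F (P t)) (F.continuous.comp P.continuous) hv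
      (fun t => by rw [hF, he, hP]; simp) 1 0
    simpa using this
  have hFA : F (A • z) - F z = 2 * Real.pi * Complex.I := by
    rw [hlift (p := HyperbolicPants.loopA _) H.left
      (v := fun t => 2 * Real.pi * (t : ℝ) * Complex.I) (by fun_prop) fun t => by
      simp [HyperbolicPants.loopA, unitCircle]]
    simp
  have hFB : F (B • z) - F z = 0 := by
    have hre : ∀ t, 2 - unitCircle t ∈ Complex.slitPlane := fun t => by
      left
      have h1 := Complex.re_le_norm (unitCircle t)
      rw [norm_unitCircle] at h1
      simp
      linarith
    rw [hlift (p := HyperbolicPants.loopB _) H.right (v := fun t => Complex.log (2 - unitCircle t))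
      ((continuous_const.sub continuous_unitCircle).clog hre) fun t => by
        rw [Complex.exp_log (Complex.slitPlane_ne_zero (hre t))]
        simp [HyperbolicPants.loopB]; ring]
    simp [unitCircle_zero, unitCircle_one]
  rw [hi, hpow] at hFA
  rw [hj, hpow] at hFB
  have hc0 : c ≠ 0 := by
    intro e
    rw [e] at hFA
    simp [Real.pi_ne_zero] at hFA
  have hj0 : j = 0 := by
    have : (j : ℂ) * c = 0 := by linear_combination hFB
    exact_mod_cast (mul_eq_zero.1 this).resolve_right hc0
  obtain ⟨w, hw⟩ := sB
  rw [hj0, zpow_zero] at hj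
  rcases hΓ.free B H.right.1 z (by rw [hj, one_smul]) with e | e
  · apply hw; rw [e]; simp [side]
  · apply hw; rw [e, side_neg]; simp [side]

/-! ### The group of a three-cusped sphere -/

/-- The holonomies around the three punctures are parabolic and do not commute, so the signs of
their traces determine the group up to conjugation. -/
theorem exists_conjGroup_eq_of_isThreeCuspedSphere {Γ : Subgroup SL(2, ℝ)} (hΓ : IsSurfaceGroup Γ)
    (hS : IsThreeCuspedSphere Γ) : ∃ N, conjGroup Γ N = Gamma2 := by
  obtain ⟨h, hP, hsurj⟩ := hS
  have hh := hP.isClosedEmbedding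
  let h' : pantsModel Set.univ ≃ₜ Surface Γ := hh.isEmbedding.toHomeomorphOfSurjective hsurj
  obtain ⟨z, A, B, H⟩ := exists_isPantsHolonomy hΓ hh.continuous
  have H' : IsPantsHolonomy Γ h'.continuous z A B := H
  have key : ∀ i X, HasHolonomy Γ (h ∘ holeLoop Set.univ i) X →
      |tr X| = 2 ∧ ∃ z, side X z ≠ 0 := by
    intro i X hX
    obtain ⟨h1, h2⟩ := hP.tr_holonomy hΓ i hX
    refine ⟨by simpa using h1, UpperHalfPlane.I, fun e => ?_⟩
    obtain ⟨w, hw, -⟩ := h2 _ e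
    exact w.2.2 (Set.mem_biUnion (Set.mem_univ i) hw)
  obtain ⟨tA, sA⟩ := key 0 A H.loopA
  obtain ⟨tB, sB⟩ := key 1 B H.loopB
  obtain ⟨tC, -⟩ := key 2 _ (H.loopC hΓ)
  have hneg := hP.tr_mul_tr_mul_tr_neg hΓ H (H'.mul_ne_mul hΓ h' tA tB sA sB)
  have hsign : ∀ X : SL(2, ℝ), |tr X| = 2 → ∃ Y, (Y = X ∨ Y = -X) ∧ tr Y = 2 := by
    intro X hX
    rcases eq_or_eq_neg_of_abs_eq hX with e | e
    · exact ⟨X, Or.inl rfl, e⟩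
    · exact ⟨-X, Or.inr rfl, by rw [tr_neg, e, neg_neg]⟩
  obtain ⟨A', hA', tA'⟩ := hsign A tA
  obtain ⟨B', hB', tB'⟩ := hsign B tB
  have tC' : tr (A' * B') = -2 := by
    have e : tr A * tr B * tr (A * B) = 4 * tr (A' * B') := by
      rw [show (4 : ℝ) = 2 * 2 by norm_num]
      nth_rw 1 [← tA', ← tB']
      rcases hA' with rfl | rfl <;> rcases hB' with rfl | rfl <;>
        simp only [neg_mul, mul_neg, tr_neg, neg_neg]
    have habs : |tr (A' * B')| = 2 := by
      rcases hA' with rfl | rfl <;> rcases hB' with rfl | rfl <;>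
        simp only [neg_mul, mul_neg, tr_neg, neg_neg, abs_neg, tC]
    rcases eq_or_eq_neg_of_abs_eq habs with e' | e'
    · rw [e, e'] at hneg; norm_num at hneg
    · exact e'
  obtain ⟨N, hU, hL⟩ := exists_conj_standard tA' tB' (by rw [tC']; norm_num)
  refine ⟨N, (hΓ.conjGroup N).eq_Gamma2 ?_ ?_ (neg_one_mem_conjGroup Γ N)⟩
  · have hm : N⁻¹ * A' * N ∈ conjGroup Γ N := by
      rw [mem_conjGroup, show N * (N⁻¹ * A' * N) * N⁻¹ = A' by group]
      rcases hA' with rfl | rfl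
      · exact Or.inl H.left.1
      · exact Or.inr (by rw [neg_neg]; exact H.left.1)
    rcases hU with e | e
    · rwa [e] at hm
    · rw [e] at hm
      simpa [U_neg] using hm
  · have hm : N⁻¹ * B' * N ∈ conjGroup Γ N := by
      rw [mem_conjGroup, show N * (N⁻¹ * B' * N) * N⁻¹ = B' by group]
      rcases hB' with rfl | rfl
      · exact Or.inl H.right.1
      · exact Or.inr (by rw [neg_neg]; exact H.right.1)
    rcases hL with e | e
    · rwa [e] at hm
    · rw [e] at hm
      simpa [Lo_neg] using hm

/-! ### The three-holed sphere without boundary as a twice-punctured plane -/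

/-- A map that is radial near `-1` and `1` and far from `0`, and the identity elsewhere. -/
def radialMap (m n : ℝ → ℝ) (w : ℂ) : ℂ :=
  w + (w + 1) * m ‖w + 1‖ + (w - 1) * m ‖w - 1‖ + w * n ‖w‖

section

variable {m n m' n' : ℝ → ℝ} {w : ℂ}

theorem norm_of_norm_add_one_le (h : ‖w + 1‖ ≤ 1) : 1 ≤ ‖w - 1‖ ∧ ‖w‖ ≤ 2 := by
  have e1 := norm_sub_le (w + 1) (w - 1)
  have e2 := norm_sub_le (w + 1) 1
  rw [show w + 1 - (w - 1) = 2 by ring] at e1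
  rw [show w + 1 - 1 = w by ring] at e2
  norm_num at e1 e2
  constructor <;> linarith

theorem norm_of_norm_sub_one_le (h : ‖w - 1‖ ≤ 1) : 1 ≤ ‖w + 1‖ ∧ ‖w‖ ≤ 2 := by
  have e1 := norm_sub_le (w + 1) (w - 1)
  have e2 := norm_add_le (w - 1) 1
  rw [show w + 1 - (w - 1) = 2 by ring] at e1
  rw [show w - 1 + 1 = w by ring] at e2
  norm_num at e1 e2
  constructor <;> linarith

theorem norm_of_two_le_norm (h : 2 ≤ ‖w‖) : 1 ≤ ‖w + 1‖ ∧ 1 ≤ ‖w - 1‖ := by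
  have e1 := norm_sub_le (w + 1) 1
  have e2 := norm_add_le (w - 1) 1
  rw [show w + 1 - 1 = w by ring] at e1
  rw [show w - 1 + 1 = w by ring] at e2
  norm_num at e1 e2
  constructor <;> linarith

theorem radialMap_left (hm : ∀ r, 1 ≤ r → m r = 0) (hn : ∀ r, r ≤ 2 → n r = 0)
    (h : ‖w + 1‖ ≤ 1) : radialMap m n w + 1 = (w + 1) * (1 + m ‖w + 1‖ : ℝ) := by
  obtain ⟨h1, h2⟩ := norm_of_norm_add_one_le h
  rw [radialMap, hm _ h1, hn _ h2]
  push_cast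
  ring

theorem radialMap_right (hm : ∀ r, 1 ≤ r → m r = 0) (hn : ∀ r, r ≤ 2 → n r = 0)
    (h : ‖w - 1‖ ≤ 1) : radialMap m n w - 1 = (w - 1) * (1 + m ‖w - 1‖ : ℝ) := by
  obtain ⟨h1, h2⟩ := norm_of_norm_sub_one_le h
  rw [radialMap, hm _ h1, hn _ h2]
  push_cast
  ring

theorem radialMap_outer (hm : ∀ r, 1 ≤ r → m r = 0) (h : 2 ≤ ‖w‖) :
    radialMap m n w = w * (1 + n ‖w‖ : ℝ) := by
  obtain ⟨h1, h2⟩ := norm_of_two_le_norm h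
  rw [radialMap, hm _ h1, hm _ h2]
  push_cast
  ring

theorem radialMap_middle (hm : ∀ r, 1 ≤ r → m r = 0) (hn : ∀ r, r ≤ 2 → n r = 0)
    (h1 : 1 ≤ ‖w + 1‖) (h2 : 1 ≤ ‖w - 1‖) (h3 : ‖w‖ ≤ 2) : radialMap m n w = w := by
  rw [radialMap, hm _ h1, hm _ h2, hn _ h3]
  simp

/-- Two radial maps are inverse to each other if this holds for the radii. -/
theorem radialMap_radialMap (hm : ∀ r, 1 ≤ r → m r = 0) (hn : ∀ r, r ≤ 2 → n r = 0)
    (hm' : ∀ r, 1 ≤ r → m' r = 0) (hn' : ∀ r, r ≤ 2 → n' r = 0)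
    (h1 : ∀ r, r = ‖w + 1‖ ∨ r = ‖w - 1‖ → r ≤ 1 →
      0 ≤ 1 + m r ∧ r * (1 + m r) ≤ 1 ∧ (1 + m r) * (1 + m' (r * (1 + m r))) = 1)
    (h2 : 2 ≤ ‖w‖ → 0 ≤ 1 + n ‖w‖ ∧ 2 ≤ ‖w‖ * (1 + n ‖w‖) ∧
      (1 + n ‖w‖) * (1 + n' (‖w‖ * (1 + n ‖w‖))) = 1) :
    radialMap m' n' (radialMap m n w) = w := by
  have hnorm : ∀ (v : ℂ) {r : ℝ}, 0 ≤ r → ‖v * (r : ℂ)‖ = ‖v‖ * r := fun v r hr => by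
    rw [norm_mul, Complex.norm_real, Real.norm_of_nonneg hr]
  rcases le_total ‖w + 1‖ 1 with i1 | i1
  · obtain ⟨k1, k2, k3⟩ := h1 _ (Or.inl rfl) i1
    have e := radialMap_left hm hn i1
    have en : ‖radialMap m n w + 1‖ = ‖w + 1‖ * (1 + m ‖w + 1‖) := by rw [e, hnorm _ k1]
    have e' := radialMap_left hm' hn' (en.le.trans k2)
    rw [en, e, mul_assoc, ← Complex.ofReal_mul, k3, Complex.ofReal_one, mul_one] at e'
    exact add_right_cancel e'
  rcases le_total ‖w - 1‖ 1 with i2 | i2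
  · obtain ⟨k1, k2, k3⟩ := h1 _ (Or.inr rfl) i2
    have e := radialMap_right hm hn i2
    have en : ‖radialMap m n w - 1‖ = ‖w - 1‖ * (1 + m ‖w - 1‖) := by rw [e, hnorm _ k1]
    have e' := radialMap_right hm' hn' (en.le.trans k2)
    rw [en, e, mul_assoc, ← Complex.ofReal_mul, k3, Complex.ofReal_one, mul_one] at e'
    exact sub_left_injective e'
  rcases le_total 2 ‖w‖ with i3 | i3
  · obtain ⟨k1, k2, k3⟩ := h2 i3
    have e := radialMap_outer (n := n) hm i3
    have en : ‖radialMap m n w‖ = ‖w‖ * (1 + n ‖w‖) := by rw [e, hnorm _ k1]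
    have e' := radialMap_outer (n := n') hm' (k2.trans en.ge)
    rwa [en, e, mul_assoc, ← Complex.ofReal_mul, k3, Complex.ofReal_one, mul_one, ← e] at e'
  · rw [radialMap_middle hm hn i1 i2 i3, radialMap_middle hm' hn' i1 i2 i3]

end

/-- The plane without `-1` and `1`. -/
def puncturedPlane : Set ℂ := {w | w ≠ -1 ∧ w ≠ 1}

theorem mem_pantsModel_univ {w : ℂ} :
    w ∈ pantsModel Set.univ ↔ ‖w‖ < 3 ∧ 1 / 2 < ‖w + 1‖ ∧ 1 / 2 < ‖w - 1‖ := by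
  refine ⟨fun h => ?_, fun h => mem_pantsModel h.1 h.2.1 h.2.2⟩
  have h1 : ‖w‖ ≤ 3 := by simpa using h.1.1
  have h2 := h.1.2
  simp only [Set.mem_union, Metric.mem_ball, dist_eq_norm, sub_neg_eq_add, not_or, not_lt] at h2
  have h3 : ∀ i, w ∉ holeCircle i := fun i hi => h.2 (Set.mem_biUnion (Set.mem_univ i) hi)
  exact ⟨lt_of_le_of_ne h1 fun e => h3 2 (mem_holeCircle_two.2 e),
    lt_of_le_of_ne h2.1 fun e => h3 0 (mem_holeCircle_zero.2 e.symm),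
    lt_of_le_of_ne h2.2 fun e => h3 1 (mem_holeCircle_one.2 e.symm)⟩

/-- The radius `r` becomes `2 * r - 1` for `r ≤ 1`. -/
def innerFactor (r : ℝ) : ℝ := min 0 (1 - 1 / r)

/-- The radius `r` becomes `r / (3 - r)` for `r ≥ 2`. -/
def outerFactor (r : ℝ) : ℝ := max 0 (r - 2) / (3 - r)

/-- The radius `r` becomes `(r + 1) / 2` for `r ≤ 1`. -/
def innerFactorInv (r : ℝ) : ℝ := max 0 ((1 / r - 1) / 2)

/-- The radius `r` becomes `3 * r / (1 + r)` for `r ≥ 2`. -/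
def outerFactorInv (r : ℝ) : ℝ := -(max 0 (r - 2) / (1 + r))

theorem innerFactor_of_one_le {r : ℝ} (h : 1 ≤ r) : innerFactor r = 0 := by
  have : 1 / r ≤ 1 := by rw [div_le_one (by linarith)]; exact h
  exact min_eq_left (by linarith)

theorem outerFactor_of_le_two {r : ℝ} (h : r ≤ 2) : outerFactor r = 0 := by
  rw [outerFactor, max_eq_left (by linarith), zero_div]

theorem innerFactorInv_of_one_le {r : ℝ} (h : 1 ≤ r) : innerFactorInv r = 0 := by
  have : 1 / r ≤ 1 := by rw [div_le_one (by linarith)]; exact h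
  exact max_eq_left (by linarith)

theorem outerFactorInv_of_le_two {r : ℝ} (h : r ≤ 2) : outerFactorInv r = 0 := by
  rw [outerFactorInv, max_eq_left (by linarith), zero_div, neg_zero]

theorem innerFactor_of_le_one {r : ℝ} (h0 : 0 < r) (h : r ≤ 1) :
    1 + innerFactor r = (2 * r - 1) / r := by
  have : 1 ≤ 1 / r := by rw [le_div_iff₀ h0]; linarith
  rw [innerFactor, min_eq_right (by linarith)]
  field_simp
  ring

theorem outerFactor_of_two_le {r : ℝ} (h : 2 ≤ r) (h3 : r < 3) :
    1 + outerFactor r = 1 / (3 - r) := by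
  have : 3 - r ≠ 0 := by linarith
  rw [outerFactor, max_eq_right (by linarith)]
  field_simp
  ring

theorem innerFactorInv_of_le_one {r : ℝ} (h0 : 0 < r) (h : r ≤ 1) :
    1 + innerFactorInv r = (r + 1) / (2 * r) := by
  have : 1 ≤ 1 / r := by rw [le_div_iff₀ h0]; linarith
  rw [innerFactorInv, max_eq_right (by linarith)]
  field_simp
  ring

theorem outerFactorInv_of_two_le {r : ℝ} (h : 2 ≤ r) :
    1 + outerFactorInv r = 3 / (1 + r) := by
  have : 1 + r ≠ 0 := by linarith
  rw [outerFactorInv, max_eq_right (by linarith)]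
  field_simp
  ring

theorem radialMap_inv_radialMap {w : ℂ} (hw : w ∈ pantsModel Set.univ) :
    radialMap innerFactorInv outerFactorInv (radialMap innerFactor outerFactor w) = w := by
  obtain ⟨h3, h1, h2⟩ := mem_pantsModel_univ.1 hw
  refine radialMap_radialMap (fun _ => innerFactor_of_one_le) (fun _ => outerFactor_of_le_two)
    (fun _ => innerFactorInv_of_one_le) (fun _ => outerFactorInv_of_le_two) (fun r hr hr1 => ?_)
    (fun h => ?_)
  · have hr0 : 1 / 2 < r := by rcases hr with rfl | rfl <;> assumption
    have hr' : 0 < r := by linarith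
    rw [innerFactor_of_le_one hr' hr1, mul_div_cancel₀ _ hr'.ne',
      innerFactorInv_of_le_one (by linarith) (by linarith)]
    refine ⟨div_nonneg (by linarith) hr'.le, by linarith, ?_⟩
    have : 2 * r - 1 ≠ 0 := by linarith
    field_simp
    ring
  · have h4 : 0 < 3 - ‖w‖ := by linarith
    have h5 : 2 ≤ ‖w‖ * (1 / (3 - ‖w‖)) := by
      rw [mul_one_div, le_div_iff₀ h4]; linarith
    rw [outerFactor_of_two_le h h3, outerFactorInv_of_two_le h5]
    refine ⟨by positivity, h5, ?_⟩
    have : 1 + ‖w‖ * (1 / (3 - ‖w‖)) = 3 / (3 - ‖w‖) := by field_simp; ring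
    rw [this]
    field_simp

theorem radialMap_radialMap_inv {w : ℂ} (hw : w ∈ puncturedPlane) :
    radialMap innerFactor outerFactor (radialMap innerFactorInv outerFactorInv w) = w := by
  refine radialMap_radialMap (fun _ => innerFactorInv_of_one_le)
    (fun _ => outerFactorInv_of_le_two) (fun _ => innerFactor_of_one_le)
    (fun _ => outerFactor_of_le_two) (fun r hr hr1 => ?_) (fun h => ?_)
  · have hr' : 0 < r := by
      rcases hr with rfl | rfl
      · rw [norm_pos_iff]; exact fun e => hw.1 (eq_neg_of_add_eq_zero_left e)
      · rw [norm_pos_iff]; exact fun e => hw.2 (sub_eq_zero.1 e)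
    have e : r * ((r + 1) / (2 * r)) = (r + 1) / 2 := by field_simp
    rw [innerFactorInv_of_le_one hr' hr1, e, innerFactor_of_le_one (by linarith) (by linarith)]
    refine ⟨by positivity, by linarith, ?_⟩
    field_simp
    ring
  · have h4 : 0 < 1 + ‖w‖ := by linarith
    have h5 : 2 ≤ ‖w‖ * (3 / (1 + ‖w‖)) := by
      rw [mul_div, le_div_iff₀ h4]; linarith
    have h6 : ‖w‖ * (3 / (1 + ‖w‖)) < 3 := by
      rw [mul_div, div_lt_iff₀ h4]; linarith
    rw [outerFactorInv_of_two_le h, outerFactor_of_two_le h5 h6]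
    refine ⟨by positivity, h5, ?_⟩
    have : 3 - ‖w‖ * (3 / (1 + ‖w‖)) = 3 / (1 + ‖w‖) := by field_simp; ring
    rw [this]
    field_simp

theorem radialMap_mem_puncturedPlane {w : ℂ} (hw : w ∈ pantsModel Set.univ) :
    radialMap innerFactor outerFactor w ∈ puncturedPlane := by
  have h0 := radialMap_inv_radialMap hw
  obtain ⟨-, h1, h2⟩ := mem_pantsModel_univ.1 hw
  -- the inverse map fixes `-1` and `1`
  have hL : radialMap innerFactorInv outerFactorInv (-1) = -1 := by
    have := radialMap_left (w := -1) (fun _ => innerFactorInv_of_one_le)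
      (fun _ => outerFactorInv_of_le_two) (by simp)
    rw [neg_add_cancel, zero_mul] at this
    exact eq_neg_of_add_eq_zero_left this
  have hR : radialMap innerFactorInv outerFactorInv 1 = 1 := by
    have := radialMap_right (w := 1) (fun _ => innerFactorInv_of_one_le)
      (fun _ => outerFactorInv_of_le_two) (by simp)
    rw [sub_self, zero_mul] at this
    exact sub_eq_zero.1 this
  constructor
  · intro e
    rw [e, hL] at h0
    rw [← h0] at h1
    norm_num at h1
  · intro e
    rw [e, hR] at h0
    rw [← h0] at h2
    norm_num at h2

theorem radialMap_inv_mem_pantsModel {w : ℂ} (hw : w ∈ puncturedPlane) :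
    radialMap innerFactorInv outerFactorInv w ∈ pantsModel Set.univ := by
  rw [mem_pantsModel_univ]
  have hnorm : ∀ (v : ℂ) {r : ℝ}, 0 ≤ r → ‖v * (r : ℂ)‖ = ‖v‖ * r := fun v r hr => by
    rw [norm_mul, Complex.norm_real, Real.norm_of_nonneg hr]
  rcases le_total ‖w + 1‖ 1 with i1 | i1
  · have h0 : 0 < ‖w + 1‖ := norm_pos_iff.2 fun e => hw.1 (eq_neg_of_add_eq_zero_left e)
    have e := congrArg norm (radialMap_left (fun _ => innerFactorInv_of_one_le)
      (fun _ => outerFactorInv_of_le_two) i1)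
    rw [innerFactorInv_of_le_one h0 i1, hnorm _ (by positivity)] at e
    have e' : ‖w + 1‖ * ((‖w + 1‖ + 1) / (2 * ‖w + 1‖)) = (‖w + 1‖ + 1) / 2 := by field_simp
    rw [e'] at e
    obtain ⟨k1, k2⟩ := norm_of_norm_add_one_le (e.le.trans (by linarith))
    exact ⟨by linarith, by linarith, by linarith⟩
  rcases le_total ‖w - 1‖ 1 with i2 | i2
  · have h0 : 0 < ‖w - 1‖ := norm_pos_iff.2 fun e => hw.2 (sub_eq_zero.1 e)
    have e := congrArg norm (radialMap_right (fun _ => innerFactorInv_of_one_le)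
      (fun _ => outerFactorInv_of_le_two) i2)
    rw [innerFactorInv_of_le_one h0 i2, hnorm _ (by positivity)] at e
    have e' : ‖w - 1‖ * ((‖w - 1‖ + 1) / (2 * ‖w - 1‖)) = (‖w - 1‖ + 1) / 2 := by field_simp
    rw [e'] at e
    obtain ⟨k1, k2⟩ := norm_of_norm_sub_one_le (e.le.trans (by linarith))
    exact ⟨by linarith, by linarith, by linarith⟩
  rcases le_total 2 ‖w‖ with i3 | i3
  · have e := congrArg norm (radialMap_outer (n := outerFactorInv)
      (fun _ => innerFactorInv_of_one_le) i3)
    have h4 : 0 < 1 + ‖w‖ := by linarith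
    rw [outerFactorInv_of_two_le i3, hnorm _ (by positivity)] at e
    have h5 : 2 ≤ ‖w‖ * (3 / (1 + ‖w‖)) := by
      rw [mul_div, le_div_iff₀ h4]; linarith
    have h6 : ‖w‖ * (3 / (1 + ‖w‖)) < 3 := by
      rw [mul_div, div_lt_iff₀ h4]; linarith
    obtain ⟨k1, k2⟩ := norm_of_two_le_norm (h5.trans e.ge)
    exact ⟨by linarith, by linarith, by linarith⟩
  · rw [radialMap_middle (fun _ => innerFactorInv_of_one_le)
      (fun _ => outerFactorInv_of_le_two) i1 i2 i3]
    exact ⟨by linarith, by linarith, by linarith⟩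

/-- The three-holed sphere without boundary is homeomorphic to the plane without two points. -/
def pantsModelHomeomorph : pantsModel Set.univ ≃ₜ puncturedPlane where
  toFun w := ⟨_, radialMap_mem_puncturedPlane w.2⟩
  invFun w := ⟨_, radialMap_inv_mem_pantsModel w.2⟩
  left_inv w := Subtype.ext (radialMap_inv_radialMap w.2)
  right_inv w := Subtype.ext (radialMap_radialMap_inv w.2)
  continuous_toFun := by
    have h : ∀ w : pantsModel Set.univ, ‖(w : ℂ) + 1‖ ≠ 0 ∧ ‖(w : ℂ) - 1‖ ≠ 0 ∧
        3 - ‖(w : ℂ)‖ ≠ 0 := fun w => by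
      obtain ⟨h1, h2, h3⟩ := mem_pantsModel_univ.1 w.2
      exact ⟨by linarith, by linarith, by linarith⟩
    unfold radialMap innerFactor outerFactor
    refine Continuous.subtype_mk ?_ _
    fun_prop (disch := first | exact fun w => (h w).1 | exact fun w => (h w).2.1 |
      exact fun w => (h w).2.2)
  continuous_invFun := by
    have h : ∀ w : puncturedPlane, ‖(w : ℂ) + 1‖ ≠ 0 ∧ ‖(w : ℂ) - 1‖ ≠ 0 ∧
        1 + ‖(w : ℂ)‖ ≠ 0 := fun w => by
      refine ⟨?_, ?_, by positivity⟩
      · rw [norm_ne_zero_iff]; exact fun e => w.2.1 (eq_neg_of_add_eq_zero_left e)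
      · rw [norm_ne_zero_iff]; exact fun e => w.2.2 (sub_eq_zero.1 e)
    unfold radialMap innerFactorInv outerFactorInv
    refine Continuous.subtype_mk ?_ _
    fun_prop (disch := first | exact fun w => (h w).1 | exact fun w => (h w).2.1 |
      exact fun w => (h w).2.2)

theorem pantsModelHomeomorph_loopA (t : I) :
    (pantsModelHomeomorph (loopA Set.univ t) : ℂ) = -1 + unitCircle t := by
  have hn : ‖-1 + unitCircle t + 1‖ = 1 := by simp [norm_unitCircle]
  obtain ⟨h1, h2⟩ := norm_of_norm_add_one_le hn.le
  exact radialMap_middle (fun _ => innerFactor_of_one_le) (fun _ => outerFactor_of_le_two) hn.ge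
    h1 h2

theorem pantsModelHomeomorph_loopB (t : I) :
    (pantsModelHomeomorph (loopB Set.univ t) : ℂ) = 1 - unitCircle t := by
  have hn : ‖1 - unitCircle t - 1‖ = 1 := by simp [norm_unitCircle]
  obtain ⟨h1, h2⟩ := norm_of_norm_sub_one_le hn.le
  exact radialMap_middle (fun _ => innerFactor_of_one_le) (fun _ => outerFactor_of_le_two) h1
    hn.ge h2

theorem pantsModelHomeomorph_loopC (t : I) :
    (pantsModelHomeomorph (loopC Set.univ t) : ℂ) = 5 * unitCircle t := by
  have hn : ‖5 / 2 * unitCircle t‖ = 5 / 2 := by norm_num [norm_unitCircle]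
  have h := radialMap_outer (n := outerFactor) (fun _ => innerFactor_of_one_le)
    (hn.ge.trans' (by norm_num))
  rw [hn, outerFactor_of_two_le (by norm_num) (by norm_num)] at h
  refine h.trans ?_
  push_cast
  ring

/-! ### A fundamental domain of the congruence subgroup -/

/-- The ideal quadrilateral with vertices `-1`, `0`, `1`, `∞`. -/
def quadrilateral : Set ℍ := {z | |z.re| ≤ 1 ∧ |z.re| ≤ z.re ^ 2 + z.im ^ 2}

/-- The square of the absolute value of `c * z + d`, where `(c, d)` is the second row of `g`. -/
def denomSq (g : SL(2, ℝ)) (z : ℍ) : ℝ := (g 1 0 * z.re + g 1 1) ^ 2 + (g 1 0 * z.im) ^ 2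

theorem smul_im_eq (g : SL(2, ℝ)) (z : ℍ) : (g • z).im = z.im / denomSq g z := smul_im g z

theorem denomSq_pos (g : SL(2, ℝ)) (z : ℍ) : 0 < denomSq g z := denom_pos g z

theorem denomSq_eq_one {g : SL(2, ℝ)} {z : ℍ} (h : (g • z).im = z.im) : denomSq g z = 1 := by
  rw [smul_im_eq, div_eq_iff (denomSq_pos g z).ne'] at h
  exact mul_left_cancel₀ z.im_pos.ne' (by rw [← h, mul_one])

/-- A decomposition of `|c * z + d| ^ 2 - 1` into non-negative terms. -/
theorem denomSq_terms {z : ℍ} (hz : z ∈ quadrilateral) {g : SL(2, ℝ)} (hg : g ∈ Gamma2) :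
    denomSq g z - 1 = g 1 0 ^ 2 * (z.re ^ 2 + z.im ^ 2 - |z.re|) +
      2 * (g 1 0 * g 1 1 * z.re + |g 1 0| * |g 1 1| * |z.re|) +
      |z.re| * ((|g 1 0| - |g 1 1|) ^ 2 - 1) + (1 - |z.re|) * (g 1 1 ^ 2 - 1) ∧
    0 ≤ g 1 0 ^ 2 * (z.re ^ 2 + z.im ^ 2 - |z.re|) ∧
    0 ≤ g 1 0 * g 1 1 * z.re + |g 1 0| * |g 1 1| * |z.re| ∧
    0 ≤ |z.re| * ((|g 1 0| - |g 1 1|) ^ 2 - 1) ∧ 0 ≤ (1 - |z.re|) * (g 1 1 ^ 2 - 1) := by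
  obtain ⟨a, b, c, d, -, -, hc, hd⟩ := mem_Gamma2.1 hg
  obtain ⟨h1, h2⟩ := hz
  refine ⟨?_, mul_nonneg (sq_nonneg _) (by linarith), ?_, mul_nonneg (abs_nonneg _) ?_,
    mul_nonneg (by linarith) ?_⟩
  · rw [denomSq]
    linear_combination (-|z.re|) * sq_abs (g 1 0) - |z.re| * sq_abs (g 1 1)
  · rw [← abs_mul, ← abs_mul]
    linarith [neg_abs_le (g 1 0 * g 1 1 * z.re)]
  · have h3 : 1 ≤ (|2 * c| - |2 * d + 1|) ^ 2 := by
      have : |2 * c| - |2 * d + 1| ≠ 0 := by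
        intro e
        rcases abs_cases (2 * c) with ⟨h, -⟩ | ⟨h, -⟩ <;>
          rcases abs_cases (2 * d + 1) with ⟨h', -⟩ | ⟨h', -⟩ <;> rw [h, h'] at e <;> omega
      have := sq_pos_of_ne_zero this
      omega
    have h4 : (1 : ℝ) ≤ ((|2 * c| - |2 * d + 1| : ℤ) : ℝ) ^ 2 := by exact_mod_cast h3
    push_cast at h4
    rw [hc, hd]
    linarith
  · have h3 : 1 ≤ (2 * d + 1) ^ 2 := by
      have : (2 * d + 1) ≠ 0 := by omega
      have := sq_pos_of_ne_zero this
      omega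
    have h4 : (1 : ℝ) ≤ (2 * d + 1) ^ 2 := by exact_mod_cast h3
    rw [hd]
    linarith

theorem one_le_denomSq {z : ℍ} (hz : z ∈ quadrilateral) {g : SL(2, ℝ)} (hg : g ∈ Gamma2) :
    1 ≤ denomSq g z := by
  obtain ⟨h0, h1, h2, h3, h4⟩ := denomSq_terms hz hg
  linarith

/-- The points of the quadrilateral are the highest ones of their orbits. -/
theorem smul_im_le {z : ℍ} (hz : z ∈ quadrilateral) {g : SL(2, ℝ)} (hg : g ∈ Gamma2) :
    (g • z).im ≤ z.im := by
  rw [smul_im_eq]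
  exact div_le_self z.im_pos.le (one_le_denomSq hz hg)

/-- Equality in `one_le_denomSq` with `g 1 0 ≠ 0` happens only on the two semicircles bounding the
quadrilateral, and it determines the second row of `g` up to sign. -/
theorem entries_of_denomSq_eq_one {z : ℍ} (hz : z ∈ quadrilateral) {g : SL(2, ℝ)} (hg : g ∈ Gamma2)
    (h : denomSq g z = 1) (hc : g 1 0 ≠ 0) : z.re ^ 2 + z.im ^ 2 = |z.re| ∧ g 1 1 ^ 2 = 1 ∧
      g 1 0 * g 1 1 * z.re = -(2 * |z.re|) := by
  obtain ⟨h0, h1, h2, h3, h4⟩ := denomSq_terms hz hg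
  have hy := z.im_pos
  have hN : z.re ^ 2 + z.im ^ 2 = |z.re| := by
    have : g 1 0 ^ 2 * (z.re ^ 2 + z.im ^ 2 - |z.re|) = 0 := by linarith
    have := (mul_eq_zero.1 this).resolve_left (by positivity)
    linarith
  have hx : |z.re| ≠ 0 := by
    intro e
    rw [e] at hN
    nlinarith
  have hx1 : |z.re| ≠ 1 := by
    intro e
    rw [e, ← sq_abs, e] at hN
    nlinarith
  have hE : g 1 1 ^ 2 = 1 := by
    have : (1 - |z.re|) * (g 1 1 ^ 2 - 1) = 0 := by linarith
    have := (mul_eq_zero.1 this).resolve_left (sub_ne_zero.2 hx1.symm)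
    linarith
  have hE' : |g 1 1| = 1 := by
    rw [← sq_abs] at hE
    nlinarith [abs_nonneg (g 1 1)]
  have hC : (|g 1 0| - |g 1 1|) ^ 2 = 1 := by
    have : |z.re| * ((|g 1 0| - |g 1 1|) ^ 2 - 1) = 0 := by linarith
    have := (mul_eq_zero.1 this).resolve_left hx
    linarith
  have hC' : |g 1 0| = 2 := by
    rw [hE'] at hC
    have h5 : |g 1 0| * (|g 1 0| - 2) = 0 := by linear_combination hC
    have := (mul_eq_zero.1 h5).resolve_left (abs_ne_zero.2 hc)
    linarith
  rw [hE', hC'] at h2 h0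
  exact ⟨hN, hE, by linarith⟩

/-- Two equivalent points of the quadrilateral are equal, or opposite points of its boundary. -/
theorem smul_eq_or_of_mem_quadrilateral {z : ℍ} (hz : z ∈ quadrilateral) {g : SL(2, ℝ)}
    (hg : g ∈ Gamma2) (hgz : g • z ∈ quadrilateral) : g • z = z ∨
      (g • z).re = -z.re ∧ (g • z).im = z.im ∧
        (|z.re| = 1 ∨ z.re ^ 2 + z.im ^ 2 = |z.re|) := by
  have hy := z.im_pos
  have him : (g • z).im = z.im := by
    apply le_antisymm (smul_im_le hz hg)
    have := smul_im_le hgz (inv_mem hg)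
    rwa [inv_smul_smul] at this
  have hden : denomSq g z = 1 := denomSq_eq_one him
  have hden' : denomSq g⁻¹ (g • z) = 1 := denomSq_eq_one (by rw [inv_smul_smul, him])
  have hre := smul_re g z
  rw [← denomSq, hden, div_one] at hre
  have hd := det_entries g
  obtain ⟨a, b, c, d, ea, eb, ec, ed⟩ := mem_Gamma2.1 hg
  by_cases hc : g 1 0 = 0
  · rw [denomSq, hc] at hden
    rw [hc] at hre hd
    have hre' : (g • z).re = z.re + 2 * (b * (2 * d + 1) : ℤ) := by
      push_cast
      rw [← ed, hre]
      linear_combination z.re * hd + g 1 1 * eb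
    generalize b * (2 * d + 1) = n at hre'
    obtain ⟨h1, -⟩ := hz
    obtain ⟨h1', -⟩ := hgz
    rw [hre', abs_le] at h1'
    have h1a := abs_le.1 h1
    have hn1 : (n : ℝ) ≤ 1 := by linarith
    have hn2 : (-1 : ℝ) ≤ n := by linarith
    have hn1' : n ≤ 1 := by exact_mod_cast hn1
    have hn2' : -1 ≤ n := by exact_mod_cast hn2
    have hn : n = -1 ∨ n = 0 ∨ n = 1 := by omega
    rcases hn with rfl | rfl | rfl
    · right
      push_cast at *
      have : z.re = 1 := by linarith
      exact ⟨by rw [hre', this]; norm_num, him, Or.inl (by rw [this]; norm_num)⟩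
    · left
      push_cast at *
      exact UpperHalfPlane.ext_re_im (by rw [hre']; ring) him
    · right
      push_cast at *
      have : z.re = -1 := by linarith
      exact ⟨by rw [hre', this]; norm_num, him, Or.inl (by rw [this]; norm_num)⟩
  · right
    obtain ⟨k1, k2, k3⟩ := entries_of_denomSq_eq_one hz hg hden hc
    obtain ⟨-, k2', -⟩ := entries_of_denomSq_eq_one hgz (inv_mem hg) hden'
      (by rw [inv_entry_10]; exact neg_ne_zero.2 hc)
    rw [inv_entry_11] at k2'
    refine ⟨?_, him, Or.inr k1⟩
    have hAE : g 0 0 = g 1 1 := by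
      rcases sq_eq_sq_iff_eq_or_eq_neg.1 (k2'.trans k2.symm) with h | h
      · exact h
      · exfalso
        rw [h] at hd
        have h5 : (4 * (b * c) : ℝ) = -2 := by
          rw [eb, ec] at hd
          linear_combination -hd - k2
        have h6 : 4 * (b * c) = -2 := by exact_mod_cast h5
        omega
    have h7 : g 1 0 * (g • z).re = g 0 0 - (g 1 0 * z.re + g 1 1) := by
      rw [hre]
      rw [denomSq] at hden
      linear_combination g 0 0 * hden - (g 1 0 * z.re + g 1 1) * hd
    rw [hAE] at h7
    apply mul_left_cancel₀ hc
    linarith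

/-- Every orbit meets the quadrilateral: a highest point of the orbit that lies between `-1` and
`1` belongs to it. -/
theorem exists_smul_mem_quadrilateral (z : ℍ) : ∃ g ∈ Gamma2, g • z ∈ quadrilateral := by
  have hy := z.im_pos
  -- a second row that minimises the denominator
  let S : Set (ℤ × ℤ) := {p | ∃ g ∈ Gamma2, g 1 0 = p.1 ∧ g 1 1 = p.2 ∧ denomSq g z ≤ 1}
  have hfin : S.Finite := by
    obtain ⟨m, hm⟩ := exists_nat_ge (1 / z.im)
    obtain ⟨k, hk⟩ := exists_nat_ge (1 + m * |z.re|)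
    refine ((Set.finite_Icc (-(m : ℤ)) m).prod (Set.finite_Icc (-(k : ℤ)) k)).subset ?_
    rintro ⟨c, d⟩ ⟨g, -, hc, hd, hle⟩
    simp only at hc hd
    rw [denomSq, hc, hd] at hle
    have h1 : |(c : ℝ)| ≤ m := by
      refine le_trans ?_ hm
      rw [le_div_iff₀ hy]
      have : |c * z.im| ≤ 1 :=
          abs_le_one_iff_mul_self_le_one.2 (by nlinarith [sq_nonneg (c * z.re + d)])
      rwa [abs_mul, abs_of_pos hy] at this
    have h2 : |(d : ℝ)| ≤ k := by
      refine le_trans ?_ hk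
      have h3 : |c * z.re + d| ≤ 1 :=
          abs_le_one_iff_mul_self_le_one.2 (by nlinarith [sq_nonneg (c * z.im)])
      have h4 : |(d : ℝ)| ≤ |c * z.re + d| + |c * z.re| := by
        have := abs_sub (c * z.re + d) (c * z.re)
        rwa [add_sub_cancel_left] at this
      rw [abs_mul] at h4
      have := mul_le_mul_of_nonneg_right h1 (abs_nonneg z.re)
      linarith
    have h1' := abs_le.1 h1
    have h2' := abs_le.1 h2
    refine ⟨⟨?_, ?_⟩, ⟨?_, ?_⟩⟩
    · exact_mod_cast h1'.1
    · exact_mod_cast h1'.2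
    · exact_mod_cast h2'.1
    · exact_mod_cast h2'.2
  have hne : S.Nonempty := ⟨(0, 1), 1, one_mem _, by simp, by simp, by simp [denomSq]⟩
  obtain ⟨p, ⟨g, hg, hp1, hp2, hp⟩, hmin⟩ :=
    Set.exists_min_image S (fun p => (p.1 * z.re + p.2) ^ 2 + (p.1 * z.im) ^ 2) hfin hne
  have hmin' : ∀ k ∈ Gamma2, denomSq g z ≤ denomSq k z := by
    intro k hk
    rcases le_total (denomSq k z) 1 with h | h
    · obtain ⟨a, b, c, d, -, -, hc, hd⟩ := mem_Gamma2.1 hk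
      have := hmin (2 * c, 2 * d + 1) ⟨k, hk, by rw [hc]; push_cast; ring,
        by rw [hd]; push_cast; ring, h⟩
      simp only at this
      rw [← hp1, ← hp2] at this
      push_cast at this
      rwa [← hc, ← hd] at this
    · exact hp.trans h
  have htop : ∀ k ∈ Gamma2, (k • z).im ≤ (g • z).im := by
    intro k hk
    rw [smul_im_eq, smul_im_eq]
    exact div_le_div_of_nonneg_left hy.le (denom_pos g z) (hmin' k hk)
  -- translate it between `-1` and `1`
  set n : ℤ := round ((g • z).re / 2) with hn
  have hU : U (2 * (-n : ℤ)) * g ∈ Gamma2 := mul_mem (U_mem_Gamma2 _) hg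
  refine ⟨_, hU, ?_, ?_⟩
  · have := abs_sub_round ((g • z).re / 2)
    rw [mul_smul, U_smul_re]
    rw [← hn, abs_le] at this
    rw [abs_le]
    push_cast
    constructor <;> linarith [this.1, this.2]
  · have key : ∀ e : ℤ, e = 1 ∨ e = -1 → 0 ≤ ((U (2 * (-n : ℤ)) * g) • z).re ^ 2 +
        ((U (2 * (-n : ℤ)) * g) • z).im ^ 2 + e * ((U (2 * (-n : ℤ)) * g) • z).re := by
      intro e he
      have h1 := htop _ (mul_mem (Lo_mem_Gamma2 e) hU)
      rw [mul_smul, smul_im_eq, div_le_iff₀ (denomSq_pos _ _)] at h1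
      have h2 : ((U (2 * (-n : ℤ)) * g) • z).im = (g • z).im := by rw [mul_smul, U_smul_im]
      rw [h2] at h1 ⊢
      have h3 := (g • z).im_pos
      have h4 : 1 ≤ denomSq (Lo (2 * e)) ((U (2 * (-n : ℤ)) * g) • z) := by
        by_contra hcon
        push Not at hcon
        nlinarith
      rw [denomSq, h2] at h4
      simp only [Lo, sl_10, sl_11] at h4
      have he2 : (e : ℝ) ^ 2 = 1 := by rcases he with rfl | rfl <;> norm_num
      nlinarith
    have k1 := key 1 (Or.inl rfl)
    have k2 := key (-1) (Or.inr rfl)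
    generalize (U (2 * (-n : ℤ)) * g) • z = v at k1 k2
    push_cast at k1 k2
    rw [abs_le]
    constructor <;> linarith

/-- A bounded box in `ℍ`, as the image of a rectangle; the maximum keeps the map inside `ℍ`. -/
theorem isCompact_box (Y : ℝ) (hY : 0 < Y) :
    IsCompact {z : ℍ | |z.re| ≤ Y ∧ 1 / Y ≤ z.im ∧ z.im ≤ Y} := by
  have hY' : 0 < 1 / Y := by positivity
  let f : ℝ × ℝ → ℍ := fun p => ⟨⟨p.1, max p.2 (1 / Y)⟩, lt_max_of_lt_right hY'⟩
  have hf : Continuous f := by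
    rw [UpperHalfPlane.isEmbedding_coe.continuous_iff]
    have : (UpperHalfPlane.coe ∘ f) =
        fun p : ℝ × ℝ => (p.1 : ℂ) + (max p.2 (1 / Y) : ℝ) * Complex.I := by
      funext p
      exact (Complex.mk_eq_add_mul_I _ _)
    rw [this]
    fun_prop
  have := ((isCompact_Icc (a := -Y) (b := Y)).prod (isCompact_Icc (a := 1 / Y) (b := Y))).image hf
  convert this using 1
  ext z
  constructor
  · rintro ⟨h1, h2, h3⟩
    refine ⟨(z.re, z.im), ⟨abs_le.1 h1, h2, h3⟩, ?_⟩
    apply UpperHalfPlane.ext_re_im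
    · rfl
    · exact max_eq_left h2
  · rintro ⟨p, ⟨h1, h2, h3⟩, rfl⟩
    refine ⟨abs_le.2 h1, ?_, ?_⟩
    · exact le_max_right _ _
    · exact max_le h3 (h2.trans h3)

/-- The images of the quadrilateral are locally finite. -/
theorem isClosed_iUnion_smul {E : Set ℍ} (hE : IsClosed E) (hq : E ⊆ quadrilateral) :
    IsClosed (⋃ g : Gamma2, (fun z : ℍ => g • z) '' E) := by
  have := isSurfaceGroup_Gamma2.discrete
  refine LocallyFinite.isClosed_iUnion ?_ fun g => (Homeomorph.smul g).isClosedMap E hE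
  intro z
  obtain ⟨Y, hY⟩ := exists_gt (max (max 1 |z.re|) (max z.im (1 / z.im)))
  simp only [max_lt_iff] at hY
  obtain ⟨⟨hY1, hYx⟩, hYy, hYy'⟩ := hY
  have hY0 : 0 < Y := by linarith
  have hzy := z.im_pos
  have hYz : 1 / Y < z.im := by
    rw [div_lt_iff₀ hY0]
    rwa [div_lt_iff₀ hzy, mul_comm] at hYy'
  set K := {z : ℍ | |z.re| ≤ Y ∧ 1 / Y ≤ z.im ∧ z.im ≤ Y} with hK
  have hKc := isCompact_box Y hY0
  refine ⟨K, ?_, ?_⟩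
  · have h1 : ∀ᶠ w : ℍ in 𝓝 z, |w.re| < Y :=
      (UpperHalfPlane.continuous_re.abs.continuousAt).eventually_lt continuousAt_const hYx
    have h2 : ∀ᶠ w : ℍ in 𝓝 z, 1 / Y < w.im :=
      continuousAt_const.eventually_lt UpperHalfPlane.continuous_im.continuousAt hYz
    have h3 : ∀ᶠ w : ℍ in 𝓝 z, w.im < Y :=
      UpperHalfPlane.continuous_im.continuousAt.eventually_lt continuousAt_const hYy
    filter_upwards [h1, h2, h3] with w k1 k2 k3 using ⟨k1.le, k2.le, k3.le⟩
  · have hf := ProperlyDiscontinuousSMul.finite_disjoint_inter_image (Γ := Gamma2) hKc hKc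
    refine hf.subset ?_
    rintro g ⟨w, ⟨e, he, rfl⟩, hw⟩
    rw [Set.mem_ofPred_eq]
    suffices heK : e ∈ K from ⟨g • e, ⟨e, heK, rfl⟩, hw⟩
    obtain ⟨k1, k2, k3⟩ := hw
    have hge : (g • e).im ≤ e.im := smul_im_le (hq he) g.2
    refine ⟨(hq he).1.trans hY1.le, k2.trans hge, ?_⟩
    -- an image of a point of height `y` has height at most `max y (1 / y)`
    have hinv : e = (g : SL(2, ℝ))⁻¹ • (g • e) := (inv_smul_smul (g : SL(2, ℝ)) e).symm
    set v := g • e with hv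
    have hvy := v.im_pos
    obtain ⟨a, b, c, d, -, -, hc, hd⟩ := mem_Gamma2.1 (inv_mem g.2)
    have him := smul_im_eq (g : SL(2, ℝ))⁻¹ v
    rw [← hinv] at him
    rw [him, div_le_iff₀ (denomSq_pos _ _)]
    have hpos := denom_pos (g : SL(2, ℝ))⁻¹ v
    rw [denomSq, hc, hd]
    by_cases hc0 : c = 0
    · have h3 : 1 ≤ (2 * d + 1) ^ 2 := by
        have : (2 * d + 1) ≠ 0 := by omega
        have := sq_pos_of_ne_zero this
        omega
      have h4 : (1 : ℝ) ≤ (2 * d + 1) ^ 2 := by exact_mod_cast h3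
      rw [hc0]
      push_cast
      nlinarith
    · have h3 : 1 ≤ c ^ 2 := by
        have := sq_pos_of_ne_zero hc0
        omega
      have h4 : (1 : ℝ) ≤ c ^ 2 := by exact_mod_cast h3
      have h5 : 1 ≤ v.im * Y := by rwa [div_le_iff₀ hY0] at k2
      have h6 : v.im ^ 2 ≤ (2 * (c : ℝ) * v.im) ^ 2 := by
        nlinarith [sq_nonneg v.im]
      have h7 : v.im ≤ Y * v.im ^ 2 := by nlinarith
      nlinarith [sq_nonneg (2 * (c : ℝ) * v.re + (2 * d + 1))]

/-! ### The ideal triangle as a half-plane -/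

/-- The reflection of `ℍ` in the imaginary axis. -/
def reflect (z : ℍ) : ℍ := ⟨⟨-z.re, z.im⟩, z.im_pos⟩

@[simp] theorem reflect_re (z : ℍ) : (reflect z).re = -z.re := rfl

@[simp] theorem reflect_im (z : ℍ) : (reflect z).im = z.im := rfl

theorem continuous_mk_iff {X : Type*} [TopologicalSpace X] {f : X → ℍ} :
    Continuous f ↔ Continuous (fun x => (f x).re) ∧ Continuous fun x => (f x).im := by
  refine ⟨fun h => ⟨UpperHalfPlane.continuous_re.comp h, UpperHalfPlane.continuous_im.comp h⟩,
    fun h => ?_⟩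
  rw [UpperHalfPlane.isEmbedding_coe.continuous_iff]
  have : (UpperHalfPlane.coe ∘ f) = fun x => ((f x).re : ℂ) + (f x).im * Complex.I :=
    funext fun x => (Complex.re_add_im _).symm
  rw [this]
  have h1 := h.1
  have h2 := h.2
  fun_prop

theorem continuous_reflect : Continuous reflect :=
  continuous_mk_iff.2 ⟨UpperHalfPlane.continuous_re.neg, UpperHalfPlane.continuous_im⟩

theorem reflect_reflect (z : ℍ) : reflect (reflect z) = z :=
  UpperHalfPlane.ext_re_im (by simp) (by simp)

/-- The ideal triangle with vertices `0`, `1`, `∞`, one half of the quadrilateral. -/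
def triangle : Set ℍ := {z | 0 ≤ z.re ∧ z.re ≤ 1 ∧ z.re ≤ z.re ^ 2 + z.im ^ 2}

theorem isClosed_triangle : IsClosed triangle := by
  have h1 := UpperHalfPlane.continuous_re
  have h2 := UpperHalfPlane.continuous_im
  exact (isClosed_le continuous_const h1).inter ((isClosed_le h1 continuous_const).inter
    (isClosed_le h1 (by fun_prop)))

theorem triangle_subset : triangle ⊆ quadrilateral := by
  rintro z ⟨h1, h2, h3⟩
  exact ⟨by rwa [abs_of_nonneg h1], by rwa [abs_of_nonneg h1]⟩

theorem reflect_mem_quadrilateral {z : ℍ} (hz : z ∈ triangle) : reflect z ∈ quadrilateral := by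
  obtain ⟨h1, h2, h3⟩ := hz
  refine ⟨?_, ?_⟩
  · rwa [reflect_re, abs_neg, abs_of_nonneg h1]
  · rwa [reflect_re, reflect_im, abs_neg, abs_of_nonneg h1, neg_sq]

theorem mem_triangle_or {z : ℍ} (hz : z ∈ quadrilateral) : z ∈ triangle ∨ reflect z ∈ triangle := by
  obtain ⟨h1, h2⟩ := hz
  rcases le_total 0 z.re with h | h
  · rw [abs_of_nonneg h] at h1 h2
    exact Or.inl ⟨h, h1, h2⟩
  · rw [abs_of_nonpos h] at h1 h2
    refine Or.inr ⟨?_, ?_, ?_⟩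
    · rw [reflect_re]; linarith
    · rwa [reflect_re]
    · rwa [reflect_re, reflect_im, neg_sq]

section

variable {w w' : ℂ}

/-- The real part of the point of the triangle that corresponds to `w`. Its level lines are
hyperbolas with foci `-1` and `1`. -/
def triRe (w : ℂ) : ℝ := (2 + ‖w + 1‖ - ‖w - 1‖) / 4

/-- The power of the corresponding point of the triangle with respect to the side with endpoints
`0` and `1`. Its level lines are ellipses with foci `-1` and `1`. -/
def triPow (w : ℂ) : ℝ := (‖w + 1‖ + ‖w - 1‖) / 2 - 1

theorem norm_bounds (w : ℂ) : ‖w + 1‖ ≤ ‖w - 1‖ + 2 ∧ ‖w - 1‖ ≤ ‖w + 1‖ + 2 ∧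
    2 ≤ ‖w + 1‖ + ‖w - 1‖ := by
  have e1 := norm_add_le (w - 1) 2
  have e2 := norm_sub_le (w + 1) 2
  have e3 := norm_sub_le (w + 1) (w - 1)
  rw [show w - 1 + 2 = w + 1 by ring] at e1
  rw [show w + 1 - 2 = w - 1 by ring] at e2
  rw [show w + 1 - (w - 1) = 2 by ring] at e3
  norm_num at e1 e2 e3
  exact ⟨e1, e2, e3⟩

theorem sq_norm_add_one (w : ℂ) : ‖w + 1‖ ^ 2 = (w.re + 1) ^ 2 + w.im ^ 2 := by
  rw [Complex.sq_norm, Complex.normSq_apply]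
  simp
  ring

theorem sq_norm_sub_one (w : ℂ) : ‖w - 1‖ ^ 2 = (w.re - 1) ^ 2 + w.im ^ 2 := by
  rw [Complex.sq_norm, Complex.normSq_apply]
  simp
  ring

theorem triRe_nonneg (w : ℂ) : 0 ≤ triRe w := by
  obtain ⟨-, h, -⟩ := norm_bounds w
  unfold triRe
  linarith

theorem triRe_le_one (w : ℂ) : triRe w ≤ 1 := by
  obtain ⟨h, -, -⟩ := norm_bounds w
  unfold triRe
  linarith

theorem triPow_nonneg (w : ℂ) : 0 ≤ triPow w := by
  obtain ⟨-, -, h⟩ := norm_bounds w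
  unfold triPow
  linarith

theorem triPow_add_pos (hw : w ∈ puncturedPlane) : 0 < triPow w + triRe w * (1 - triRe w) := by
  have h1 : 0 < ‖w + 1‖ := norm_pos_iff.2 fun e => hw.1 (eq_neg_of_add_eq_zero_left e)
  have h2 : 0 < ‖w - 1‖ := norm_pos_iff.2 fun e => hw.2 (sub_eq_zero.1 e)
  have p1 := triPow_nonneg w
  have p2 : 0 ≤ triRe w * (1 - triRe w) :=
    mul_nonneg (triRe_nonneg w) (sub_nonneg.2 (triRe_le_one w))
  rcases p1.lt_or_eq with h | h
  · linarith
  rcases p2.lt_or_eq with h' | h'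
  · linarith
  · exfalso
    unfold triPow at h
    unfold triRe at h'
    rcases mul_eq_zero.1 h'.symm with e | e <;> linarith

/-- The map from the punctured plane to the triangle that folds it along the real axis. -/
def triMap (w : puncturedPlane) : ℍ :=
  ⟨⟨triRe w, √(triPow w + triRe w * (1 - triRe w))⟩, Real.sqrt_pos.2 (triPow_add_pos w.2)⟩

theorem triMap_re (w : puncturedPlane) : (triMap w).re = triRe w := rfl

theorem triMap_im_sq (w : puncturedPlane) :
    (triMap w).im ^ 2 = triPow w + triRe w * (1 - triRe w) :=
  Real.sq_sqrt (triPow_add_pos w.2).le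

theorem continuous_triMap : Continuous triMap := by
  rw [continuous_mk_iff]
  have h1 : Continuous fun w : puncturedPlane => triRe w := by unfold triRe; fun_prop
  have h2 : Continuous fun w : puncturedPlane => triPow w := by unfold triPow; fun_prop
  exact ⟨h1, (h2.add (h1.mul (continuous_const.sub h1))).sqrt⟩

theorem triMap_mem (w : puncturedPlane) : triMap w ∈ triangle := by
  refine ⟨triRe_nonneg w, triRe_le_one w, ?_⟩
  rw [triMap_im_sq, triMap_re]
  have := triPow_nonneg w
  nlinarith

theorem eq_or_eq_conj (h1 : ‖w + 1‖ = ‖w' + 1‖) (h2 : ‖w - 1‖ = ‖w' - 1‖) :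
    w.re = w'.re ∧ (w.im = w'.im ∨ w.im = -w'.im) := by
  have e1 := sq_norm_add_one w
  have e2 := sq_norm_sub_one w
  rw [h1, sq_norm_add_one] at e1
  rw [h2, sq_norm_sub_one] at e2
  have hre : w.re = w'.re := by linarith
  refine ⟨hre, sq_eq_sq_iff_eq_or_eq_neg.1 ?_⟩
  rw [hre] at e1
  linarith

theorem triMap_eq_iff_norm {w w' : puncturedPlane} (hre : (triMap w).re = (triMap w').re)
    (him : (triMap w).im = (triMap w').im) :
    (w : ℂ).re = (w' : ℂ).re ∧ ((w : ℂ).im = (w' : ℂ).im ∨ (w : ℂ).im = -(w' : ℂ).im) := by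
  have e2 := triMap_im_sq w
  rw [him, triMap_im_sq, ← triMap_re, ← triMap_re, hre] at e2
  have e3 : triPow w' = triPow w := add_right_cancel e2
  rw [triMap_re, triMap_re] at hre
  unfold triPow at e3
  unfold triRe at hre
  exact eq_or_eq_conj (by linarith) (by linarith)

/-- The boundary of the triangle corresponds to the real axis. -/
theorem im_eq_zero_of_triMap {w : puncturedPlane} (h : (triMap w).re = 0 ∨ (triMap w).re = 1 ∨
    (triMap w).re ^ 2 + (triMap w).im ^ 2 = (triMap w).re) : (w : ℂ).im = 0 := by
  rw [triMap_im_sq, triMap_re] at h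
  have e1 := sq_norm_add_one w
  have e2 := sq_norm_sub_one w
  have key : (w : ℂ).im ^ 2 = 0 := by
    rcases h with h | h | h
    · unfold triRe at h
      have h' : ‖(w : ℂ) - 1‖ = ‖(w : ℂ) + 1‖ + 2 := by linarith
      rw [h'] at e2
      have h3 : ‖(w : ℂ) + 1‖ = -(w : ℂ).re - 1 := by linarith
      rw [h3] at e1
      linarith
    · unfold triRe at h
      have h' : ‖(w : ℂ) + 1‖ = ‖(w : ℂ) - 1‖ + 2 := by linarith
      rw [h'] at e1
      have h3 : ‖(w : ℂ) - 1‖ = (w : ℂ).re - 1 := by linarith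
      rw [h3] at e2
      linarith
    · have h0 : triPow w = 0 := by linarith
      unfold triPow at h0
      have h' : ‖(w : ℂ) - 1‖ = 2 - ‖(w : ℂ) + 1‖ := by linarith
      rw [h'] at e2
      have h3 : ‖(w : ℂ) + 1‖ = (w : ℂ).re + 1 := by linarith
      rw [h3] at e1
      linarith
  exact pow_eq_zero_iff two_ne_zero |>.1 key

/-- The power of a point with respect to the side of the triangle with endpoints `0` and `1`. -/
def sidePow (z : ℍ) : ℝ := z.re ^ 2 + z.im ^ 2 - z.re

/-- The inverse of `triMap` with values in the closed upper half-plane. -/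
def triInv (z : ℍ) : ℂ :=
  ⟨-((1 + sidePow z) * (1 - 2 * z.re)),
    √(sidePow z * (sidePow z + 2) * (4 * (z.re * (1 - z.re))))⟩

theorem triInv_im_nonneg (z : ℍ) : 0 ≤ (triInv z).im := Real.sqrt_nonneg _

theorem continuous_triInv : Continuous triInv := by
  have h1 := UpperHalfPlane.continuous_re
  have h2 := UpperHalfPlane.continuous_im
  have : triInv = fun z => (((triInv z).re : ℝ) : ℂ) + ((triInv z).im : ℝ) * Complex.I :=
    funext fun z => (Complex.re_add_im _).symm
  rw [this]
  simp only [triInv]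
  unfold sidePow
  fun_prop

theorem norm_triInv {z : ℍ} (hz : z ∈ triangle) :
    ‖triInv z + 1‖ = sidePow z + 2 * z.re ∧ ‖triInv z - 1‖ = sidePow z + 2 - 2 * z.re := by
  obtain ⟨h0, h1, h2⟩ := hz
  have hY : 0 ≤ sidePow z := by unfold sidePow; linarith
  have hv : (triInv z).im ^ 2 = sidePow z * (sidePow z + 2) * (4 * (z.re * (1 - z.re))) :=
    Real.sq_sqrt (mul_nonneg (by positivity)
      (mul_nonneg (by norm_num) (mul_nonneg h0 (by linarith))))
  have hu : (triInv z).re = -((1 + sidePow z) * (1 - 2 * z.re)) := rfl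
  constructor
  · rw [← sq_eq_sq₀ (norm_nonneg _) (by linarith), sq_norm_add_one, hv, hu]
    ring
  · rw [← sq_eq_sq₀ (norm_nonneg _) (by linarith), sq_norm_sub_one, hv, hu]
    ring

theorem triInv_mem {z : ℍ} (hz : z ∈ triangle) : triInv z ∈ puncturedPlane := by
  obtain ⟨e1, e2⟩ := norm_triInv hz
  obtain ⟨h0, h1, h2⟩ := hz
  have hy := z.im_pos
  have hY : 0 ≤ sidePow z := by unfold sidePow; linarith
  constructor
  · intro e
    rw [e] at e1
    norm_num at e1
    have h3 : z.re = 0 := by linarith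
    unfold sidePow at e1
    rw [h3] at e1
    nlinarith
  · intro e
    rw [e] at e2
    norm_num at e2
    have h3 : z.re = 1 := by linarith
    unfold sidePow at e2
    rw [h3] at e2
    nlinarith

theorem triMap_triInv {z : ℍ} (hz : z ∈ triangle) : triMap ⟨triInv z, triInv_mem hz⟩ = z := by
  obtain ⟨e1, e2⟩ := norm_triInv hz
  have hre : triRe (triInv z) = z.re := by
    unfold triRe
    rw [e1, e2]
    ring
  apply UpperHalfPlane.ext_re_im
  · exact hre
  · rw [← sq_eq_sq₀ (UpperHalfPlane.im_pos _).le z.im_pos.le, triMap_im_sq, hre, triPow, e1, e2,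
      sidePow]
    ring

end

/-! ### The three-cusped sphere from the congruence subgroup -/

/-- The map from the punctured plane to the surface: the closed upper half-plane is mapped to the
triangle, and the lower one to its mirror image. -/
def surfaceMap (Γ : Subgroup SL(2, ℝ)) (N : SL(2, ℝ)) (w : puncturedPlane) : Surface Γ :=
  if 0 ≤ (w : ℂ).im then proj Γ (N • triMap w) else proj Γ (N • reflect (triMap w))

section

variable {Γ : Subgroup SL(2, ℝ)} {N : SL(2, ℝ)}

theorem surfaceMap_of_nonneg {w : puncturedPlane} (h : 0 ≤ (w : ℂ).im) :
    surfaceMap Γ N w = proj Γ (N • triMap w) := if_pos h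

theorem Lo_smul_eq_reflect {z : ℍ} (h : z.re ^ 2 + z.im ^ 2 = z.re) : Lo (-2) • z = reflect z := by
  have h0 := z.im_pos
  have hden : ((Lo (-2)) 1 0 * z.re + (Lo (-2)) 1 1) ^ 2 + ((Lo (-2)) 1 0 * z.im) ^ 2 = 1 := by
    simp only [Lo, sl_10, sl_11]
    linear_combination 4 * h
  apply UpperHalfPlane.ext_re_im
  · rw [smul_re, hden, reflect_re]
    simp only [Lo, sl_00, sl_01, sl_10, sl_11]
    linear_combination -2 * h
  · rw [smul_im, hden, reflect_im, div_one]

theorem U_smul_eq_reflect {z : ℍ} (h : z.re = 1) : U (-2) • z = reflect z := by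
  apply UpperHalfPlane.ext_re_im
  · rw [U_smul_re, reflect_re, h]; norm_num
  · rw [U_smul_im, reflect_im]

/-- On the real axis the two halves are glued by elements of the group. -/
theorem proj_triMap_eq (hN : conjGroup Γ N = Gamma2) {w : puncturedPlane} (h : (w : ℂ).im = 0) :
    proj Γ (N • triMap w) = proj Γ (N • reflect (triMap w)) := by
  rw [proj_smul_eq_iff, hN]
  have e1 := sq_norm_add_one w
  have e2 := sq_norm_sub_one w
  rw [h] at e1 e2
  have n1 : ‖(w : ℂ) + 1‖ = |(w : ℂ).re + 1| := by
    rw [← sq_eq_sq₀ (norm_nonneg _) (abs_nonneg _), sq_abs]; linarith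
  have n2 : ‖(w : ℂ) - 1‖ = |(w : ℂ).re - 1| := by
    rw [← sq_eq_sq₀ (norm_nonneg _) (abs_nonneg _), sq_abs]; linarith
  rcases le_total (w : ℂ).re (-1) with h1 | h1
  · refine ⟨1, one_mem _, ?_⟩
    have : (triMap w).re = 0 := by
      rw [triMap_re, triRe, n1, n2, abs_of_nonpos (by linarith), abs_of_nonpos (by linarith)]
      ring
    rw [one_smul]
    exact UpperHalfPlane.ext_re_im (by rw [reflect_re, this, neg_zero]) rfl
  rcases le_total 1 (w : ℂ).re with h2 | h2
  · refine ⟨U (-2), by simpa using U_mem_Gamma2 (-1), U_smul_eq_reflect ?_⟩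
    rw [triMap_re, triRe, n1, n2, abs_of_nonneg (by linarith), abs_of_nonneg (by linarith)]
    ring
  · refine ⟨Lo (-2), by simpa using Lo_mem_Gamma2 (-1), Lo_smul_eq_reflect ?_⟩
    rw [triMap_im_sq, triMap_re, triPow, n1, n2, abs_of_nonneg (by linarith),
      abs_of_nonpos (by linarith)]
    ring

theorem surfaceMap_of_nonpos (hN : conjGroup Γ N = Gamma2) {w : puncturedPlane}
    (h : (w : ℂ).im ≤ 0) : surfaceMap Γ N w = proj Γ (N • reflect (triMap w)) := by
  rcases h.lt_or_eq with h | h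
  · exact if_neg (not_le.2 h)
  · rw [surfaceMap_of_nonneg h.ge, proj_triMap_eq hN h]

theorem continuous_surfaceMap (hN : conjGroup Γ N = Gamma2) : Continuous (surfaceMap Γ N) := by
  have h1 := (continuous_proj Γ).comp (continuous_triMap.const_smul N)
  have h2 := (continuous_proj Γ).comp ((continuous_reflect.comp continuous_triMap).const_smul N)
  refine Continuous.if_le h1 h2 continuous_const
    (Complex.continuous_im.comp continuous_subtype_val) fun w hw => ?_
  exact proj_triMap_eq hN hw.symm

/-- Complex conjugation of the punctured plane. -/
def conjPlane (w : puncturedPlane) : puncturedPlane :=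
  ⟨(starRingEnd ℂ) w, fun e => w.2.1 (by simpa using congrArg (starRingEnd ℂ) e),
    fun e => w.2.2 (by simpa using congrArg (starRingEnd ℂ) e)⟩

theorem conjPlane_im (w : puncturedPlane) : (conjPlane w : ℂ).im = -(w : ℂ).im := rfl

theorem continuous_conjPlane : Continuous conjPlane :=
  (Complex.continuous_conj.comp continuous_subtype_val).subtype_mk _

theorem triMap_conjPlane (w : puncturedPlane) : triMap (conjPlane w) = triMap w := by
  have h1 : ‖(conjPlane w : ℂ) + 1‖ = ‖(w : ℂ) + 1‖ := by
    rw [← Complex.norm_conj ((w : ℂ) + 1)]; simp [conjPlane]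
  have h2 : ‖(conjPlane w : ℂ) - 1‖ = ‖(w : ℂ) - 1‖ := by
    rw [← Complex.norm_conj ((w : ℂ) - 1)]; simp [conjPlane]
  have hre : triRe (conjPlane w) = triRe w := by rw [triRe, triRe, h1, h2]
  apply UpperHalfPlane.ext_re_im
  · exact hre
  · rw [← sq_eq_sq₀ (UpperHalfPlane.im_pos _).le (UpperHalfPlane.im_pos _).le, triMap_im_sq,
      triMap_im_sq, hre, triPow, triPow, h1, h2]

theorem triInv_triMap {w : puncturedPlane} (h : 0 ≤ (w : ℂ).im) :
    (⟨triInv (triMap w), triInv_mem (triMap_mem w)⟩ : puncturedPlane) = w := by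
  have e := triMap_triInv (triMap_mem w)
  obtain ⟨h1, h2⟩ := triMap_eq_iff_norm (congrArg UpperHalfPlane.re e)
    (congrArg UpperHalfPlane.im e)
  refine Subtype.ext (Complex.ext h1 ?_)
  rcases h2 with h2 | h2
  · exact h2
  · have := triInv_im_nonneg (triMap w)
    simp only at h2
    rw [h2]
    linarith

theorem eq_of_proj_eq (hN : conjGroup Γ N = Gamma2) {v v' : ℍ} (hv : v ∈ quadrilateral)
    (hv' : v' ∈ quadrilateral) (h : proj Γ (N • v) = proj Γ (N • v')) :
    |v'.re| = |v.re| ∧ v'.im = v.im ∧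
      (v'.re = v.re ∨ |v.re| = 1 ∨ v.re ^ 2 + v.im ^ 2 = |v.re|) := by
  rw [proj_smul_eq_iff, hN] at h
  obtain ⟨g, hg, rfl⟩ := h
  rcases smul_eq_or_of_mem_quadrilateral hv hg hv' with e | ⟨e1, e2, e3⟩
  · rw [e]; exact ⟨rfl, rfl, Or.inl rfl⟩
  · exact ⟨by rw [e1, abs_neg], e2, Or.inr e3⟩

/-- Only opposite boundary points of the quadrilateral are identified, and these are the images of
the same real point under the two halves of the map. -/
theorem injective_surfaceMap (hN : conjGroup Γ N = Gamma2) :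
    Function.Injective (surfaceMap Γ N) := by
  have hpos : ∀ w : puncturedPlane, |(triMap w).re| = (triMap w).re := fun w =>
    abs_of_nonneg (triRe_nonneg w)
  have same : ∀ w w' : puncturedPlane, ((w : ℂ).im = -(w' : ℂ).im → (w : ℂ).im = (w' : ℂ).im) →
      (triMap w').re = (triMap w).re → (triMap w').im = (triMap w).im → w = w' := by
    intro w w' hs h1 h2
    obtain ⟨k1, k2⟩ := triMap_eq_iff_norm h1.symm h2.symm
    exact Subtype.ext (Complex.ext k1 (k2.elim id hs))
  -- points of the open lower half-plane and of the closed upper half-plane are not identified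
  have mixed : ∀ w w' : puncturedPlane, 0 ≤ (w : ℂ).im → (w' : ℂ).im < 0 →
      proj Γ (N • triMap w) ≠ proj Γ (N • reflect (triMap w')) := by
    intro w w' hw hw' h
    obtain ⟨h1, h2, h3⟩ := eq_of_proj_eq hN (triangle_subset (triMap_mem w))
      (reflect_mem_quadrilateral (triMap_mem w')) h
    rw [reflect_re, abs_neg, hpos, hpos] at h1
    rw [reflect_im] at h2
    rw [hpos, reflect_re] at h3
    have hw0 : (w : ℂ).im = 0 := im_eq_zero_of_triMap (h3.imp_left fun e => by linarith)
    obtain ⟨-, k2⟩ := triMap_eq_iff_norm h1.symm h2.symm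
    rcases k2 with k2 | k2 <;> linarith
  intro w w' h
  rcases le_or_gt 0 (w : ℂ).im with hw | hw <;> rcases le_or_gt 0 (w' : ℂ).im with hw' | hw'
  · rw [surfaceMap_of_nonneg hw, surfaceMap_of_nonneg hw'] at h
    obtain ⟨h1, h2, -⟩ := eq_of_proj_eq hN (triangle_subset (triMap_mem w))
      (triangle_subset (triMap_mem w')) h
    rw [hpos, hpos] at h1
    exact same w w' (fun e => by linarith) h1 h2
  · rw [surfaceMap_of_nonneg hw, surfaceMap_of_nonpos hN hw'.le] at h
    exact absurd h (mixed w w' hw hw')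
  · rw [surfaceMap_of_nonneg hw', surfaceMap_of_nonpos hN hw.le] at h
    exact absurd h.symm (mixed w' w hw' hw)
  · rw [surfaceMap_of_nonpos hN hw.le, surfaceMap_of_nonpos hN hw'.le] at h
    obtain ⟨h1, h2, -⟩ := eq_of_proj_eq hN (reflect_mem_quadrilateral (triMap_mem w))
      (reflect_mem_quadrilateral (triMap_mem w')) h
    rw [reflect_re, reflect_re, abs_neg, abs_neg, hpos, hpos] at h1
    rw [reflect_im, reflect_im] at h2
    exact same w w' (fun e => by linarith) h1 h2

theorem surfaceMap_triInv {z : ℍ} (h : z ∈ triangle) :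
    surfaceMap Γ N ⟨triInv z, triInv_mem h⟩ = proj Γ (N • z) := by
  rw [surfaceMap_of_nonneg (triInv_im_nonneg _), triMap_triInv h]

theorem surfaceMap_conjPlane_triInv (hN : conjGroup Γ N = Gamma2) {z : ℍ} (h : z ∈ triangle) :
    surfaceMap Γ N (conjPlane ⟨triInv z, triInv_mem h⟩) = proj Γ (N • reflect z) := by
  rw [surfaceMap_of_nonpos hN (by rw [conjPlane_im]; linarith [triInv_im_nonneg z]),
    triMap_conjPlane, triMap_triInv h]

theorem surjective_surfaceMap (hN : conjGroup Γ N = Gamma2) :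
    Function.Surjective (surfaceMap Γ N) := by
  intro x
  obtain ⟨z, rfl⟩ := proj_surjective Γ x
  obtain ⟨g, hg, hgz⟩ := exists_smul_mem_quadrilateral (N⁻¹ • z)
  have e : proj Γ z = proj Γ (N • g • N⁻¹ • z) := by
    conv_lhs => rw [← smul_inv_smul N z]
    rw [proj_smul_eq_iff, hN]
    exact ⟨g, hg, rfl⟩
  rw [e]
  rcases mem_triangle_or hgz with h | h
  · exact ⟨_, surfaceMap_triInv h⟩
  · exact ⟨_, by rw [surfaceMap_conjPlane_triInv hN h, reflect_reflect]⟩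

/-- The preimage in `ℍ` of the image of a closed set is the union of the translates of a closed
subset of the quadrilateral, which is locally finite. -/
theorem isClosedMap_surfaceMap (hN : conjGroup Γ N = Gamma2) : IsClosedMap (surfaceMap Γ N) := by
  intro C hC
  have hcl : ∀ C : Set puncturedPlane, IsClosed C →
      IsClosed {z : ℍ | ∃ h : z ∈ triangle, (⟨triInv z, triInv_mem h⟩ : puncturedPlane) ∈ C} := by
    intro C hC
    have h1 : Continuous fun z : triangle => (⟨triInv z, triInv_mem z.2⟩ : puncturedPlane) :=
      (continuous_triInv.comp continuous_subtype_val).subtype_mk _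
    have h2 := isClosed_triangle.isClosedEmbedding_subtypeVal.isClosedMap _ (hC.preimage h1)
    convert h2 using 1
    ext z
    constructor
    · rintro ⟨h, hz⟩
      exact ⟨⟨z, h⟩, hz, rfl⟩
    · rintro ⟨⟨z, h⟩, hz, rfl⟩
      exact ⟨h, hz⟩
  set T := {z : ℍ | ∃ h : z ∈ triangle, (⟨triInv z, triInv_mem h⟩ : puncturedPlane) ∈ C} with hT
  set T' := {z : ℍ | ∃ h : z ∈ triangle,
    (⟨triInv z, triInv_mem h⟩ : puncturedPlane) ∈ conjPlane ⁻¹' C} with hT'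
  have hE : IsClosed (T ∪ reflect ⁻¹' T') :=
    (hcl C hC).union ((hcl _ (hC.preimage continuous_conjPlane)).preimage continuous_reflect)
  have hq : T ∪ reflect ⁻¹' T' ⊆ quadrilateral := by
    rintro z (⟨h, -⟩ | ⟨h, -⟩)
    · exact triangle_subset h
    · rw [← reflect_reflect z]; exact reflect_mem_quadrilateral h
  have hquot : Topology.IsQuotientMap fun z : ℍ => proj Γ (N • z) :=
    Topology.IsQuotientMap.comp (g := proj Γ) isQuotientMap_quotient_mk'
      (Homeomorph.smul N).isQuotientMap
  rw [← hquot.isClosed_preimage]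
  convert isClosed_iUnion_smul hE hq using 1
  ext z
  simp only [Set.mem_preimage, Set.mem_iUnion]
  constructor
  · rintro ⟨w, hw, e⟩
    obtain ⟨v, hv, hvw⟩ : ∃ v ∈ T ∪ reflect ⁻¹' T', surfaceMap Γ N w = proj Γ (N • v) := by
      rcases le_total 0 (w : ℂ).im with h | h
      · exact ⟨triMap w, Or.inl ⟨triMap_mem w, by rwa [triInv_triMap h]⟩, surfaceMap_of_nonneg h⟩
      · refine ⟨reflect (triMap w), Or.inr ?_, surfaceMap_of_nonpos hN h⟩
        rw [Set.mem_preimage, reflect_reflect]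
        refine ⟨triMap_mem w, ?_⟩
        have h1 := triInv_triMap (w := conjPlane w) (by rw [conjPlane_im]; linarith)
        simp only [triMap_conjPlane] at h1
        rw [Set.mem_preimage, h1]
        convert hw using 1
        exact Subtype.ext (Complex.conj_conj _)
    rw [hvw, proj_smul_eq_iff, hN] at e
    obtain ⟨g, hg, rfl⟩ := e
    exact ⟨⟨g, hg⟩, v, hv, rfl⟩
  · rintro ⟨⟨g, hg⟩, v, hv, rfl⟩
    have e : proj Γ (N • (g • v)) = proj Γ (N • v) := by
      rw [eq_comm, proj_smul_eq_iff, hN]; exact ⟨g, hg, rfl⟩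
    change proj Γ (N • (g • v)) ∈ _
    rw [e]
    rcases hv with ⟨h, hz⟩ | ⟨h, hz⟩
    · exact ⟨_, hz, surfaceMap_triInv h⟩
    · exact ⟨_, hz, by rw [surfaceMap_conjPlane_triInv hN h, reflect_reflect]⟩

theorem isClosedEmbedding_surfaceMap (hN : conjGroup Γ N = Gamma2) :
    Topology.IsClosedEmbedding (surfaceMap Γ N) :=
  .of_continuous_injective_isClosedMap (continuous_surfaceMap hN) (injective_surfaceMap hN)
    (isClosedMap_surfaceMap hN)

end

/-! ### The cusps -/

theorem isParabolic_of_sq_tr {X : SL(2, ℝ)} (h : tr X ^ 2 = 4) (h01 : X 0 1 ≠ 0 ∨ X 1 0 ≠ 0) :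
    (X : Matrix (Fin 2) (Fin 2) ℝ).IsParabolic := by
  constructor
  · rintro ⟨r, hr⟩
    have h1 : X 0 1 = 0 := by rw [← hr]; simp
    have h2 : X 1 0 = 0 := by rw [← hr]; simp
    rcases h01 with h | h
    · exact h h1
    · exact h h2
  · rw [Matrix.discr_fin_two, Matrix.trace_fin_two, X.det_coe]
    rw [tr] at h
    linarith

theorem entry_ne_zero_of_conj {X N : SL(2, ℝ)} (h : X ≠ 1 ∧ X ≠ -1) (ht : tr X ^ 2 = 4) :
    (N * X * N⁻¹) 0 1 ≠ 0 ∨ (N * X * N⁻¹) 1 0 ≠ 0 := by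
  by_contra hcon
  push Not at hcon
  obtain ⟨h1, h2⟩ := hcon
  have e : X = N⁻¹ * (N * X * N⁻¹) * N := by group
  rw [← tr_conj N X, tr] at ht
  have hd := det_entries (N * X * N⁻¹)
  set Y := N * X * N⁻¹
  rw [h1, h2] at hd
  have h3 : (Y 0 0 - Y 1 1) ^ 2 = 0 := by linear_combination ht - 4 * hd
  have h4 : Y 1 1 = Y 0 0 := by have := pow_eq_zero_iff two_ne_zero |>.1 h3; linarith
  rw [h4] at hd
  rcases mul_self_eq_one_iff.1 (by linarith : Y 0 0 * Y 0 0 = 1) with h5 | h5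
  · have : Y = 1 := by apply ext_entries <;> simp [h1, h2, h4, h5]
    exact h.1 (by rw [e, this]; group)
  · have : Y = -1 := by apply ext_entries <;> simp [h1, h2, h4, h5]
    exact h.2 (by rw [e, this]; simp)

section

variable {Γ : Subgroup SL(2, ℝ)} {N : SL(2, ℝ)}

/-- A loop with a lift that consists of two arcs and is closed up by a parabolic element. -/
theorem isParabolicLoop_of_arcs (hN : conjGroup Γ N = Gamma2) {u : I → Surface Γ} {F G : I → ℍ}
    {X : SL(2, ℝ)} (hF : Continuous F) (hG : Continuous G)
    (hFu : ∀ t : I, (t : ℝ) ≤ 1 / 2 → u t = proj Γ (N • F t))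
    (hGu : ∀ t : I, 1 / 2 ≤ (t : ℝ) → u t = proj Γ (N • G t))
    (hFG : ∀ t : I, (t : ℝ) = 1 / 2 → F t = G t) (hX : X ∈ Gamma2) (hXz : G 1 = X • F 0)
    (hX1 : X ≠ 1 ∧ X ≠ -1) (ht : tr X ^ 2 = 4) : IsParabolicLoop Γ u := by
  have hP : Continuous fun t : I => if (t : ℝ) ≤ 1 / 2 then F t else G t :=
    Continuous.if_le hF hG continuous_subtype_val continuous_const hFG
  rw [← hN, mem_conjGroup] at hX
  have h0 : ((0 : I) : ℝ) ≤ 1 / 2 := by norm_num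
  have h1 : ¬ ((1 : I) : ℝ) ≤ 1 / 2 := by norm_num
  have e : N • G 1 = (N * X * N⁻¹) • N • F 0 := by
    rw [hXz, mul_smul, mul_smul, inv_smul_smul]
  obtain ⟨k1, k2⟩ := And.intro (entry_ne_zero_of_conj (N := N) hX1 ht)
    (show tr (N * X * N⁻¹) ^ 2 = 4 by rw [tr_conj, ht])
  have hw : ∀ t : I, proj Γ (N • if (t : ℝ) ≤ 1 / 2 then F t else G t) = u t := by
    intro t
    split_ifs with h
    · exact (hFu t h).symm
    · exact (hGu t (not_le.1 h).le).symm
  rcases hX with hX | hX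
  · refine ⟨⟨_, hP.const_smul N⟩, _, hw, hX, ?_, isParabolic_of_sq_tr k2 k1⟩
    simp only [ContinuousMap.coe_mk, Pi.smul_apply, if_pos h0, if_neg h1]
    exact e
  · refine ⟨⟨_, hP.const_smul N⟩, _, hw, hX, ?_, isParabolic_of_sq_tr ?_ ?_⟩
    · simp only [ContinuousMap.coe_mk, Pi.smul_apply, if_pos h0, if_neg h1]
      rw [neg_smul']
      exact e
    · rw [tr_neg, neg_sq, k2]
    · simpa only [neg_entry, neg_ne_zero] using k1

theorem unitCircle_im (t : I) : (unitCircle t).im = Real.sin (2 * Real.pi * t) := by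
  rw [unitCircle, ← Complex.exp_ofReal_mul_I_im]
  push_cast
  rfl

theorem unitCircle_im_nonneg {t : I} (h : (t : ℝ) ≤ 1 / 2) : 0 ≤ (unitCircle t).im := by
  rw [unitCircle_im]
  apply Real.sin_nonneg_of_nonneg_of_le_pi
  · have := t.2.1; positivity
  · nlinarith [Real.pi_pos]

theorem unitCircle_im_nonpos {t : I} (h : 1 / 2 ≤ (t : ℝ)) : (unitCircle t).im ≤ 0 := by
  rw [unitCircle_im, ← Real.sin_sub_two_pi]
  apply Real.sin_nonpos_of_nonpos_of_neg_pi_le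
  · have := t.2.2; nlinarith [Real.pi_pos]
  · nlinarith [Real.pi_pos]

theorem unitCircle_half {t : I} (h : (t : ℝ) = 1 / 2) : unitCircle t = -1 := by
  rw [unitCircle, h, ← Complex.exp_pi_mul_I]
  congr 1
  push_cast
  ring

theorem triMap_re_eq {w : puncturedPlane} {r s : ℝ} (h1 : ‖(w : ℂ) + 1‖ = r)
    (h2 : ‖(w : ℂ) - 1‖ = s) : (triMap w).re = (2 + r - s) / 4 := by
  rw [triMap_re, triRe, h1, h2]

theorem triMap_zero {w : puncturedPlane} (h : (w : ℂ) = 0) :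
    (triMap w).re ^ 2 + (triMap w).im ^ 2 = (triMap w).re := by
  rw [triMap_im_sq, triMap_re, triPow, triRe, h]
  norm_num

/-- The map `surfaceMap` is a parametrisation by the three-holed sphere, and the loops around the
three holes have parabolic holonomy. -/
theorem isThreeCuspedSphere_of_conjGroup_eq (hN : conjGroup Γ N = Gamma2) :
    IsThreeCuspedSphere Γ := by
  set φ := pantsModelHomeomorph
  have hemb : Topology.IsClosedEmbedding (surfaceMap Γ N ∘ φ) :=
    (isClosedEmbedding_surfaceMap hN).comp φ.isClosedEmbedding
  have hU2 : U (-2) ∈ Gamma2 := by simpa using U_mem_Gamma2 (-1)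
  have hL2 : Lo (-2) ∈ Gamma2 := by simpa using Lo_mem_Gamma2 (-1)
  refine ⟨_, ⟨hemb, fun i _ => ⟨?_, rfl⟩, fun i hi => absurd (Set.mem_univ i) hi⟩,
    (surjective_surfaceMap hN).comp φ.surjective⟩
  have hc : ∀ i, Continuous fun t => triMap (φ (holeLoop Set.univ i t)) := by
    intro i
    refine continuous_triMap.comp (φ.continuous.comp ?_)
    refine Topology.IsEmbedding.subtypeVal.continuous_iff.2 ?_
    have : (Subtype.val ∘ holeLoop Set.univ i) = fun t => holeParam i (loopRadius i) t :=
      funext fun t => holeLoop_eq _ i t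
    rw [this]
    exact (continuous_holeParam i).comp (continuous_const.prodMk continuous_id)
  have hne : ∀ X : SL(2, ℝ), X 0 1 ≠ 0 ∨ X 1 0 ≠ 0 → X ≠ 1 ∧ X ≠ -1 := by
    rintro X h
    constructor <;> rintro rfl <;> simp at h
  have hre : ∀ z : ℍ, z.re = 0 → reflect z = z := fun z h =>
    UpperHalfPlane.ext_re_im (by rw [reflect_re, h, neg_zero]) rfl
  have hi : i = 0 ∨ i = 1 ∨ i = 2 := by fin_cases i <;> simp
  rcases hi with rfl | rfl | rfl
  · -- the lift runs from the side between `0` and `1` through the imaginary axis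
    have hA : ∀ t, (φ (holeLoop Set.univ 0 t) : ℂ) = -1 + unitCircle t := pantsModelHomeomorph_loopA
    refine isParabolicLoop_of_arcs hN (hc 0) (continuous_reflect.comp (hc 0)) (fun t ht => ?_)
      (fun t ht => ?_) (fun t ht => ?_) hL2 ?_ (hne _ (by simp [Lo])) (by norm_num [tr, Lo])
    · exact surfaceMap_of_nonneg (by rw [hA]; simpa using unitCircle_im_nonneg ht)
    · exact surfaceMap_of_nonpos hN (by rw [hA]; simpa using unitCircle_im_nonpos ht)
    · refine (hre _ ?_).symm
      rw [triMap_re_eq (r := 1) (s := 3)]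
      · norm_num
      · rw [hA, unitCircle_half ht]; norm_num
      · rw [hA, unitCircle_half ht]; norm_num
    · have e : φ (holeLoop Set.univ 0 1) = φ (holeLoop Set.univ 0 0) :=
        Subtype.ext (by rw [hA, hA, unitCircle_one, unitCircle_zero])
      rw [Lo_smul_eq_reflect (triMap_zero (by rw [hA, unitCircle_zero]; ring)), Function.comp_apply,
        e]
  · have hB : ∀ t, (φ (holeLoop Set.univ 1 t) : ℂ) = 1 - unitCircle t := pantsModelHomeomorph_loopB
    refine isParabolicLoop_of_arcs hN (X := U (-2) * Lo 2) (continuous_reflect.comp (hc 1))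
      ((hc 1).const_smul (U (-2))) (fun t ht => ?_) (fun t ht => ?_) (fun t ht => ?_)
      (mul_mem hU2 (by simpa using Lo_mem_Gamma2 1)) ?_
      (hne _ (by rw [mul_entry, mul_entry]; simp [Lo, U]))
      (by rw [tr, mul_entry, mul_entry]; simp [Lo, U]; norm_num)
    · exact surfaceMap_of_nonpos hN (by rw [hB]; simpa using unitCircle_im_nonneg ht)
    · have h1 : surfaceMap Γ N (φ (holeLoop Set.univ 1 t)) = _ :=
        surfaceMap_of_nonneg (by rw [hB]; simpa using unitCircle_im_nonpos ht)
      refine h1.trans ?_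
      rw [proj_smul_eq_iff, hN]
      exact ⟨_, hU2, rfl⟩
    · refine (U_smul_eq_reflect ?_).symm
      rw [triMap_re_eq (r := 3) (s := 1)]
      · norm_num
      · rw [hB, unitCircle_half ht]; norm_num
      · rw [hB, unitCircle_half ht]; norm_num
    · have e : φ (holeLoop Set.univ 1 1) = φ (holeLoop Set.univ 1 0) :=
        Subtype.ext (by rw [hB, hB, unitCircle_one, unitCircle_zero])
      rw [Function.comp_apply,
        ← Lo_smul_eq_reflect (triMap_zero (by rw [hB, unitCircle_zero]; ring)), mul_smul,
        ← mul_smul (Lo 2), ← Lo_add, add_neg_cancel, Lo_zero, one_smul, Pi.smul_apply, e]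
  · have hC : ∀ t, (φ (holeLoop Set.univ 2 t) : ℂ) = 5 * unitCircle t := pantsModelHomeomorph_loopC
    refine isParabolicLoop_of_arcs hN (hc 2) (continuous_reflect.comp (hc 2)) (fun t ht => ?_)
      (fun t ht => ?_) (fun t ht => ?_) hU2 ?_ (hne _ (by simp [U])) (by norm_num [tr, U])
    · exact surfaceMap_of_nonneg (by rw [hC]; simpa using unitCircle_im_nonneg ht)
    · exact surfaceMap_of_nonpos hN (by
        have := unitCircle_im_nonpos ht
        rw [hC]; simp; linarith)
    · refine (hre _ ?_).symm
      rw [triMap_re_eq (r := 4) (s := 6)]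
      · norm_num
      · rw [hC, unitCircle_half ht]; norm_num
      · rw [hC, unitCircle_half ht]; norm_num
    · have e : φ (holeLoop Set.univ 2 1) = φ (holeLoop Set.univ 2 0) :=
        Subtype.ext (by rw [hC, hC, unitCircle_one, unitCircle_zero])
      rw [Function.comp_apply, U_smul_eq_reflect, e]
      rw [triMap_re_eq (r := 6) (s := 4)]
      · norm_num
      · rw [hC, unitCircle_zero]; norm_num
      · rw [hC, unitCircle_zero]; norm_num

end

/-- The three-cusped sphere is the quotient of `ℍ` by the congruence subgroup of level two, up to
isometry. -/
theorem isThreeCuspedSphere_iff {Γ : Subgroup SL(2, ℝ)} (hΓ : IsSurfaceGroup Γ) :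
    IsThreeCuspedSphere Γ ↔ ∃ N, conjGroup Γ N = Gamma2 :=
  ⟨exists_conjGroup_eq_of_isThreeCuspedSphere hΓ,
    fun ⟨_, hN⟩ => isThreeCuspedSphere_of_conjGroup_eq hN⟩

end HyperbolicPants

end

theorem mainTheorem4 :
    -- the length formula in a pair of pants
    (∀ Γ : Subgroup SL(2, ℝ), HyperbolicPants.IsSurfaceGroup Γ →
      ∀ (J : Set (Fin 3)) (h : HyperbolicPants.pantsModel J → HyperbolicPants.Surface Γ)
        (L : Fin 3 → ℝ), HyperbolicPants.IsPairOfPants Γ J h L →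
      ∀ (c : ℝ → HyperbolicPants.Surface Γ) (ℓ : ℝ), HyperbolicPants.IsClosedGeodesic Γ c ℓ →
        HyperbolicPants.FreelyHomotopic (fun t : unitInterval => c (ℓ * t))
          (fun t => h (HyperbolicPants.figureEight J t)) →
        Real.cosh (ℓ / 2) =
          2 * Real.cosh (L 0 / 2) * Real.cosh (L 1 / 2) + Real.cosh (L 2 / 2)) ∧
    -- the lower bound, with the case of equality
    (∀ Γ : Subgroup SL(2, ℝ), HyperbolicPants.IsSurfaceGroup Γ →
      ∀ (c : ℝ → HyperbolicPants.Surface Γ) (ℓ : ℝ), HyperbolicPants.IsClosedGeodesic Γ c ℓ →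
        HyperbolicPants.HasExactlyOneDoublePoint c ℓ →
        2 * Real.arcosh 3 ≤ ℓ ∧
          (ℓ = 2 * Real.arcosh 3 ↔ HyperbolicPants.IsThreeCuspedSphere Γ)) ∧
    -- the bound is attained on the three-cusped sphere
    (∀ Γ : Subgroup SL(2, ℝ), HyperbolicPants.IsSurfaceGroup Γ →
      HyperbolicPants.IsThreeCuspedSphere Γ →
      ∃ c : ℝ → HyperbolicPants.Surface Γ,
        HyperbolicPants.IsClosedGeodesic Γ c (2 * Real.arcosh 3) ∧
        HyperbolicPants.HasExactlyOneDoublePoint c (2 * Real.arcosh 3)) ∧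
    2 * Real.arcosh 3 = 2 * Real.log (3 + 2 * √2) := by
  refine ⟨?_, fun Γ hΓ c l hc hd => ?_, fun Γ hΓ h => ?_, by rw [HyperbolicPants.arcosh_three]⟩
  · exact fun Γ hΓ J h L hP c l hc hch => hP.cosh_length hΓ hc hch
  · rw [HyperbolicPants.isThreeCuspedSphere_iff hΓ]
    exact hd.le_length hΓ hc
  · obtain ⟨N, hN⟩ := (HyperbolicPants.isThreeCuspedSphere_iff hΓ).1 h
    exact HyperbolicPants.exists_length_eq hN
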